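/- Let $q\ge 1$. A gate is a unitary $u$ on $\mathbb C^q\otimes\mathbb C^q$. In a brick-wall circuit on the chain $\mathbb Z$ of $q$-level sites, layer $s\ge 1$ is $\tilde U(s)=\bigotimes_{i\equiv s\ (\mathrm{mod}\ 2)}u_{i,i+1}^{(s)}$, and $U(t)=\tilde U(1)\cdots\tilde U(t)$, $A(t)=U(t)^\dagger A\,U(t)$. The circuit is either *spatial-temporal invariant* (all $u^{(s)}_{i,i+1}$ equal one gate $u$) or *spatial-temporal random* (the $u^{(s)}_{i,i+1}$ are i.i.d. random gates); in the second case, overlines below denote the ensemble average, and in the first case they are void. *OTOC.* For $j,k\in\{0,\dots,q-1\}$ and $\mu=j+qk$, let $\sigma^\mu=\sum_{m=0}^{q-1}e^{2\pi i jm/q}\,|m+k\rangle\langle m|$ (with $m+k$ modulo $q$), and let $\sigma^\mu(x)$ be this operator at site $x$, $\sigma^\mu(x,t)$ its evolution. With $\langle\cdot\rangle$ the normalized trace, put, for $w\ge1$ and $\tau\ge0$, $$C_{\mu\nu}(w,\tau)=\overline{1-\big\langle \sigma^\mu(0,t)^\dagger\,\sigma^\nu(x)^\dagger\,\sigma^\mu(0,t)\,\sigma^\nu(x)\big\rangle},\qquad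 x=w-1-\tau,\quad t=w-1+\tau .$$ *Light-like generator.* On the replicated one-site operator space $\mathrm{End}(\mathbb C^q)\otimes_{\mathrm k}\mathrm{End}(\mathbb C^q)$ with the Hilbert-Schmidt inner product let $|0\rangle=\mathbb I\otimes_{\mathrm k}\mathbb I/\sqrt q$ and $|1\rangle=\mathbb S/\sqrt q$, with $\mathbb S$ the swap of the two replicas. Let $\mathcal U_2$ be the superoperator $O\mapsto (u\otimes_{\mathrm k}u)^\dagger\,O\,(u\otimes_{\mathrm k}u)$ on two sites. The light-like generator of width $w$, $$T_w=(0|\,\textstyle\bigodot_{k=1}^{w}\overline{\mathcal U_2}\,|1),$$ acts on the replicated operators of $w$ sites as follows: insert $|0\rangle$ at a new site to the left of the sites $1,\dots,w$; apply $\overline{\mathcal U_2}$ to the sites $(0,1)$, then $(1,2)$, ..., then $(w-1,w)$; contract the rightmost site $w$ with $\langle 1|$. Let $F_w=T_w-|0^w\rangle\langle 1^w|$. Let $z_2(w)$ be an eigenvalue of $F_w$ of largest modulus (the subleading eigenvalue of $T_w$), and let $\varphi(w)$ be the maximum of $N-1$ over the dimensions $N$ of the Jordan blocks of $F_w$ whose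 eigenvalue has modulus $|z_2(w)|$. **Theorem.** Let $w\ge 2$. If for some $\mu,\nu$ $$\liminf_{\tau\to\infty}\frac{\mathrm{Re}\,C_{\mu\nu}(w,\tau)}{\tau^{\varphi(w)}\,|z_2(w)|^\tau}>0$$ (in particular $z_2(w)\ne0$), then $|z_2(w)|=|z_2(w-1)|$. -/

import Mathlib

open Filter MeasureTheory

noncomputable section

namespace LLG

/-- Two-site gates: unitaries on `ℂ^q ⊗ ℂ^q`; the first index is the left site. -/
abbrev Gate (q : ℕ) : Type := Matrix.unitaryGroup (Fin q × Fin q) ℂ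

/-- The generalized Pauli matrix `σ^{j,k} = ∑ m, ω^{j m} |m + k⟩⟨m|`, with `ω = e^{2πi/q}` and
`m + k` taken modulo `q`; the label `μ = (j, k)` stands for `j + q k`. -/
def pauli {q : ℕ} (μ : Fin q × Fin q) : Matrix (Fin q) (Fin q) ℂ :=
  Matrix.of fun a b =>
    if (a : ℕ) = ((b : ℕ) + (μ.2 : ℕ)) % q then
      Complex.exp (2 * Real.pi * Complex.I / q) ^ ((μ.1 : ℕ) * (b : ℕ))
    else 0

/-! ### The brick-wall circuit and the out-of-time-order correlator -/

/-- The sites of the open chain `{-L, …, L}`. -/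
abbrev Site (L : ℕ) : Type := Set.Icc (-(L : ℤ)) (L : ℤ)

/-- Operators on the chain `{-L, …, L}` of `q`-level sites. -/
abbrev ChainOp (q L : ℕ) : Type := Matrix (Site L → Fin q) (Site L → Fin q) ℂ

/-- The one-site operator `A` acting at site `x` of the chain (`1` if `x` is not in the chain). -/
def siteOp {q : ℕ} (L : ℕ) (A : Matrix (Fin q) (Fin q) ℂ) (x : ℤ) : ChainOp q L :=
  if hx : x ∈ Set.Icc (-(L : ℤ)) (L : ℤ) then
    Matrix.of fun a b =>
      if ∀ k : Site L, (k : ℤ) ≠ x → a k = b k then A (a ⟨x, hx⟩) (b ⟨x, hx⟩) else 0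
  else 1

/-- The two-site operator `v` acting on the bond `(i, i + 1)` of the chain
(`1` if one of these sites is not in the chain). -/
def bondOp {q : ℕ} (L : ℕ) (v : Matrix (Fin q × Fin q) (Fin q × Fin q) ℂ) (i : ℤ) : ChainOp q L :=
  if h : i ∈ Set.Icc (-(L : ℤ)) (L : ℤ) ∧ i + 1 ∈ Set.Icc (-(L : ℤ)) (L : ℤ) then
    Matrix.of fun a b =>
      if ∀ k : Site L, (k : ℤ) ≠ i → (k : ℤ) ≠ i + 1 → a k = b k then
        v (a ⟨i, h.1⟩, a ⟨i + 1, h.2⟩) (b ⟨i, h.1⟩, b ⟨i + 1, h.2⟩)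
      else 0
  else 1

/-- The layer `Ũ(s)` of the brick-wall circuit whose gate on the bond `(i, i + 1)` in layer `s` is
`g (i, s)`: the product over all bonds of the chain with `i ≡ s` modulo `2` (these gates commute).
The index `k` stands for the bond `i = k - L`. -/
def layer {q : ℕ} (L : ℕ) (g : ℤ × ℕ → Gate q) (s : ℕ) : ChainOp q L :=
  ((List.range (2 * L)).map fun k : ℕ =>
    if ((k : ℤ) - L) % 2 = (s : ℤ) % 2 then
      bondOp L (g ((k : ℤ) - L, s) : Matrix (Fin q × Fin q) (Fin q × Fin q) ℂ) ((k : ℤ) - L)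
    else 1).prod

/-- The evolution operator `U(t) = Ũ(1) Ũ(2) ⋯ Ũ(t)`. -/
def evolution {q : ℕ} (L : ℕ) (g : ℤ × ℕ → Gate q) (t : ℕ) : ChainOp q L :=
  ((List.range t).map fun s => layer L g (s + 1)).prod

/-- Heisenberg evolution `A(t) = U(t)† A U(t)`. -/
def heisenberg {q : ℕ} (L : ℕ) (g : ℤ × ℕ → Gate q) (t : ℕ) (A : ChainOp q L) : ChainOp q L :=
  (evolution L g t).conjTranspose * A * evolution L g t

/-- The infinite-temperature expectation value `⟨A⟩ = tr A / tr 1`. -/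
def expval {q L : ℕ} (A : ChainOp q L) : ℂ :=
  A.trace / (1 : ChainOp q L).trace

/-- The out-of-time-order correlator
`C̃_{μν}(x,t) = 1 - ⟨σ^μ(0,t)† σ^ν(x,0)† σ^μ(0,t) σ^ν(x,0)⟩`.
The light cone of `σ^μ(0,t)` is contained in `{-t, …, t}`, so on the chain `{-L, …, L}` with
`L = t + |x|` this is the value in the infinite system. -/
def otocXT {q : ℕ} (g : ℤ × ℕ → Gate q) (μ ν : Fin q × Fin q) (x : ℤ) (t : ℕ) : ℂ :=
  let L := t + x.natAbs
  let A := heisenberg L g t (siteOp L (pauli μ) 0)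
  let B := siteOp L (pauli ν) x
  1 - expval (A.conjTranspose * B.conjTranspose * A * B)

/-- The out-of-time-order correlator in light-cone coordinates, `C_{μν}(w,τ) = C̃_{μν}(x,t)` with
`x = (w - 1) - τ` and `t = (w - 1) + τ` (so `x = -t` is the edge of the light cone for `w = 1`);
meant for `1 ≤ w`. -/
def otoc {q : ℕ} (g : ℤ × ℕ → Gate q) (μ ν : Fin q × Fin q) (w τ : ℕ) : ℂ :=
  otocXT g μ ν ((w : ℤ) - 1 - τ) (w - 1 + τ)

/-! ### The light-like generator -/

/-- Basis labels of the replicated one-site operator space `End(ℂ^q) ⊗ₖ End(ℂ^q)`: the operator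
`X ⊗ₖ Y` is the vector with entries `((a, b), (c, d)) ↦ X a b * Y c d`. -/
abbrev Rep (q : ℕ) : Type := (Fin q × Fin q) × (Fin q × Fin q)

/-- The state `|0⟩ = 𝕀 ⊗ₖ 𝕀 / √q`. -/
def ket0 {q : ℕ} (p : Rep q) : ℂ :=
  if p.1.1 = p.1.2 ∧ p.2.1 = p.2.2 then ((Real.sqrt q : ℝ) : ℂ)⁻¹ else 0

/-- The state `|1⟩ = 𝕊 / √q`, with `𝕊` the swap of the two replicas. -/
def ket1 {q : ℕ} (p : Rep q) : ℂ :=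
  if p.1.1 = p.2.2 ∧ p.2.1 = p.1.2 then ((Real.sqrt q : ℝ) : ℂ)⁻¹ else 0

/-- The replicated gate `𝒰₂`: the matrix of `O ↦ (u ⊗ₖ u)† O (u ⊗ₖ u)` on
`End(ℂ^q ⊗ ℂ^q) ⊗ₖ End(ℂ^q ⊗ ℂ^q)`. The row `(l', r')` is the output, the column `(l, r)` the
input, each with a left and a right site. -/
def replica {q : ℕ} (u : Gate q) : Matrix (Rep q × Rep q) (Rep q × Rep q) ℂ :=
  Matrix.of fun o i =>
    star (u.1 (i.1.1.1, i.2.1.1) (o.1.1.1, o.2.1.1)) * u.1 (i.1.1.2, i.2.1.2) (o.1.1.2, o.2.1.2) *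
      (star (u.1 (i.1.2.1, i.2.2.1) (o.1.2.1, o.2.2.1)) *
        u.1 (i.1.2.2, i.2.2.2) (o.1.2.2, o.2.2.2))

/-- The ensemble average of the replicated gate, for a random gate `u`. -/
def avgReplica {q : ℕ} {Ω : Type*} [MeasurableSpace Ω] (P : Measure Ω) (u : Ω → Gate q) :
    Matrix (Rep q × Rep q) (Rep q × Rep q) ℂ :=
  Matrix.of fun o i => ∫ ω, replica (u ω) o i ∂P

/-- The light-like generator `T_w = (0| ⨀_{k=1}^{w} 𝒰₂ |1)` of width `w`, for the (possibly
averaged) replicated gate `V`. An auxiliary line enters in the state `0` at the left, crosses the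
sites `1, …, w` from left to right through one copy of `V` each, and leaves at the right, where it
is contracted with `1`; `m k` is its label after `k` crossings. -/
def T {q : ℕ} (V : Matrix (Rep q × Rep q) (Rep q × Rep q) ℂ) (w : ℕ) :
    Matrix (Fin w → Rep q) (Fin w → Rep q) ℂ :=
  Matrix.of fun i j =>
    ∑ m : Fin (w + 1) → Rep q,
      ket0 (m 0) * (∏ k : Fin w, V (i k, m k.succ) (m k.castSucc, j k)) * ket1 (m (Fin.last w))

/-- The generator with the trivial leading eigenvalue `1` removed:
`F_w = T_w - |0^w⟩⟨1^w|`. -/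
def F {q : ℕ} (V : Matrix (Rep q × Rep q) (Rep q × Rep q) ℂ) (w : ℕ) :
    Matrix (Fin w → Rep q) (Fin w → Rep q) ℂ :=
  Matrix.of fun i j => T V w i j - (∏ k, ket0 (i k)) * ∏ k, star (ket1 (j k))

/-- `|z₂(w)|`: the modulus of the leading eigenvalue of `F_w`, that is, of the subleading
eigenvalue of `T_w`. -/
def absZ2 {q : ℕ} (V : Matrix (Rep q × Rep q) (Rep q × Rep q) ℂ) (w : ℕ) : ℝ :=
  sSup {r : ℝ | ∃ z : ℂ, Module.End.HasEigenvalue (Matrix.toLin' (F V w)) z ∧ r = ‖z‖}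

/-- `φ(w)`: the maximum of `N - 1` over the dimensions `N` of the Jordan blocks of `F_w` whose
eigenvalue has modulus `|z₂(w)|`. The largest Jordan block for an eigenvalue `z` has dimension
`maxGenEigenspaceIndex _ z`, the least `N` for which `ker (F_w - z)^N` is the whole generalized
eigenspace. -/
def phi {q : ℕ} (V : Matrix (Rep q × Rep q) (Rep q × Rep q) ℂ) (w : ℕ) : ℕ :=
  sSup {n : ℕ | ∃ z : ℂ, Module.End.HasEigenvalue (Matrix.toLin' (F V w)) z ∧ ‖z‖ = absZ2 V w ∧
    n = Module.End.maxGenEigenspaceIndex (Matrix.toLin' (F V w)) z - 1}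

end LLG

end

/-!
The light-like generator of width `w` governs the correlator in light-cone coordinates, so a
priori the correlator decays at the rate `|z₂(w)|`. It is shown that it decays in fact at every
rate above `|z₂(w - 1)|` (`exists_re_integral_otoc_le`). Since `|z₂(w - 1)| ≤ |z₂(w)|`
(`absZ2_le_succ`), a correlator that decays no faster than `τ^φ |z₂(w)|^τ` forces equality; the
size `φ` of the Jordan blocks plays no role, because `τ^φ ≥ 1`.

*Monotonicity.* A left eigenvector of `F_{w-1}` becomes a left eigenvector of `F_w` for the same
eigenvalue when `(1|` is appended to it, since the last gate preserves `(1| ⊗ (1|`.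

*The correlator as a weight.* Let `X` be the operator `σ^μ(0, t)` and `x` its replicated form
`X† ⊗ₖ X` (`dens`), whose pairing with nonnegative functionals is nonnegative. By unitarity only the
gates in a rectangle of `τ` rows of `w` gates matter (`siteFun_dotProduct_circuit`), by
independence each replicated gate may be replaced with its average
(`integral_dotProduct_prod_mulVec`), and the real part of the correlator is the expectation of a
functional `N` of one site that is positive semidefinite and vanishes on the identity: up to
normalization `N` is half the square norm of `O - σ^ν† O σ^ν`. This positivity survives the
average, since each replicated gate preserves it (`IsChannel`).

*The decay.* Put `v = w - 1`. After `b` rows let `p b` be the weight of the part of the operator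
that is not the identity on the first `v` of the `w` output sites. The last gate of each row does
not affect these sites, so `p b` is a matrix element of `T_v^b`; as the functional annihilates the
trivial eigenvector, `p b = O(r^b)` for every `r > |z₂(v)|` (`lift_dotProduct_rowProd`). Let
further `M = ∑ r^{-k} N T_1^k`, which converges because `|z₂(1)| ≤ |z₂(v)| < r`; it is positive,
dominates `N` and satisfies `M T_1 = r (M - N) ≤ r M` (`exists_lyapunov`). Let `m b` be the weight
`M` on the last output site after `b` rows. In the next row, split the operator into the part
where the auxiliary line carries the identity when it reaches the last gate, and the rest. On the
first part the last gate acts as `T_1` and contracts `M` by `r`. The second part is bounded by a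
multiple of `p b`, because a row maps the identity to the identity and back. The splitting costs a
factor `1 + δ`, as the weights are quadratic in the operator, hence
`m (b + 1) ≤ (1 + δ) r m b + C_δ p b` (`row_estimate`). As `δ` and `r - |z₂(v)|` may be taken arbitrarily small, `m` decays at
every rate above `|z₂(v)|`, and so does the correlator, which is at most `m τ`
(`exists_weight_bound`).
-/

open Filter MeasureTheory

noncomputable section

namespace LLG

open Matrix
open scoped ComplexOrder

/-! ### Local operators on configuration spaces -/

section Local

variable {ι α : Type*} [DecidableEq ι]

/-- The configuration `c` with the labels at the sites `i` and `j` replaced by `p`. -/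
def pairUpdate (c : ι → α) (i j : ι) (p : α × α) : ι → α :=
  Function.update (Function.update c j p.2) i p.1

@[simp] lemma pairUpdate_left (c : ι → α) (i j : ι) (p : α × α) : pairUpdate c i j p i = p.1 := by
  simp [pairUpdate]

lemma pairUpdate_right (c : ι → α) {i j : ι} (hij : i ≠ j) (p : α × α) :
    pairUpdate c i j p j = p.2 := by
  simp [pairUpdate, Function.update_of_ne hij.symm]

lemma pairUpdate_of_ne (c : ι → α) {i j k : ι} (hi : k ≠ i) (hj : k ≠ j) (p : α × α) :
    pairUpdate c i j p k = c k := by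
  simp [pairUpdate, hi, hj]

lemma pairUpdate_injective (c : ι → α) {i j : ι} (hij : i ≠ j) :
    Function.Injective (pairUpdate c i j) := by
  intro p p' h
  have h1 := congrFun h i
  have h2 := congrFun h j
  rw [pairUpdate_right c hij, pairUpdate_right c hij] at h2
  simp only [pairUpdate_left] at h1
  exact Prod.ext h1 h2

lemma pairUpdate_comm (c : ι → α) {i j k l : ι} (hik : i ≠ k) (hil : i ≠ l) (hjk : j ≠ k)
    (hjl : j ≠ l) (p p' : α × α) :
    pairUpdate (pairUpdate c i j p) k l p' = pairUpdate (pairUpdate c k l p') i j p := by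
  funext m
  simp only [pairUpdate, Function.update_apply]
  split_ifs <;> simp_all

lemma prod_update_of_notMem {S : Finset ι} {i : ι} (hi : i ∉ S) (c : ι → α) (p : α)
    (φ : ι → α → ℂ) : ∏ k ∈ S, φ k (Function.update c i p k) = ∏ k ∈ S, φ k (c k) :=
  Finset.prod_congr rfl fun k hk => by
    rw [Function.update_of_ne fun e => hi (by rwa [← e])]

variable [Fintype ι]

/-- The product vector with factor `φ k` at the site `k`. -/
def prodVec (φ : ι → α → ℂ) : (ι → α) → ℂ := fun c => ∏ k, φ k (c k)

lemma prodVec_eq_pair_mul (φ : ι → α → ℂ) {i j : ι} (hij : i ≠ j) (c : ι → α) :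
    prodVec φ c = φ i (c i) * φ j (c j) * ∏ k ∈ (Finset.univ.erase i).erase j, φ k (c k) := by
  rw [prodVec, ← Finset.mul_prod_erase _ _ (Finset.mem_univ i),
    ← Finset.mul_prod_erase _ _ (Finset.mem_erase.2 ⟨hij.symm, Finset.mem_univ j⟩), mul_assoc]

lemma prodVec_eq_mul (φ : ι → α → ℂ) (i : ι) (c : ι → α) :
    prodVec φ c = φ i (c i) * ∏ k ∈ Finset.univ.erase i, φ k (c k) := by
  rw [prodVec, ← Finset.mul_prod_erase _ _ (Finset.mem_univ i)]

lemma prodVec_update (φ : ι → α → ℂ) (i : ι) (a : α → ℂ) (c : ι → α) :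
    prodVec (Function.update φ i a) c = a (c i) * ∏ k ∈ Finset.univ.erase i, φ k (c k) := by
  rw [prodVec_eq_mul _ i, Function.update_self]
  congr 1
  refine Finset.prod_congr rfl fun k hk => ?_
  rw [Function.update_of_ne (Finset.ne_of_mem_erase hk)]

lemma prodVec_update_add (φ : ι → α → ℂ) (i : ι) (a b : α → ℂ) :
    prodVec (Function.update φ i (a + b))
      = prodVec (Function.update φ i a) + prodVec (Function.update φ i b) := by
  funext c
  simp only [prodVec_update, Pi.add_apply, add_mul]

lemma prodVec_update_smul (φ : ι → α → ℂ) (i : ι) (z : ℂ) (a : α → ℂ) :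
    prodVec (Function.update φ i (z • a)) = z • prodVec (Function.update φ i a) := by
  funext c
  simp only [prodVec_update, Pi.smul_apply, smul_eq_mul, mul_assoc]

lemma prodVec_dotProduct [Fintype α] (φ ψ : ι → α → ℂ) :
    prodVec φ ⬝ᵥ prodVec ψ = ∏ k, φ k ⬝ᵥ ψ k := by
  simp only [prodVec, dotProduct, ← Finset.prod_mul_distrib]
  rw [Finset.prod_univ_sum]
  simp

variable [DecidableEq α]

/-- The operator on configurations `ι → α` that acts as `V` on the ordered pair of sites `(i, j)`
and as the identity elsewhere. -/
def bondMat (i j : ι) (V : Matrix (α × α) (α × α) ℂ) : Matrix (ι → α) (ι → α) ℂ :=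
  Matrix.of fun a b => if ∀ k, k ≠ i → k ≠ j → a k = b k then V (a i, a j) (b i, b j) else 0

lemma bondMat_transpose (i j : ι) (V : Matrix (α × α) (α × α) ℂ) :
    (bondMat i j V)ᵀ = bondMat i j Vᵀ := by
  ext a b
  simp only [bondMat, transpose_apply, of_apply, eq_comm]

/-- The operator that acts as `W` at the site `i` and as the identity elsewhere. -/
def siteMat (i : ι) (W : Matrix α α ℂ) : Matrix (ι → α) (ι → α) ℂ :=
  Matrix.of fun a b => if ∀ k, k ≠ i → a k = b k then W (a i) (b i) else 0

lemma siteMat_transpose (i : ι) (W : Matrix α α ℂ) : (siteMat i W)ᵀ = siteMat i Wᵀ := by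
  ext a b
  simp only [siteMat, transpose_apply, of_apply, eq_comm]

variable [Fintype α]

lemma vecMul_bondMat {i j : ι} (hij : i ≠ j) (V : Matrix (α × α) (α × α) ℂ) (f : (ι → α) → ℂ)
    (c : ι → α) :
    (f ᵥ* bondMat i j V) c = ∑ p, f (pairUpdate c i j p) * V p (c i, c j) := by
  symm
  simp only [vecMul, dotProduct]
  refine Finset.sum_of_injOn (pairUpdate c i j) (pairUpdate_injective c hij).injOn
    (fun _ _ => Finset.mem_univ _) ?_ ?_
  · intro a _ ha
    have : ¬ ∀ k, k ≠ i → k ≠ j → a k = c k := by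
      intro h
      refine ha ⟨(a i, a j), Finset.mem_coe.2 (Finset.mem_univ _), ?_⟩
      funext k
      by_cases hi : k = i
      · subst hi; simp
      · by_cases hj : k = j
        · subst hj; rw [pairUpdate_right c hij]
        · rw [pairUpdate_of_ne c hi hj, h k hi hj]
    simp [bondMat, this]
  · intro p _
    have : ∀ k, k ≠ i → k ≠ j → pairUpdate c i j p k = c k :=
      fun k hi hj => pairUpdate_of_ne c hi hj p
    simp only [bondMat, of_apply, if_pos this, pairUpdate_left, pairUpdate_right c hij]

lemma mulVec_bondMat {i j : ι} (hij : i ≠ j) (V : Matrix (α × α) (α × α) ℂ) (f : (ι → α) → ℂ)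
    (c : ι → α) :
    (bondMat i j V *ᵥ f) c = ∑ p, V (c i, c j) p * f (pairUpdate c i j p) := by
  rw [← vecMul_transpose, bondMat_transpose, vecMul_bondMat hij]
  simp [mul_comm]

/-- Operators on disjoint pairs of sites commute. -/
lemma bondMat_commute {i j k l : ι} (hij : i ≠ j) (hkl : k ≠ l) (hik : i ≠ k) (hil : i ≠ l)
    (hjk : j ≠ k) (hjl : j ≠ l) (V W : Matrix (α × α) (α × α) ℂ) :
    Commute (bondMat i j V) (bondMat k l W) := by
  refine ext_of_mulVec_single fun b => ?_
  generalize (Pi.single b 1 : (ι → α) → ℂ) = f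
  rw [← mulVec_mulVec, ← mulVec_mulVec]
  funext c
  simp only [mulVec_bondMat hij, mulVec_bondMat hkl, Finset.mul_sum]
  rw [Finset.sum_comm]
  refine Finset.sum_congr rfl fun p _ => Finset.sum_congr rfl fun p' _ => ?_
  rw [pairUpdate_of_ne c hik.symm hjk.symm, pairUpdate_of_ne c hil.symm hjl.symm,
    pairUpdate_of_ne c hik hil, pairUpdate_of_ne c hjk hjl,
    pairUpdate_comm c hik hil hjk hjl]
  ring

lemma vecMul_siteMat (i : ι) (W : Matrix α α ℂ) (f : (ι → α) → ℂ) (c : ι → α) :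
    (f ᵥ* siteMat i W) c = ∑ p, f (Function.update c i p) * W p (c i) := by
  symm
  simp only [vecMul, dotProduct]
  refine Finset.sum_of_injOn (Function.update c i) (Function.update_injective c i).injOn
    (fun _ _ => Finset.mem_univ _) ?_ ?_
  · intro a _ ha
    have : ¬ ∀ k, k ≠ i → a k = c k := by
      intro h
      refine ha ⟨a i, Finset.mem_coe.2 (Finset.mem_univ _), ?_⟩
      funext k
      by_cases hi : k = i
      · subst hi; simp
      · rw [Function.update_of_ne hi, h k hi]
    simp [siteMat, this]
  · intro p _
    have : ∀ k, k ≠ i → Function.update c i p k = c k :=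
      fun k hi => Function.update_of_ne hi p c
    simp only [siteMat, of_apply, if_pos this, Function.update_self]

lemma mulVec_siteMat (i : ι) (W : Matrix α α ℂ) (f : (ι → α) → ℂ) (c : ι → α) :
    (siteMat i W *ᵥ f) c = ∑ p, W (c i) p * f (Function.update c i p) := by
  rw [← vecMul_transpose, siteMat_transpose, vecMul_siteMat]
  simp [mul_comm]

lemma siteMat_commute_bondMat {i j k : ι} (hij : i ≠ j) (hki : k ≠ i) (hkj : k ≠ j)
    (V : Matrix (α × α) (α × α) ℂ) (W : Matrix α α ℂ) :
    Commute (siteMat k W) (bondMat i j V) := by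
  refine ext_of_mulVec_single fun b => ?_
  generalize (Pi.single b 1 : (ι → α) → ℂ) = f
  rw [← mulVec_mulVec, ← mulVec_mulVec]
  funext c
  simp only [mulVec_bondMat hij, mulVec_siteMat, Finset.mul_sum]
  rw [Finset.sum_comm]
  refine Finset.sum_congr rfl fun p _ => Finset.sum_congr rfl fun p' _ => ?_
  have : pairUpdate (Function.update c k p') i j p
      = Function.update (pairUpdate c i j p) k p' := by
    funext m
    simp only [pairUpdate, Function.update_apply]
    split_ifs <;> simp_all
  rw [pairUpdate_of_ne c hki hkj, Function.update_of_ne hki.symm, Function.update_of_ne hkj.symm,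
    this]
  ring

/-- A row vector with the factors `a`, `b` at the sites `i`, `j` keeps this form under an operator
on `(i, j)` that maps `a ⊗ b` to `a' ⊗ b'`. -/
lemma vecMul_bondMat_of_factor {i j : ι} (hij : i ≠ j) {V : Matrix (α × α) (α × α) ℂ}
    {a b a' b' : α → ℂ} (hV : ∀ r, ∑ p : α × α, a p.1 * b p.2 * V p r = a' r.1 * b' r.2)
    {f : (ι → α) → ℂ} (ρ : (ι → α) → ℂ) (hρ : ∀ c p, ρ (pairUpdate c i j p) = ρ c)
    (hf : ∀ c, f c = a (c i) * b (c j) * ρ c) (c : ι → α) :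
    (f ᵥ* bondMat i j V) c = a' (c i) * b' (c j) * ρ c := by
  rw [vecMul_bondMat hij, ← hV (c i, c j), Finset.sum_mul]
  refine Finset.sum_congr rfl fun p _ => ?_
  rw [hf, hρ, pairUpdate_left, pairUpdate_right c hij]
  ring

lemma prodVec_vecMul_bondMat {i j : ι} (hij : i ≠ j) {V : Matrix (α × α) (α × α) ℂ}
    {φ ψ : ι → α → ℂ}
    (hV : ∀ r, ∑ p : α × α, φ i p.1 * φ j p.2 * V p r = ψ i r.1 * ψ j r.2)
    (h : ∀ k, k ≠ i → k ≠ j → φ k = ψ k) :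
    prodVec φ ᵥ* bondMat i j V = prodVec ψ := by
  funext c
  rw [vecMul_bondMat_of_factor hij hV
    (fun c => ∏ k ∈ (Finset.univ.erase i).erase j, φ k (c k)) _
    (prodVec_eq_pair_mul φ hij), prodVec_eq_pair_mul ψ hij]
  · congr 1
    refine Finset.prod_congr rfl fun k hk => ?_
    simp only [Finset.mem_erase] at hk
    rw [h k hk.2.1 hk.1]
  · intro c p
    refine Finset.prod_congr rfl fun k hk => ?_
    simp only [Finset.mem_erase] at hk
    rw [pairUpdate_of_ne c hk.2.1 hk.1]

lemma bondMat_mulVec_prodVec {i j : ι} (hij : i ≠ j) {V : Matrix (α × α) (α × α) ℂ}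
    {φ : ι → α → ℂ}
    (hV : ∀ r, ∑ p : α × α, V r p * (φ i p.1 * φ j p.2) = φ i r.1 * φ j r.2) :
    bondMat i j V *ᵥ prodVec φ = prodVec φ := by
  rw [← vecMul_transpose, bondMat_transpose]
  refine prodVec_vecMul_bondMat hij (fun r => ?_) fun _ _ _ => rfl
  rw [← hV r]
  exact Finset.sum_congr rfl fun p _ => mul_comm _ _

lemma prodVec_vecMul_siteMat (i : ι) (W : Matrix α α ℂ) (φ : ι → α → ℂ) :
    prodVec φ ᵥ* siteMat i W = prodVec (Function.update φ i (φ i ᵥ* W)) := by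
  funext c
  rw [vecMul_siteMat, prodVec_update, vecMul, dotProduct, Finset.sum_mul]
  refine Finset.sum_congr rfl fun p _ => ?_
  rw [prodVec_eq_mul _ i, Function.update_self]
  have : ∏ k ∈ Finset.univ.erase i, φ k (Function.update c i p k)
      = ∏ k ∈ Finset.univ.erase i, φ k (c k) :=
    Finset.prod_congr rfl fun k hk => by rw [Function.update_of_ne (Finset.ne_of_mem_erase hk)]
  rw [this]
  ring

lemma siteMat_mulVec_prodVec (i : ι) (W : Matrix α α ℂ) (φ : ι → α → ℂ) :
    siteMat i W *ᵥ prodVec φ = prodVec (Function.update φ i (W *ᵥ φ i)) := by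
  rw [← vecMul_transpose, siteMat_transpose, prodVec_vecMul_siteMat, vecMul_transpose]

end Local

/-! ### Replicated operators and positive functionals -/

section Replicated

variable {ι : Type*} [Fintype ι] [DecidableEq ι] {q : ℕ}

/-- The replicated operator `X† ⊗ₖ X`, as a vector on the configurations of `Rep q`-labels. -/
def dens (X : Matrix (ι → Fin q) (ι → Fin q) ℂ) : (ι → Rep q) → ℂ := fun c =>
  star (X (fun k => (c k).1.2) fun k => (c k).1.1) * X (fun k => (c k).2.1) fun k => (c k).2.2

/-- A configuration of `Rep q`-labels is a quadruple of configurations of levels. -/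
def repEquiv (ι : Type*) (q : ℕ) :
    ((ι → Fin q) × (ι → Fin q)) × ((ι → Fin q) × (ι → Fin q)) ≃ (ι → Rep q) where
  toFun x := fun k => ((x.1.1 k, x.1.2 k), (x.2.1 k, x.2.2 k))
  invFun c := ((fun k => (c k).1.1, fun k => (c k).1.2), (fun k => (c k).2.1, fun k => (c k).2.2))
  left_inv _ := rfl
  right_inv _ := rfl

lemma sum_rep_config {M : Type*} [AddCommMonoid M] (F : (ι → Rep q) → M) :
    ∑ c, F c = ∑ a : ι → Fin q, ∑ b : ι → Fin q, ∑ c : ι → Fin q, ∑ d : ι → Fin q,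
      F fun k => ((a k, b k), (c k, d k)) := by
  rw [← (repEquiv ι q).sum_comp, Fintype.sum_prod_type, Fintype.sum_prod_type]
  refine Finset.sum_congr rfl fun a _ => Finset.sum_congr rfl fun b _ => ?_
  rw [Fintype.sum_prod_type]
  rfl

/-- Conjugating an operator with a gate acts on the replicated operator as the replicated gate. -/
lemma dens_conj_bondMat (i j : ι) (u : Gate q) (X : Matrix (ι → Fin q) (ι → Fin q) ℂ) :
    dens ((bondMat i j (u : Matrix (Fin q × Fin q) (Fin q × Fin q) ℂ))ᴴ * X *
      bondMat i j (u : Matrix (Fin q × Fin q) (Fin q × Fin q) ℂ)) =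
      bondMat i j (replica u) *ᵥ dens X := by
  set Y := bondMat i j (u : Matrix (Fin q × Fin q) (Fin q × Fin q) ℂ) with hY
  have key : ∀ o c : ι → Rep q, bondMat i j (replica u) o c =
      star (Y (fun k => (c k).1.1) fun k => (o k).1.1) *
        Y (fun k => (c k).1.2) (fun k => (o k).1.2) *
        (star (Y (fun k => (c k).2.1) fun k => (o k).2.1) *
        Y (fun k => (c k).2.2) (fun k => (o k).2.2)) := by
    intro o c
    by_cases h : ∀ k, k ≠ i → k ≠ j → o k = c k
    · have h1 : ∀ k, k ≠ i → k ≠ j → (c k).1.1 = (o k).1.1 := fun k a b => by rw [h k a b]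
      have h2 : ∀ k, k ≠ i → k ≠ j → (c k).1.2 = (o k).1.2 := fun k a b => by rw [h k a b]
      have h3 : ∀ k, k ≠ i → k ≠ j → (c k).2.1 = (o k).2.1 := fun k a b => by rw [h k a b]
      have h4 : ∀ k, k ≠ i → k ≠ j → (c k).2.2 = (o k).2.2 := fun k a b => by rw [h k a b]
      simp only [hY, bondMat, of_apply, if_pos h, if_pos h1, if_pos h2, if_pos h3, if_pos h4,
        replica]
    · have : (bondMat i j (replica u)) o c = 0 := by
        simp only [bondMat, of_apply, if_neg h]
      rw [this]
      push Not at h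
      obtain ⟨k, hi, hj, hk⟩ := h
      have hne : ∀ a b : ι → Fin q, a k ≠ b k → Y a b = 0 := fun a b hab => by
        simp only [hY, bondMat, of_apply]
        exact if_neg fun h => hab (h k hi hj)
      symm
      by_contra hcon
      have h1 := fun h => hcon (by rw [hne (fun k => (c k).1.1) (fun k => (o k).1.1) h]; simp)
      have h2 := fun h => hcon (by rw [hne (fun k => (c k).1.2) (fun k => (o k).1.2) h]; simp)
      have h3 := fun h => hcon (by rw [hne (fun k => (c k).2.1) (fun k => (o k).2.1) h]; simp)
      have h4 := fun h => hcon (by rw [hne (fun k => (c k).2.2) (fun k => (o k).2.2) h]; simp)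
      simp only [ne_eq, imp_false, not_not] at h1 h2 h3 h4
      exact hk (Prod.ext (Prod.ext h1.symm h2.symm) (Prod.ext h3.symm h4.symm))
  funext o
  rw [mulVec, dotProduct, sum_rep_config]
  have conj : ∀ y z, (Yᴴ * X * Y) y z = ∑ a, ∑ b, star (Y a y) * X a b * Y b z := by
    intro y z
    simp only [mul_apply, conjTranspose_apply, Finset.sum_mul]
    rw [Finset.sum_comm]
  rw [dens, conj, conj]
  simp only [star_sum]
  rw [Finset.sum_comm, Finset.sum_mul]
  refine Finset.sum_congr rfl fun b _ => ?_
  rw [Finset.sum_mul]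
  refine Finset.sum_congr rfl fun a _ => ?_
  rw [Finset.mul_sum]
  refine Finset.sum_congr rfl fun c _ => ?_
  rw [Finset.mul_sum]
  refine Finset.sum_congr rfl fun d _ => ?_
  rw [key]
  simp only [dens, star_mul', star_star]
  ring

/-- The replicated action of a linear map `K` on one-site operators. -/
def repKraus (K : Matrix (Fin q × Fin q) (Fin q × Fin q) ℂ) : Matrix (Rep q) (Rep q) ℂ :=
  Matrix.of fun o p => star (K o.1.swap p.1.swap) * K o.2 p.2

/-- The linear map `K` on one-site operators, applied at the site `i`. -/
def krausAt (i : ι) (K : Matrix (Fin q × Fin q) (Fin q × Fin q) ℂ)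
    (X : Matrix (ι → Fin q) (ι → Fin q) ℂ) : Matrix (ι → Fin q) (ι → Fin q) ℂ :=
  Matrix.of fun y z => ∑ a : Fin q × Fin q,
    K (y i, z i) a * X (Function.update y i a.1) (Function.update z i a.2)

lemma dens_krausAt (i : ι) (K : Matrix (Fin q × Fin q) (Fin q × Fin q) ℂ)
    (X : Matrix (ι → Fin q) (ι → Fin q) ℂ) :
    dens (krausAt i K X) = siteMat i (repKraus K) *ᵥ dens X := by
  funext c
  rw [mulVec_siteMat, Fintype.sum_prod_type]
  have hc : ∀ (p : Rep q), dens X (Function.update c i p) =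
      star (X (Function.update (fun k => (c k).1.2) i p.1.2)
        (Function.update (fun k => (c k).1.1) i p.1.1)) *
      X (Function.update (fun k => (c k).2.1) i p.2.1)
        (Function.update (fun k => (c k).2.2) i p.2.2) := by
    intro p
    have e : ∀ (g : Rep q → Fin q), (fun k => g (Function.update c i p k))
        = Function.update (fun k => g (c k)) i (g p) := by
      intro g
      funext k
      by_cases hk : k = i
      · subst hk; simp
      · simp [Function.update_of_ne hk]
    simp only [dens]
    rw [e fun p => p.1.2, e fun p => p.1.1, e fun p => p.2.1, e fun p => p.2.2]
  simp only [hc, repKraus, of_apply]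
  simp only [dens, krausAt, of_apply, star_sum, Finset.sum_mul_sum, star_mul']
  rw [← (Equiv.prodComm (Fin q) (Fin q)).sum_comp]
  refine Finset.sum_congr rfl fun a _ => Finset.sum_congr rfl fun b _ => ?_
  simp only [Equiv.prodComm_apply, Prod.fst_swap, Prod.snd_swap]
  simp only [Prod.swap]
  ring

/-- A functional on replicated operators is nonnegative if its real part is nonnegative on all
`X† ⊗ₖ X`. -/
def Nonneg (f : (ι → Rep q) → ℂ) : Prop :=
  ∀ X : Matrix (ι → Fin q) (ι → Fin q) ℂ, 0 ≤ (f ⬝ᵥ dens X).re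

lemma Nonneg.add {f g : (ι → Rep q) → ℂ} (hf : Nonneg f) (hg : Nonneg g) : Nonneg (f + g) := by
  intro X
  rw [add_dotProduct, Complex.add_re]
  exact add_nonneg (hf X) (hg X)

lemma Nonneg.smul {f : (ι → Rep q) → ℂ} (hf : Nonneg f) {r : ℝ} (hr : 0 ≤ r) :
    Nonneg ((r : ℂ) • f) := by
  intro X
  rw [smul_dotProduct, smul_eq_mul, Complex.re_ofReal_mul]
  exact mul_nonneg hr (hf X)

lemma Nonneg.vecMul_siteMat {f : (ι → Rep q) → ℂ} (hf : Nonneg f) (i : ι)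
    (K : Matrix (Fin q × Fin q) (Fin q × Fin q) ℂ) :
    Nonneg (f ᵥ* siteMat i (repKraus K)) := by
  intro X
  rw [← dotProduct_mulVec, ← dens_krausAt]
  exact hf _

lemma Nonneg.vecMul_replica {f : (ι → Rep q) → ℂ} (hf : Nonneg f) (i j : ι) (u : Gate q) :
    Nonneg (f ᵥ* bondMat i j (replica u)) := by
  intro X
  rw [← dotProduct_mulVec, ← dens_conj_bondMat]
  exact hf _

/-- Splitting an operator as `K X + (1 - K) X` at one site costs a factor `1 + δ` on the first part
and `1 + δ⁻¹` on the second. -/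
lemma Nonneg.split {f : (ι → Rep q) → ℂ} (hf : Nonneg f) (i : ι)
    (K : Matrix (Fin q × Fin q) (Fin q × Fin q) ℂ) {δ : ℝ} (hδ : 0 < δ) :
    Nonneg (((1 + δ : ℝ) : ℂ) • (f ᵥ* siteMat i (repKraus K)) +
      ((1 + δ⁻¹ : ℝ) : ℂ) • (f ᵥ* siteMat i (repKraus (1 - K))) - f) := by
  intro X
  have hX : X = krausAt i K X + krausAt i (1 - K) X := by
    ext y z
    simp only [krausAt, Matrix.add_apply, of_apply, Matrix.sub_apply, sub_mul,
      Finset.sum_sub_distrib]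
    simp [Matrix.one_apply]
  rw [sub_dotProduct, add_dotProduct, smul_dotProduct, smul_dotProduct, ← dotProduct_mulVec,
    ← dens_krausAt, ← dotProduct_mulVec, ← dens_krausAt]
  set A := krausAt i K X
  set B := krausAt i (1 - K) X
  have hAB := hf ((δ : ℂ) • A - B)
  -- `δ⁻¹ |δ A - B|² = δ |A|² + δ⁻¹ |B|² - 2 Re ⟨A, B⟩` absorbs the cross terms of `|A + B|²`.
  have expand : dens ((δ : ℂ) • A - B) + (δ : ℂ) • dens X
      = ((δ * (1 + δ) : ℝ) : ℂ) • dens A + ((1 + δ : ℝ) : ℂ) • dens B := by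
    rw [hX]
    funext c
    simp only [dens, Matrix.sub_apply, Matrix.add_apply, Matrix.smul_apply, Pi.add_apply,
      Pi.smul_apply, smul_eq_mul, star_sub, star_mul', star_add, Complex.star_def,
      Complex.conj_ofReal]
    push_cast
    ring
  have e2 := congrArg (fun x => (f ⬝ᵥ x).re) expand
  simp only [dotProduct_add, dotProduct_smul, smul_eq_mul, Complex.add_re,
    Complex.re_ofReal_mul] at e2
  simp only [Complex.sub_re, Complex.add_re, smul_eq_mul, Complex.re_ofReal_mul]
  have e3 : (1 + δ) * (f ⬝ᵥ dens A).re + (1 + δ⁻¹) * (f ⬝ᵥ dens B).re - (f ⬝ᵥ dens X).re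
      = δ⁻¹ * (f ⬝ᵥ dens ((δ : ℂ) • A - B)).re := by
    have : (f ⬝ᵥ dens ((δ : ℂ) • A - B)).re = δ * (1 + δ) * (f ⬝ᵥ dens A).re
      + (1 + δ) * (f ⬝ᵥ dens B).re - δ * (f ⬝ᵥ dens X).re := by linarith
    rw [this]
    field_simp
    ring
  rw [e3]
  exact mul_nonneg (inv_nonneg.2 hδ.le) hAB

/-- The sesquilinear form of a one-site functional on one-site operators. -/
def siteForm (φ : Rep q → ℂ) : Matrix (Fin q × Fin q) (Fin q × Fin q) ℂ :=
  Matrix.of fun x y => φ (x.swap, y)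

/-- Products of positive semidefinite one-site functionals are nonnegative: they are sums of
squares of product functionals. -/
lemma prodVec_dotProduct_dens_nonneg {φ : ι → Rep q → ℂ}
    (hφ : ∀ k, (siteForm (φ k)).PosSemidef) (X : Matrix (ι → Fin q) (ι → Fin q) ℂ) :
    0 ≤ prodVec φ ⬝ᵥ dens X := by
  have h1 : ∀ k, ∃ B : Matrix (Fin q × Fin q) (Fin q × Fin q) ℂ, siteForm (φ k) = Bᴴ * B :=
    fun k => by
      open scoped MatrixOrder in
      have := CStarAlgebra.nonneg_iff_eq_star_mul_self.mp (hφ k).nonneg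
      exact this
  choose B hB using h1
  have h2 : ∀ k (p : Rep q), φ k p = ∑ x, star (B k x p.1.swap) * B k x p.2 := by
    intro k p
    have := congrFun (congrFun (hB k) p.1.swap) p.2
    simpa [siteForm, mul_apply] using this
  have h3 : prodVec φ ⬝ᵥ dens X = ∑ α : ι → Fin q × Fin q,
      star (∑ c : ι → Fin q, ∑ d : ι → Fin q, (∏ k, B k (α k) (c k, d k)) * X c d) *
        (∑ c : ι → Fin q, ∑ d : ι → Fin q, (∏ k, B k (α k) (c k, d k)) * X c d) := by
    have h4 : ∀ c, prodVec φ c = ∑ α : ι → Fin q × Fin q,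
        star (∏ k, B k (α k) (c k).1.swap) * ∏ k, B k (α k) (c k).2 := by
      intro c
      simp only [prodVec, h2, Finset.prod_univ_sum, Fintype.piFinset_univ, star_prod,
        Finset.prod_mul_distrib]
    rw [dotProduct]
    simp only [h4, Finset.sum_mul]
    rw [Finset.sum_comm]
    refine Finset.sum_congr rfl fun α _ => ?_
    rw [sum_rep_config, Finset.sum_comm]
    simp only [star_sum]
    rw [Finset.sum_mul]
    refine Finset.sum_congr rfl fun a _ => ?_
    rw [Finset.sum_mul]
    refine Finset.sum_congr rfl fun b _ => ?_
    rw [Finset.mul_sum]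
    refine Finset.sum_congr rfl fun c _ => ?_
    rw [Finset.mul_sum]
    refine Finset.sum_congr rfl fun d _ => ?_
    simp only [dens, Prod.swap, star_mul']
    ring
  rw [h3]
  exact Finset.sum_nonneg fun α _ => star_mul_self_nonneg _

lemma nonneg_prodVec {φ : ι → Rep q → ℂ} (hφ : ∀ k, (siteForm (φ k)).PosSemidef) :
    Nonneg (prodVec φ) :=
  fun X => (Complex.nonneg_iff.1 (prodVec_dotProduct_dens_nonneg hφ X)).1

/-- A functional takes nonnegative real values on all `X† ⊗ₖ X` if and only if it and its multiples
by `i` and `-i` are `Nonneg`. -/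
lemma dotProduct_dens_nonneg_iff {f : (ι → Rep q) → ℂ} :
    (∀ X, 0 ≤ f ⬝ᵥ dens X) ↔
      Nonneg f ∧ Nonneg (Complex.I • f) ∧ Nonneg ((-Complex.I) • f) := by
  simp only [Nonneg, smul_dotProduct, smul_eq_mul, Complex.mul_re, Complex.neg_re, Complex.neg_im,
    Complex.I_re, Complex.I_im, Complex.nonneg_iff, ← forall_and]
  refine forall_congr' fun X => and_congr_right fun _ => ?_
  constructor
  · intro h
    rw [← h]
    simp
  · rintro ⟨h1, h2⟩
    linarith

end Replicated

/-! ### The averaged replicated gate -/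

section Channel

variable {q : ℕ}

/-- The properties of the averaged replicated gate that are used: the states `0 ⊗ 0` (from both
sides) and `1 ⊗ 1` (as a row vector) are invariant, and positivity is preserved. -/
structure IsChannel (V : Matrix (Rep q × Rep q) (Rep q × Rep q) ℂ) : Prop where
  ket1_mul : ∀ r, ∑ p : Rep q × Rep q, ket1 p.1 * ket1 p.2 * V p r = ket1 r.1 * ket1 r.2
  ket0_mul : ∀ r, ∑ p : Rep q × Rep q, ket0 p.1 * ket0 p.2 * V p r = ket0 r.1 * ket0 r.2
  mul_ket0 : ∀ r, ∑ p : Rep q × Rep q, V r p * (ket0 p.1 * ket0 p.2) = ket0 r.1 * ket0 r.2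
  nonneg : ∀ {ι : Type} [Fintype ι] [DecidableEq ι] {i j : ι}, i ≠ j → ∀ {f : (ι → Rep q) → ℂ},
    Nonneg f → Nonneg (f ᵥ* bondMat i j V)

lemma sum_rep_pair {M : Type*} [AddCommMonoid M] (F : Rep q × Rep q → M) :
    ∑ p, F p = ∑ x : Fin q × Fin q, ∑ y : Fin q × Fin q, ∑ z : Fin q × Fin q, ∑ w : Fin q × Fin q,
      F (((x.1, y.1), (z.1, w.1)), ((x.2, y.2), (z.2, w.2))) := by
  let e : ((Fin q × Fin q) × (Fin q × Fin q)) × ((Fin q × Fin q) × (Fin q × Fin q)) ≃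
      Rep q × Rep q :=
    { toFun := fun t => (((t.1.1.1, t.1.2.1), (t.2.1.1, t.2.2.1)),
        ((t.1.1.2, t.1.2.2), (t.2.1.2, t.2.2.2)))
      invFun := fun p => (((p.1.1.1, p.2.1.1), (p.1.1.2, p.2.1.2)),
        ((p.1.2.1, p.2.2.1), (p.1.2.2, p.2.2.2)))
      left_inv := fun _ => rfl
      right_inv := fun _ => rfl }
  rw [← e.sum_comp, Fintype.sum_prod_type, Fintype.sum_prod_type]
  refine Finset.sum_congr rfl fun a _ => Finset.sum_congr rfl fun b _ => ?_
  rw [Fintype.sum_prod_type]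
  rfl

lemma ket1_mul_ket1 (x y z w : Fin q × Fin q) :
    (ket1 ((x.1, y.1), (z.1, w.1)) * ket1 ((x.2, y.2), (z.2, w.2)) : ℂ) =
      if x = w then (if z = y then ((Real.sqrt q : ℝ) : ℂ)⁻¹ ^ 2 else 0) else 0 := by
  simp only [ket1, Prod.ext_iff]
  split_ifs <;> simp_all [sq]

lemma ket0_mul_ket0 (x y z w : Fin q × Fin q) :
    (ket0 ((x.1, y.1), (z.1, w.1)) * ket0 ((x.2, y.2), (z.2, w.2)) : ℂ) =
      if x = y then (if z = w then ((Real.sqrt q : ℝ) : ℂ)⁻¹ ^ 2 else 0) else 0 := by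
  simp only [ket0, Prod.ext_iff]
  split_ifs <;> simp_all [sq]

lemma gate_mul_star (u : Gate q) (a b : Fin q × Fin q) :
    ∑ x, u.1 a x * star (u.1 b x) = if b = a then 1 else 0 := by
  have := congrFun (congrFun (mem_unitaryGroup_iff.1 u.2) a) b
  simpa [mul_apply, one_apply, eq_comm] using this

lemma star_gate_mul (u : Gate q) (a b : Fin q × Fin q) :
    ∑ x, star (u.1 x a) * u.1 x b = if a = b then 1 else 0 := by
  have := congrFun (congrFun (mem_unitaryGroup_iff'.1 u.2) a) b
  simpa [mul_apply, one_apply] using this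

lemma isChannel_replica (u : Gate q) : IsChannel (replica u) where
  ket1_mul r := by
    obtain ⟨⟨⟨a, b⟩, c, d⟩, ⟨a', b'⟩, c', d'⟩ := r
    have h := ket1_mul_ket1 (a, a') (b, b') (c, c') (d, d')
    simp only at h
    rw [sum_rep_pair]
    simp only [ket1_mul_ket1, h, replica, of_apply, Prod.mk.eta]
    have : ∀ x y : Fin q × Fin q, ∑ z, ∑ w, (if x = w then (if z = y then
        ((Real.sqrt q : ℝ) : ℂ)⁻¹ ^ 2 else 0) else 0) * (star (u.1 (a, a') x) * u.1 (b, b') y *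
        (star (u.1 (c, c') z) * u.1 (d, d') w)) = ((Real.sqrt q : ℝ) : ℂ)⁻¹ ^ 2 *
        ((u.1 (d, d') x * star (u.1 (a, a') x)) * (u.1 (b, b') y * star (u.1 (c, c') y))) := by
      intro x y
      simp only [ite_mul, zero_mul, Finset.sum_ite_eq, Finset.sum_ite_eq', Finset.mem_univ, if_true]
      ring
    simp only [this, ← Finset.mul_sum, ← Finset.sum_mul, gate_mul_star]
    split_ifs <;> simp
  ket0_mul r := by
    obtain ⟨⟨⟨a, b⟩, c, d⟩, ⟨a', b'⟩, c', d'⟩ := r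
    have h := ket0_mul_ket0 (a, a') (b, b') (c, c') (d, d')
    simp only at h
    rw [sum_rep_pair]
    simp only [ket0_mul_ket0, h, replica, of_apply, Prod.mk.eta]
    have : ∀ x : Fin q × Fin q, ∑ y, ∑ z, ∑ w, (if x = y then (if z = w then
        ((Real.sqrt q : ℝ) : ℂ)⁻¹ ^ 2 else 0) else 0) * (star (u.1 (a, a') x) * u.1 (b, b') y *
        (star (u.1 (c, c') z) * u.1 (d, d') w)) = ((Real.sqrt q : ℝ) : ℂ)⁻¹ ^ 2 *
        ((u.1 (b, b') x * star (u.1 (a, a') x)) *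
          ∑ z, (u.1 (d, d') z * star (u.1 (c, c') z))) := by
      intro x
      rw [Finset.mul_sum, Finset.mul_sum, Finset.sum_comm]
      refine Finset.sum_congr rfl fun z _ => ?_
      rw [Finset.sum_comm]
      simp only [ite_mul, zero_mul, Finset.sum_ite_eq, Finset.mem_univ, if_true]
      ring
    simp only [this, ← Finset.mul_sum, ← Finset.sum_mul, gate_mul_star]
    split_ifs <;> simp
  mul_ket0 r := by
    obtain ⟨⟨⟨a, b⟩, c, d⟩, ⟨a', b'⟩, c', d'⟩ := r
    have h := ket0_mul_ket0 (a, a') (b, b') (c, c') (d, d')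
    simp only at h
    rw [sum_rep_pair]
    simp only [ket0_mul_ket0, h, replica, of_apply, Prod.mk.eta]
    have : ∀ x : Fin q × Fin q, ∑ y, ∑ z, ∑ w, (star (u.1 x (a, a')) * u.1 y (b, b') *
        (star (u.1 z (c, c')) * u.1 w (d, d'))) * (if x = y then (if z = w then
        ((Real.sqrt q : ℝ) : ℂ)⁻¹ ^ 2 else 0) else 0) = ((Real.sqrt q : ℝ) : ℂ)⁻¹ ^ 2 *
        ((star (u.1 x (a, a')) * u.1 x (b, b')) *
          ∑ z, (star (u.1 z (c, c')) * u.1 z (d, d'))) := by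
      intro x
      rw [Finset.mul_sum, Finset.mul_sum, Finset.sum_comm]
      refine Finset.sum_congr rfl fun z _ => ?_
      rw [Finset.sum_comm]
      simp only [mul_ite, mul_zero, Finset.sum_ite_eq, Finset.mem_univ, if_true]
      ring
    simp only [this, ← Finset.mul_sum, ← Finset.sum_mul, star_gate_mul]
    split_ifs <;> simp_all
  nonneg _ _ hf := hf.vecMul_replica _ _ u

variable {Ω : Type*} [MeasurableSpace Ω] {P : Measure Ω} [IsProbabilityMeasure P] {u : Ω → Gate q}

lemma measurable_replica
    (hu : ∀ a b, Measurable fun ω => (u ω : Matrix (Fin q × Fin q) (Fin q × Fin q) ℂ) a b)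
    (o i : Rep q × Rep q) : Measurable fun ω => replica (u ω) o i := by
  have hs : ∀ a b, Measurable fun ω =>
      star ((u ω : Matrix (Fin q × Fin q) (Fin q × Fin q) ℂ) a b) :=
    fun a b => continuous_star.measurable.comp (hu a b)
  exact ((hs _ _).mul (hu _ _)).mul ((hs _ _).mul (hu _ _))

lemma norm_replica_le (u : Gate q) (o i : Rep q × Rep q) : ‖replica u o i‖ ≤ 1 := by
  have h : ∀ a b, ‖u.1 a b‖ ≤ 1 := fun a b => entry_norm_bound_of_unitary u.2 a b
  have h2 : ∀ a b c d, ‖star (u.1 a b) * u.1 c d‖ ≤ 1 := fun a b c d => by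
    rw [norm_mul, norm_star]
    exact mul_le_one₀ (h _ _) (norm_nonneg _) (h _ _)
  simp only [replica, of_apply]
  rw [norm_mul]
  exact mul_le_one₀ (h2 _ _ _ _) (norm_nonneg _) (h2 _ _ _ _)

lemma integrable_replica
    (hu : ∀ a b, Measurable fun ω => (u ω : Matrix (Fin q × Fin q) (Fin q × Fin q) ℂ) a b)
    (o i : Rep q × Rep q) : Integrable (fun ω => replica (u ω) o i) P :=
  Integrable.of_bound (measurable_replica hu o i).aestronglyMeasurable 1
    (ae_of_all _ fun ω => norm_replica_le (u ω) o i)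

lemma isChannel_avgReplica
    (hu : ∀ a b, Measurable fun ω => (u ω : Matrix (Fin q × Fin q) (Fin q × Fin q) ℂ) a b) :
    IsChannel (avgReplica P u) where
  ket1_mul r := by
    simp only [avgReplica, of_apply, ← integral_const_mul]
    rw [← integral_finsetSum _ fun p _ => (integrable_replica hu p r).const_mul _]
    simp [(isChannel_replica _).ket1_mul]
  ket0_mul r := by
    simp only [avgReplica, of_apply, ← integral_const_mul]
    rw [← integral_finsetSum _ fun p _ => (integrable_replica hu p r).const_mul _]
    simp [(isChannel_replica _).ket0_mul]
  mul_ket0 r := by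
    simp only [avgReplica, of_apply, ← integral_mul_const]
    rw [← integral_finsetSum _ fun p _ => (integrable_replica hu r p).mul_const _]
    simp [(isChannel_replica _).mul_ket0]
  nonneg {ι} _ _ i j hij f hf X := by
    have hint : ∀ c : ι → Rep q, Integrable (fun ω => (f ᵥ* bondMat i j (replica (u ω))) c) P := by
      intro c
      simp only [vecMul_bondMat hij]
      exact integrable_finsetSum _ fun p _ => (integrable_replica hu p _).const_mul _
    have h : f ᵥ* bondMat i j (avgReplica P u) ⬝ᵥ dens X =
        ∫ ω, (f ᵥ* bondMat i j (replica (u ω)) ⬝ᵥ dens X) ∂P := by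
      simp only [dotProduct]
      rw [integral_finsetSum _ fun c _ => (hint c).mul_const _]
      refine Finset.sum_congr rfl fun c _ => ?_
      rw [integral_mul_const]
      congr 1
      simp only [vecMul_bondMat hij]
      rw [integral_finsetSum _ fun p _ => (integrable_replica hu p _).const_mul _]
      refine Finset.sum_congr rfl fun p _ => ?_
      rw [integral_const_mul]
      rfl
    have hint2 : Integrable (fun ω => f ᵥ* bondMat i j (replica (u ω)) ⬝ᵥ dens X) P :=
      integrable_finsetSum _ fun c _ => (hint c).mul_const _
    rw [h, ← RCLike.re_eq_complex_re, ← integral_re hint2]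
    exact integral_nonneg fun ω => hf.vecMul_replica i j (u ω) X

end Channel

/-! ### The light-like generator and its powers -/

section Generator

variable {q : ℕ}

lemma ket1_dot_ket0 (hq : 0 < q) : (ket1 (q := q)) ⬝ᵥ ket0 = 1 := by
  have hs : ((Real.sqrt q : ℝ) : ℂ)⁻¹ * ((Real.sqrt q : ℝ) : ℂ)⁻¹ = (q : ℂ)⁻¹ := by
    rw [← mul_inv, ← Complex.ofReal_mul, Real.mul_self_sqrt (Nat.cast_nonneg q),
      Complex.ofReal_natCast]
  have hq' : (q : ℂ) ≠ 0 := Nat.cast_ne_zero.2 hq.ne'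
  have h : ∀ a b c d : Fin q, (ket1 ((a, b), (c, d)) * ket0 ((a, b), (c, d)) : ℂ) =
      if b = a then (if c = a then (if d = c then (q : ℂ)⁻¹ else 0) else 0) else 0 := by
    intro a b c d
    simp only [ket1, ket0]
    rw [← hs]
    clear hs
    split_ifs <;> first | rfl | (exfalso; grind) | simp
  simp only [dotProduct, Fintype.sum_prod_type, h]
  simp [hq']

/-- The sum defining the light-like generator, with arbitrary boundary vectors `a` and `b` of the
auxiliary line in place of `0` and `1`. -/
def lineSum (V : Matrix (Rep q × Rep q) (Rep q × Rep q) ℂ) (v : ℕ) (a b : Rep q → ℂ)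
    (i j : Fin v → Rep q) : ℂ :=
  ∑ m : Fin (v + 1) → Rep q,
    a (m 0) * (∏ k : Fin v, V (i k, m k.succ) (m k.castSucc, j k)) * b (m (Fin.last v))

lemma T_apply (V : Matrix (Rep q × Rep q) (Rep q × Rep q) ℂ) (v : ℕ) (i j : Fin v → Rep q) :
    T V v i j = lineSum V v ket0 ket1 i j := rfl

lemma sum_snoc {M : Type*} [AddCommMonoid M] {α : Type*} [Fintype α] {v : ℕ}
    (G : (Fin (v + 1) → α) → M) :
    ∑ m, G m = ∑ m : Fin v → α, ∑ x : α, G (Fin.snoc m x) := by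
  rw [← (Fin.snocEquiv fun _ => α).sum_comp, Fintype.sum_prod_type, Finset.sum_comm]
  rfl

lemma lineSum_zero (V : Matrix (Rep q × Rep q) (Rep q × Rep q) ℂ) (a b : Rep q → ℂ)
    (i j : Fin 0 → Rep q) : lineSum V 0 a b i j = a ⬝ᵥ b := by
  rw [lineSum, sum_snoc]
  simp [dotProduct, Fin.snoc]

lemma lineSum_succ (V : Matrix (Rep q × Rep q) (Rep q × Rep q) ℂ) (v : ℕ) (a b : Rep q → ℂ)
    (i j : Fin (v + 1) → Rep q) :
    lineSum V (v + 1) a b i j = lineSum V v a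
      (fun m => ∑ m', V (i (Fin.last v), m') (m, j (Fin.last v)) * b m')
      (Fin.init i) (Fin.init j) := by
  rw [lineSum, sum_snoc, lineSum]
  refine Finset.sum_congr rfl fun m _ => ?_
  rw [Finset.mul_sum]
  refine Finset.sum_congr rfl fun x _ => ?_
  rw [Fin.prod_univ_castSucc]
  have h0 : (Fin.snoc m x : Fin (v + 2) → Rep q) 0 = m 0 := by
    rw [← Fin.castSucc_zero, Fin.snoc_castSucc]
  simp only [h0, Fin.snoc_castSucc, Fin.succ_last, Fin.snoc_last, Fin.succ_castSucc, Fin.init]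
  ring

lemma lineSum_finset_sum {κ : Type*} (s : Finset κ)
    (V : Matrix (Rep q × Rep q) (Rep q × Rep q) ℂ) (v : ℕ) (a : Rep q → ℂ) (b : κ → Rep q → ℂ)
    (z : κ → ℂ) (i j : Fin v → Rep q) :
    lineSum V v a (fun m => ∑ k ∈ s, z k * b k m) i j = ∑ k ∈ s, z k * lineSum V v a (b k) i j := by
  simp only [lineSum, Finset.mul_sum]
  rw [Finset.sum_comm]
  refine Finset.sum_congr rfl fun k _ => Finset.sum_congr rfl fun m _ => ?_
  ring

lemma lineSum_eq_sum_left (V : Matrix (Rep q × Rep q) (Rep q × Rep q) ℂ) (v : ℕ)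
    (a b : Rep q → ℂ) (i j : Fin v → Rep q) :
    lineSum V v a b i j = ∑ p, a p * lineSum V v (Pi.single p 1) b i j := by
  simp only [lineSum, Finset.mul_sum]
  rw [Finset.sum_comm]
  refine Finset.sum_congr rfl fun m _ => ?_
  rw [Finset.sum_eq_single (m 0)]
  · simp only [Pi.single_eq_same]
    ring
  · intro p _ hp
    simp [hp.symm]
  · simp

variable {V : Matrix (Rep q × Rep q) (Rep q × Rep q) ℂ}

/-- The row vector `(x| ⊗ (1|`. -/
def appendKet1 {v : ℕ} (x : (Fin v → Rep q) → ℂ) : (Fin (v + 1) → Rep q) → ℂ :=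
  fun c => x (Fin.init c) * ket1 (c (Fin.last v))

lemma appendKet1_vecMul_T (hV : IsChannel V) {v : ℕ} (x : (Fin v → Rep q) → ℂ) :
    appendKet1 x ᵥ* T V (v + 1) = appendKet1 (x ᵥ* T V v) := by
  funext j
  simp only [vecMul, dotProduct, appendKet1]
  rw [sum_snoc, Finset.sum_mul]
  refine Finset.sum_congr rfl fun i _ => ?_
  have h : ∀ y : Rep q, T V (v + 1) (Fin.snoc i y) j =
      lineSum V v ket0 (fun m => ∑ m', V (y, m') (m, j (Fin.last v)) * ket1 m') i (Fin.init j) := by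
    intro y
    rw [T_apply, lineSum_succ]
    simp only [Fin.snoc_last, Fin.init_snoc]
  simp only [h, Fin.init_snoc, Fin.snoc_last, mul_assoc]
  rw [← Finset.mul_sum, ← lineSum_finset_sum, T_apply]
  congr 1
  have h2 := lineSum_finset_sum {()} V v ket0 (fun _ => ket1) (fun _ => ket1 (j (Fin.last v))) i
    (Fin.init j)
  simp only [Finset.sum_singleton] at h2
  rw [mul_comm, ← h2]
  congr 1
  funext m
  have h3 := hV.ket1_mul (m, j (Fin.last v))
  rw [Fintype.sum_prod_type] at h3
  rw [mul_comm, ← h3]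
  simp only [Finset.mul_sum]
  exact Finset.sum_congr rfl fun y _ => Finset.sum_congr rfl fun m' _ => by ring

lemma star_ket1 (p : Rep q) : star (ket1 p) = ket1 p := by
  simp only [ket1]
  split_ifs <;> simp

/-- The action of `F_v = T_v - |0^v)(1^v|` on row vectors. -/
lemma vecMul_F {v : ℕ} (x : (Fin v → Rep q) → ℂ) :
    x ᵥ* F V v = x ᵥ* T V v - (x ⬝ᵥ prodVec fun _ => ket0) • prodVec fun _ => ket1 := by
  funext j
  simp only [vecMul, dotProduct, F, of_apply, mul_sub, Finset.sum_sub_distrib, Pi.sub_apply,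
    Pi.smul_apply, smul_eq_mul, star_ket1, prodVec, Finset.sum_mul]
  congr 1
  exact Finset.sum_congr rfl fun i _ => by ring

lemma appendKet1_vecMul_F (hq : 0 < q) (hV : IsChannel V) {v : ℕ} (x : (Fin v → Rep q) → ℂ) :
    appendKet1 x ᵥ* F V (v + 1) = appendKet1 (x ᵥ* F V v) := by
  have h : appendKet1 x ⬝ᵥ (prodVec fun _ => ket0) = x ⬝ᵥ prodVec fun _ => ket0 := by
    simp only [dotProduct, appendKet1]
    rw [sum_snoc]
    refine Finset.sum_congr rfl fun i _ => ?_
    have h1 := ket1_dot_ket0 hq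
    rw [dotProduct] at h1
    rw [← mul_one (x i * prodVec (fun _ => ket0) i), ← h1, Finset.mul_sum]
    refine Finset.sum_congr rfl fun y _ => ?_
    simp only [prodVec, Fin.prod_univ_castSucc, Fin.init_snoc, Fin.snoc_castSucc, Fin.snoc_last]
    ring
  rw [vecMul_F, vecMul_F, appendKet1_vecMul_T hV, h]
  funext c
  simp only [appendKet1, Pi.sub_apply, Pi.smul_apply, smul_eq_mul, sub_mul, prodVec,
    Fin.prod_univ_castSucc, Fin.init]
  ring

lemma hasEigenvalue_iff_exists_vecMul {n : Type*} [Fintype n] [DecidableEq n] (A : Matrix n n ℂ)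
    (z : ℂ) : Module.End.HasEigenvalue (toLin' A) z ↔ ∃ x ≠ 0, x ᵥ* A = z • x := by
  rw [Module.End.hasEigenvalue_iff_mem_spectrum, spectrum_toLin', spectrum.mem_iff,
    isUnit_iff_isUnit_det, isUnit_iff_ne_zero, not_not, ← exists_vecMul_eq_zero_iff]
  refine exists_congr fun x => and_congr_right fun _ => ?_
  rw [vecMul_sub, Algebra.algebraMap_eq_smul_one, vecMul_smul, vecMul_one, sub_eq_zero, eq_comm]

lemma eigenvalue_norms_finite (v : ℕ) :
    {r : ℝ | ∃ z : ℂ, Module.End.HasEigenvalue (toLin' (F V v)) z ∧ r = ‖z‖}.Finite := by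
  refine ((Module.End.finite_hasEigenvalue (toLin' (F V v))).image fun z => ‖z‖).subset ?_
  rintro r ⟨z, hz, rfl⟩
  exact ⟨z, hz, rfl⟩

lemma norm_le_absZ2 {v : ℕ} {z : ℂ} (hz : Module.End.HasEigenvalue (toLin' (F V v)) z) :
    ‖z‖ ≤ absZ2 V v :=
  le_csSup (eigenvalue_norms_finite v).bddAbove ⟨z, hz, rfl⟩

lemma absZ2_nonneg (v : ℕ) : 0 ≤ absZ2 V v := by
  refine Real.sSup_nonneg ?_
  rintro r ⟨z, -, rfl⟩
  exact norm_nonneg z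

/-- The spectrum of `F_v` is contained in that of `F_{v+1}`: appending `(1|` to a left eigenvector
gives a left eigenvector. -/
lemma absZ2_le_succ (hq : 0 < q) (hV : IsChannel V) (v : ℕ) : absZ2 V v ≤ absZ2 V (v + 1) := by
  refine Real.sSup_le ?_ (absZ2_nonneg _)
  rintro r ⟨z, hz, rfl⟩
  refine norm_le_absZ2 ?_
  rw [hasEigenvalue_iff_exists_vecMul] at hz ⊢
  obtain ⟨x, hx, hxz⟩ := hz
  refine ⟨appendKet1 x, ?_, ?_⟩
  · intro h
    have h1 : ∃ p : Rep q, ket1 p ≠ 0 := by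
      by_contra hcon
      push Not at hcon
      have := ket1_dot_ket0 hq
      simp [dotProduct, hcon] at this
    obtain ⟨p, hp⟩ := h1
    refine hx (funext fun c => ?_)
    have := congrFun h (Fin.snoc c p)
    simpa [appendKet1, hp] using this
  · rw [appendKet1_vecMul_F hq hV, hxz]
    funext c
    simp [appendKet1, mul_assoc]

/-- The powers of a matrix are bounded geometrically, for every rate above the moduli of its
eigenvalues. -/
lemma exists_pow_bound {n : Type*} [Fintype n] [DecidableEq n] (A : Matrix n n ℂ) {ρ r : ℝ}
    (hρ : 0 ≤ ρ) (h : ∀ z, Module.End.HasEigenvalue (toLin' A) z → ‖z‖ ≤ ρ) (hr : ρ < r) :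
    ∃ C : ℝ, ∀ (k : ℕ) (i j : n), ‖(A ^ k) i j‖ ≤ C * r ^ k := by
  let _ : NormedRing (Matrix n n ℂ) := Matrix.linftyOpNormedRing
  let _ : NormedAlgebra ℂ (Matrix n n ℂ) := Matrix.linftyOpNormedAlgebra
  have hr0 : 0 < r := hρ.trans_lt hr
  have hentry : ∀ (B : Matrix n n ℂ) i j, ‖B i j‖ ≤ ‖B‖ := by
    intro B i j
    have h1 : ‖B i j‖₊ ≤ ‖B‖₊ := by
      rw [linfty_opNNNorm_def]
      exact (Finset.single_le_sum (f := fun j => ‖B i j‖₊) (fun _ _ => zero_le)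
        (Finset.mem_univ j)).trans
        (Finset.le_sup (f := fun i => ∑ j, ‖B i j‖₊) (Finset.mem_univ i))
    exact h1
  have hs : spectralRadius ℂ A < ENNReal.ofReal r := by
    refine lt_of_le_of_lt (b := ENNReal.ofReal ρ) ?_ ((ENNReal.ofReal_lt_ofReal_iff hr0).2 hr)
    refine iSup₂_le fun z hz => ?_
    rw [← spectrum_toLin', ← Module.End.hasEigenvalue_iff_mem_spectrum] at hz
    exact ENNReal.coe_le_coe.2 (NNReal.le_toNNReal_of_coe_le (h z hz))
  have hlim := (spectrum.pow_norm_pow_one_div_tendsto_nhds_spectralRadius A).eventually_lt_const hs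
  obtain ⟨K, hK⟩ := eventually_atTop.1 hlim
  have hK' : ∀ k, max K 1 ≤ k → ‖A ^ k‖ ≤ r ^ k := by
    intro k hk
    have h1 := (ENNReal.ofReal_lt_ofReal_iff hr0).1 (hK k ((le_max_left _ _).trans hk))
    have hk0 : k ≠ 0 := by have := (le_max_right K 1).trans hk; omega
    have h2 := pow_le_pow_left₀ (Real.rpow_nonneg (norm_nonneg _) _) h1.le k
    rwa [one_div, Real.rpow_inv_natCast_pow (norm_nonneg _) hk0] at h2
  refine ⟨1 + ∑ k ∈ Finset.range (max K 1), ‖A ^ k‖ / r ^ k, fun k i j => (hentry _ i j).trans ?_⟩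
  have hsum : 0 ≤ ∑ k ∈ Finset.range (max K 1), ‖A ^ k‖ / r ^ k :=
    Finset.sum_nonneg fun _ _ => by positivity
  by_cases hk : max K 1 ≤ k
  · refine (hK' k hk).trans ?_
    exact le_mul_of_one_le_left (by positivity) (by linarith)
  · have h1 : ‖A ^ k‖ / r ^ k ≤ ∑ k ∈ Finset.range (max K 1), ‖A ^ k‖ / r ^ k :=
      Finset.single_le_sum (f := fun k => ‖A ^ k‖ / r ^ k) (fun _ _ => by positivity)
        (Finset.mem_range.2 (not_le.1 hk))
    rw [← div_le_iff₀ (by positivity)]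
    linarith

lemma exists_vecMul_pow_bound {n : Type*} [Fintype n] [DecidableEq n] (A : Matrix n n ℂ) {ρ r : ℝ}
    (hρ : 0 ≤ ρ) (h : ∀ z, Module.End.HasEigenvalue (toLin' A) z → ‖z‖ ≤ ρ) (hr : ρ < r)
    (x : n → ℂ) : ∃ C : ℝ, ∀ (k : ℕ) (j : n), ‖(x ᵥ* A ^ k) j‖ ≤ C * r ^ k := by
  obtain ⟨C, hC⟩ := exists_pow_bound A hρ h hr
  refine ⟨∑ i, ‖x i‖ * C, fun k j => ?_⟩
  rw [vecMul, dotProduct, Finset.sum_mul]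
  refine (norm_sum_le _ _).trans (Finset.sum_le_sum fun i _ => ?_)
  rw [norm_mul, mul_assoc]
  exact mul_le_mul_of_nonneg_left (hC k i j) (norm_nonneg _)

end Generator

/-! ### One-site functionals -/

section SiteForm

variable {q : ℕ}

lemma posSemidef_of_dotProduct_nonneg {n : Type*} [Fintype n] [DecidableEq n] {A : Matrix n n ℂ}
    (h : ∀ x, 0 ≤ star x ⬝ᵥ (A *ᵥ x)) : A.PosSemidef := by
  rw [← isPositive_toEuclideanLin_iff, LinearMap.isPositive_iff_complex]
  intro x
  have h1 : inner ℂ (A.toEuclideanLin x) x = star (star x.ofLp ⬝ᵥ (A *ᵥ x.ofLp)) := by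
    rw [EuclideanSpace.inner_eq_star_dotProduct, ofLp_toLpLin, toLin'_apply, star_dotProduct,
      star_star, dotProduct_comm]
  have h2 := Complex.nonneg_iff.1 (h x.ofLp)
  rw [h1]
  constructor
  · apply Complex.ext <;> simp [← h2.2]
  · simpa using h2.1

lemma exists_smul_one_sub_posSemidef {n : Type*} [Fintype n] [DecidableEq n] {A : Matrix n n ℂ}
    (hA : A.IsHermitian) : ∃ c : ℝ, 0 ≤ c ∧ ((c : ℂ) • (1 : Matrix n n ℂ) - A).PosSemidef := by
  open scoped MatrixOrder Matrix.Norms.L2Operator in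
  have h : A ≤ algebraMap ℝ (Matrix n n ℂ) ‖A‖ := IsSelfAdjoint.le_algebraMap_norm_self hA
  exact ⟨‖A‖, norm_nonneg _, by
    have := Matrix.le_iff.1 h
    rwa [Algebra.algebraMap_eq_smul_one, ← Complex.coe_smul] at this⟩

lemma star_dotProduct_siteForm_mulVec (φ : Rep q → ℂ) (x : Fin q × Fin q → ℂ) :
    star x ⬝ᵥ (siteForm φ *ᵥ x) = φ ⬝ᵥ fun p => star (x p.1.swap) * x p.2 := by
  simp only [dotProduct, mulVec, Finset.mul_sum, siteForm, of_apply, Pi.star_apply]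
  conv_rhs => rw [Fintype.sum_prod_type, ← (Equiv.prodComm (Fin q) (Fin q)).sum_comp]
  refine Finset.sum_congr rfl fun a _ => Finset.sum_congr rfl fun b _ => ?_
  simp only [Equiv.prodComm_apply, Prod.swap_swap]
  ring

lemma siteForm_sub (φ ψ : Rep q → ℂ) : siteForm (φ - ψ) = siteForm φ - siteForm ψ := rfl

lemma siteForm_smul (z : ℂ) (φ : Rep q → ℂ) : siteForm (z • φ) = z • siteForm φ := rfl

lemma siteForm_ket1 :
    siteForm (ket1 (q := q)) = (((Real.sqrt q)⁻¹ : ℝ) : ℂ) • (1 : Matrix _ _ ℂ) := by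
  ext x y
  have h : (x.2 = y.2 ∧ y.1 = x.1) ↔ x = y := by
    rw [Prod.ext_iff, and_comm, @eq_comm _ y.1]
  simp only [siteForm, ket1, of_apply, Matrix.smul_apply, one_apply, Prod.fst_swap, Prod.snd_swap,
    h]
  split_ifs <;> simp

lemma posSemidef_siteForm_ket1 : (siteForm (ket1 (q := q))).PosSemidef := by
  rw [siteForm_ket1]
  refine PosSemidef.one.smul ?_
  rw [Complex.zero_le_real]
  positivity

/-- The orthogonal projection of one-site operators onto the multiples of the identity. -/
def projId (q : ℕ) : Matrix (Fin q × Fin q) (Fin q × Fin q) ℂ :=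
  Matrix.of fun x y => if x.1 = x.2 ∧ y.1 = y.2 then (q : ℂ)⁻¹ else 0

/-- The functional that measures the weight of the identity at one site. -/
def idWeight (p : Rep q) : ℂ := (q : ℂ)⁻¹ * ket0 p

lemma isHermitian_projId : (projId q).IsHermitian := by
  ext x y
  simp only [conjTranspose_apply, projId, of_apply, and_comm (a := y.1 = y.2)]
  split_ifs <;> simp

lemma projId_mul_self (hq : 0 < q) : projId q * projId q = projId q := by
  have hq' : (q : ℂ) ≠ 0 := Nat.cast_ne_zero.2 hq.ne'
  ext x y
  simp only [projId, mul_apply, of_apply]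
  by_cases hx : x.1 = x.2
  · by_cases hy : y.1 = y.2
    · have h : ∀ a b : Fin q, ((if a = b then (q : ℂ)⁻¹ else 0) * if a = b then (q : ℂ)⁻¹ else 0)
          = if a = b then (q : ℂ)⁻¹ * (q : ℂ)⁻¹ else 0 := by
        intro a b
        split_ifs <;> simp
      simp [hx, hy, Fintype.sum_prod_type, h, hq']
    · simp [hy]
  · simp [hx]

lemma one_sub_projId_mul_self (hq : 0 < q) :
    (1 - projId q)ᴴ * (1 - projId q) = 1 - projId q := by
  have h : (projId q)ᴴ = projId q := isHermitian_projId
  rw [conjTranspose_sub, h, conjTranspose_one, sub_mul, mul_sub, mul_sub, projId_mul_self hq]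
  simp

lemma siteForm_idWeight :
    siteForm (idWeight (q := q)) = (((Real.sqrt q)⁻¹ : ℝ) : ℂ) • projId q := by
  ext x y
  simp only [siteForm, idWeight, ket0, of_apply, Matrix.smul_apply, projId, Prod.fst_swap,
    Prod.snd_swap, @eq_comm _ x.2]
  split_ifs <;> simp [mul_comm]

lemma posSemidef_projId (hq : 0 < q) : (projId q).PosSemidef := by
  have h := posSemidef_conjTranspose_mul_self (projId q)
  have h2 : (projId q)ᴴ = projId q := isHermitian_projId
  rwa [h2, projId_mul_self hq] at h

lemma posSemidef_siteForm_idWeight (hq : 0 < q) : (siteForm (idWeight (q := q))).PosSemidef := by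
  rw [siteForm_idWeight]
  refine (posSemidef_projId hq).smul ?_
  rw [Complex.zero_le_real]
  positivity

lemma posSemidef_siteForm_ket1_sub_idWeight (hq : 0 < q) :
    (siteForm (ket1 - idWeight (q := q))).PosSemidef := by
  rw [siteForm_sub, siteForm_ket1, siteForm_idWeight, ← smul_sub, ← one_sub_projId_mul_self hq]
  refine (posSemidef_conjTranspose_mul_self _).smul ?_
  rw [Complex.zero_le_real]
  positivity

lemma repKraus_projId (o p : Rep q) : repKraus (projId q) o p = ket0 o * idWeight p := by
  have hs : ((Real.sqrt q : ℝ) : ℂ)⁻¹ * ((Real.sqrt q : ℝ) : ℂ)⁻¹ = (q : ℂ)⁻¹ := by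
    rw [← mul_inv, ← Complex.ofReal_mul, Real.mul_self_sqrt (Nat.cast_nonneg q),
      Complex.ofReal_natCast]
  simp only [repKraus, projId, of_apply, idWeight, ket0, Prod.fst_swap, Prod.snd_swap,
    @eq_comm _ o.1.2, @eq_comm _ p.1.2]
  have : ∀ A B C D : Prop, ∀ [Decidable A] [Decidable B] [Decidable C] [Decidable D],
      star (if A ∧ B then (q : ℂ)⁻¹ else 0) * (if C ∧ D then (q : ℂ)⁻¹ else 0) =
      (if A ∧ C then ((Real.sqrt q : ℝ) : ℂ)⁻¹ else 0) *
        ((q : ℂ)⁻¹ * if B ∧ D then ((Real.sqrt q : ℝ) : ℂ)⁻¹ else 0) := by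
    intro A B C D _ _ _ _
    by_cases hA : A <;> by_cases hB : B <;> by_cases hC : C <;> by_cases hD : D <;>
      simp [hA, hB, hC, hD]
    rw [← hs]
    ring
  rw [this]

lemma idWeight_dot_ket0 (hq : 0 < q) : idWeight (q := q) ⬝ᵥ ket0 = 1 := by
  have hs : ((Real.sqrt q : ℝ) : ℂ)⁻¹ * ((Real.sqrt q : ℝ) : ℂ)⁻¹ = (q : ℂ)⁻¹ := by
    rw [← mul_inv, ← Complex.ofReal_mul, Real.mul_self_sqrt (Nat.cast_nonneg q),
      Complex.ofReal_natCast]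
  have hq' : (q : ℂ) ≠ 0 := Nat.cast_ne_zero.2 hq.ne'
  have h : ∀ a b c d : Fin q, (idWeight ((a, b), (c, d)) * ket0 ((a, b), (c, d)) : ℂ) =
      if a = b then (if c = d then (q : ℂ)⁻¹ * (q : ℂ)⁻¹ else 0) else 0 := by
    intro a b c d
    simp only [idWeight, ket0]
    nth_rewrite 3 [← hs]
    clear hs
    split_ifs <;> first | (exfalso; grind) | ring
  simp only [dotProduct, Fintype.sum_prod_type, h]
  simp [hq']

lemma ket1_vecMul_repKraus_one_sub_projId (hq : 0 < q) :
    ket1 ᵥ* repKraus (1 - projId q) = ket1 - idWeight (q := q) := by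
  have h1 : siteForm (ket1 - idWeight (q := q)) =
      (((Real.sqrt q)⁻¹ : ℝ) : ℂ) • ((1 - projId q)ᴴ * (1 - projId q)) := by
    rw [siteForm_sub, siteForm_ket1, siteForm_idWeight, ← smul_sub, one_sub_projId_mul_self hq]
  funext p
  have h2 : (ket1 - idWeight : Rep q → ℂ) p =
      siteForm (ket1 - idWeight (q := q)) p.1.swap p.2 := rfl
  rw [h2, h1, Matrix.smul_apply, mul_apply, smul_eq_mul, Finset.mul_sum, vecMul, dotProduct,
    Fintype.sum_prod_type, ← (Equiv.prodComm (Fin q) (Fin q)).sum_comp]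
  refine Finset.sum_congr rfl fun x _ => ?_
  have h3 : ∀ y : Fin q × Fin q, (ket1 (x.swap, y) : ℂ) =
      if x = y then (((Real.sqrt q)⁻¹ : ℝ) : ℂ) else 0 := by
    intro y
    have := congrFun (congrFun (siteForm_ket1 (q := q)) x) y
    simpa [siteForm, one_apply] using this
  simp only [Equiv.prodComm_apply, h3, ite_mul, zero_mul, Finset.sum_ite_eq, Finset.mem_univ,
    if_true, repKraus, of_apply, Prod.swap_swap, conjTranspose_apply]

end SiteForm

/-! ### The generator of width one and a Lyapunov functional for it -/

section Lyapunov

variable {q : ℕ} {V : Matrix (Rep q × Rep q) (Rep q × Rep q) ℂ}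

/-- A row maps `0`'s on all inputs to `0`'s on all outputs, for every final vector `b` of the
auxiliary line. -/
lemma sum_lineSum_mul_ket0 (hV : IsChannel V) (v : ℕ) (b : Rep q → ℂ) (i : Fin v → Rep q) :
    ∑ j, lineSum V v ket0 b i j * ∏ k, ket0 (j k) = (∏ k, ket0 (i k)) * (ket0 ⬝ᵥ b) := by
  induction v generalizing b with
  | zero => simp [lineSum_zero]
  | succ v ih =>
    rw [sum_snoc]
    have h : ∀ j : Fin v → Rep q, ∑ l, lineSum V (v + 1) ket0 b i (Fin.snoc j l) *
        ∏ k, ket0 ((Fin.snoc j l : Fin (v + 1) → Rep q) k) =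
        lineSum V v ket0 (fun m => ∑ l, ket0 l *
          ∑ m', V (i (Fin.last v), m') (m, l) * b m') (Fin.init i) j * ∏ k, ket0 (j k) := by
      intro j
      rw [lineSum_finset_sum, Finset.sum_mul]
      refine Finset.sum_congr rfl fun l _ => ?_
      simp only [lineSum_succ, Fin.snoc_last, Fin.init_snoc, Fin.prod_univ_castSucc,
        Fin.snoc_castSucc]
      ring
    have h2 : ∀ m', ∑ m, ∑ l, V (i (Fin.last v), m') (m, l) * (ket0 m * ket0 l) =
        ket0 (i (Fin.last v)) * ket0 m' := fun m' =>
      (Fintype.sum_prod_type _).symm.trans (hV.mul_ket0 (i (Fin.last v), m'))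
    rw [Finset.sum_congr rfl fun j _ => h j, ih, Fin.prod_univ_castSucc, mul_assoc]
    congr 1
    simp only [dotProduct, Finset.mul_sum]
    have h3 : ∀ G : Rep q → Rep q → Rep q → ℂ,
        ∑ m, ∑ l, ∑ m', G m l m' = ∑ m', ∑ m, ∑ l, G m l m' := fun G =>
      (Finset.sum_congr rfl fun m _ => Finset.sum_comm (f := G m)).trans Finset.sum_comm
    rw [h3]
    refine Finset.sum_congr rfl fun m' _ => ?_
    rw [← mul_assoc, ← h2, Finset.sum_mul]
    refine Finset.sum_congr rfl fun m _ => ?_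
    rw [Finset.sum_mul]
    exact Finset.sum_congr rfl fun l _ => by ring

lemma T_mulVec_ket0 (hq : 0 < q) (hV : IsChannel V) (v : ℕ) :
    T V v *ᵥ (prodVec fun _ => ket0) = prodVec fun _ => ket0 := by
  funext i
  have h := sum_lineSum_mul_ket0 hV v ket1 i
  rw [dotProduct_comm, ket1_dot_ket0 hq, mul_one] at h
  exact h

/-- On row vectors orthogonal to the trivial eigenvector, `T_v` and `F_v` have the same powers. -/
lemma vecMul_T_pow (hq : 0 < q) (hV : IsChannel V) {v : ℕ} {x : (Fin v → Rep q) → ℂ}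
    (hx : (x ⬝ᵥ prodVec fun _ => ket0) = 0) (k : ℕ) : x ᵥ* T V v ^ k = x ᵥ* F V v ^ k := by
  induction k generalizing x with
  | zero => simp
  | succ k ih =>
    have h : x ᵥ* F V v = x ᵥ* T V v := by rw [vecMul_F, hx, zero_smul, sub_zero]
    rw [pow_succ', pow_succ', ← vecMul_vecMul, ← vecMul_vecMul, h]
    refine ih ?_
    rw [← dotProduct_mulVec, T_mulVec_ket0 hq hV, hx]

/-- The action of the generator of width one on one-site functionals. -/
def stepOne (V : Matrix (Rep q × Rep q) (Rep q × Rep q) ℂ) (φ : Rep q → ℂ) : Rep q → ℂ := fun j =>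
  ∑ m, ket0 m * ∑ p : Rep q × Rep q, φ p.1 * ket1 p.2 * V p (m, j)

/-- A one-site functional as a row vector of width one. -/
def ofSite (φ : Rep q → ℂ) : (Fin 1 → Rep q) → ℂ := fun c => φ (c 0)

lemma sum_fin_one (G : (Fin 1 → Rep q) → ℂ) : ∑ c, G c = ∑ p, G fun _ => p := by
  rw [← (Equiv.funUnique (Fin 1) (Rep q)).symm.sum_comp]
  rfl

lemma ofSite_vecMul_T (φ : Rep q → ℂ) : ofSite φ ᵥ* T V 1 = ofSite (stepOne V φ) := by
  funext j
  have h : ∀ p, T V 1 (fun _ => p) j = ∑ m, ket0 m * ∑ m', V (p, m') (m, j 0) * ket1 m' := by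
    intro p
    rw [T_apply, lineSum_succ, lineSum_zero]
    rfl
  have h2 : ∀ m, ∑ p : Rep q × Rep q, φ p.1 * ket1 p.2 * V p (m, j 0) =
      ∑ p, ∑ m', φ p * ket1 m' * V (p, m') (m, j 0) := fun m => Fintype.sum_prod_type _
  rw [vecMul, dotProduct, sum_fin_one]
  simp only [ofSite, stepOne, h, h2, Finset.mul_sum]
  rw [Finset.sum_comm]
  refine Finset.sum_congr rfl fun m _ => Finset.sum_congr rfl fun p _ => ?_
  exact Finset.sum_congr rfl fun m' _ => by ring

lemma sum_bool_config (G : (Bool → Rep q) → ℂ) :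
    ∑ c, G c = ∑ p : Rep q × Rep q, G fun b => if b then p.2 else p.1 := by
  rw [← (Equiv.boolArrowEquivProd (Rep q)).symm.sum_comp]
  refine Finset.sum_congr rfl fun p _ => ?_
  congr 1

/-- Positivity is preserved: dually, the map tensors an operator with the identity on the auxiliary
line and conjugates the result with the gate. -/
lemma posSemidef_stepOne (hV : IsChannel V) {φ : Rep q → ℂ} (hφ : (siteForm φ).PosSemidef) :
    (siteForm (stepOne V φ)).PosSemidef := by
  refine posSemidef_of_dotProduct_nonneg fun x => ?_
  set f : (Bool → Rep q) → ℂ := prodVec fun b => if b then ket1 else φ with hf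
  have hne : false ≠ true := by decide
  have h1 : ∀ X, 0 ≤ f ᵥ* bondMat false true V ⬝ᵥ dens X := by
    rw [dotProduct_dens_nonneg_iff, ← smul_vecMul, ← smul_vecMul]
    obtain ⟨h1, h2, h3⟩ := (dotProduct_dens_nonneg_iff (f := f)).1
      (prodVec_dotProduct_dens_nonneg fun k => by cases k; exacts [hφ, posSemidef_siteForm_ket1])
    exact ⟨hV.nonneg hne h1, hV.nonneg hne h2, hV.nonneg hne h3⟩
  set X : Matrix (Bool → Fin q) (Bool → Fin q) ℂ := Matrix.of fun y z =>
    if y false = z false then x (y true, z true) else 0 with hX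
  have h2 : dens X = ((Real.sqrt q : ℝ) : ℂ) • prodVec fun b => if b then
      (fun p : Rep q => star (x p.1.swap) * x p.2) else ket0 := by
    funext c
    rcases Nat.eq_zero_or_pos q with rfl | hq
    · exact (c true).1.1.elim0
    have hs : ((Real.sqrt q : ℝ) : ℂ) ≠ 0 := by
      rw [Complex.ofReal_ne_zero]
      exact (Real.sqrt_pos.2 (Nat.cast_pos.2 hq)).ne'
    simp only [dens, hX, of_apply, prodVec, Fintype.prod_bool, Pi.smul_apply, smul_eq_mul, ket0,
      if_true, Prod.swap, Bool.false_eq_true, if_false, @eq_comm _ (c false).1.2]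
    by_cases hA : (c false).1.1 = (c false).1.2 <;> by_cases hB : (c false).2.1 = (c false).2.2 <;>
      simp [hA, hB]
    field_simp
  have h3 := h1 X
  rw [h2, dotProduct_smul, smul_eq_mul] at h3
  have h4 : f ᵥ* bondMat false true V ⬝ᵥ (prodVec fun b => if b then
      (fun p : Rep q => star (x p.1.swap) * x p.2) else ket0) =
      star x ⬝ᵥ (siteForm (stepOne V φ) *ᵥ x) := by
    rw [star_dotProduct_siteForm_mulVec, dotProduct, sum_bool_config, Fintype.sum_prod_type,
      Finset.sum_comm]
    simp only [dotProduct, stepOne, Finset.sum_mul]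
    refine Finset.sum_congr rfl fun j _ => Finset.sum_congr rfl fun m _ => ?_
    rw [vecMul_bondMat hne]
    have : ∀ p : Rep q × Rep q, f (pairUpdate (fun b => if b = true then j else m) false true p)
        = φ p.1 * ket1 p.2 := by
      intro p
      rw [hf, prodVec, Fintype.prod_bool, pairUpdate_left, pairUpdate_right _ hne]
      simp [mul_comm]
    simp only [this, prodVec, Fintype.prod_bool, if_true, Bool.false_eq_true, if_false]
    ring
  rw [h4] at h3
  rcases Nat.eq_zero_or_pos q with rfl | hq
  · have : star x ⬝ᵥ (siteForm (stepOne V φ) *ᵥ x) = 0 :=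
      Finset.sum_eq_zero fun p _ => p.1.elim0
    rw [this]
  have hs : ((Real.sqrt q : ℝ) : ℂ) ≠ 0 := by
    rw [Complex.ofReal_ne_zero]
    exact (Real.sqrt_pos.2 (Nat.cast_pos.2 hq)).ne'
  have hs2 : (0 : ℂ) ≤ (((Real.sqrt q)⁻¹ : ℝ) : ℂ) := by
    rw [Complex.zero_le_real]
    positivity
  have h5 := mul_nonneg hs2 h3
  rwa [← mul_assoc, Complex.ofReal_inv, inv_mul_cancel₀ hs, one_mul] at h5

/-- For every rate `r` above `|z₂(1)|`, a positive functional that vanishes on the identity is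
dominated by one whose image under the generator of width one is at most `r` times itself, namely
`M = ∑ r^{-k} N T_1^k`. -/
lemma exists_lyapunov (hq : 0 < q) (hV : IsChannel V) {N : Rep q → ℂ}
    (hN : (siteForm N).PosSemidef) (hN0 : N ⬝ᵥ ket0 = 0) {r : ℝ} (hr : absZ2 V 1 < r) :
    ∃ M : Rep q → ℂ, (siteForm M).PosSemidef ∧ (siteForm (M - N)).PosSemidef ∧
      stepOne V M = (r : ℂ) • (M - N) := by
  obtain ⟨r', hr', hr'r⟩ := exists_between hr
  have hr'0 : 0 < r' := (absZ2_nonneg 1).trans_lt hr'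
  have hr0 : 0 < r := hr'0.trans hr'r
  have hrC : (r : ℂ) ≠ 0 := Complex.ofReal_ne_zero.2 hr0.ne'
  obtain ⟨C, hC⟩ := exists_vecMul_pow_bound (F V 1) (absZ2_nonneg 1)
    (fun z hz => norm_le_absZ2 hz) hr' (ofSite N)
  have hdot : (ofSite N ⬝ᵥ prodVec fun _ => ket0) = 0 := by
    rw [dotProduct, sum_fin_one, ← hN0]
    simp [ofSite, prodVec, dotProduct]
  have hiter : ∀ k, ofSite ((stepOne V)^[k] N) = ofSite N ᵥ* F V 1 ^ k := by
    intro k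
    rw [← vecMul_T_pow hq hV hdot]
    induction k with
    | zero => simp
    | succ k ih =>
      rw [Function.iterate_succ_apply', ← ofSite_vecMul_T, ih, vecMul_vecMul, pow_succ]
  have hbound : ∀ k p, ‖(stepOne V)^[k] N p‖ ≤ C * r' ^ k := by
    intro k p
    have := hC k fun _ => p
    rwa [← hiter k] at this
  have hpsd : ∀ k, (siteForm ((stepOne V)^[k] N)).PosSemidef := by
    intro k
    induction k with
    | zero => exact hN
    | succ k ih =>
      rw [Function.iterate_succ_apply']
      exact posSemidef_stepOne hV ih
  have hsum : ∀ p, Summable fun k => ((r⁻¹ ^ k : ℝ) : ℂ) * (stepOne V)^[k] N p := by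
    intro p
    refine Summable.of_norm_bounded (g := fun k => C * (r' / r) ^ k)
      ((summable_geometric_of_lt_one (by positivity) ((div_lt_one hr0).2 hr'r)).mul_left C) ?_
    intro k
    rw [norm_mul, Complex.norm_real, norm_pow, Real.norm_of_nonneg (inv_nonneg.2 hr0.le)]
    calc r⁻¹ ^ k * ‖(stepOne V)^[k] N p‖ ≤ r⁻¹ ^ k * (C * r' ^ k) :=
          mul_le_mul_of_nonneg_left (hbound k p) (by positivity)
      _ = C * (r' / r) ^ k := by
          rw [div_pow, inv_pow]
          field_simp
  set M : Rep q → ℂ := fun p => ∑' k, ((r⁻¹ ^ k : ℝ) : ℂ) * (stepOne V)^[k] N p with hM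
  have hHas : ∀ p, HasSum (fun k => ((r⁻¹ ^ k : ℝ) : ℂ) * (stepOne V)^[k] N p) (M p) :=
    fun p => (hsum p).hasSum
  have hMpsd : (siteForm M).PosSemidef := by
    refine posSemidef_of_dotProduct_nonneg fun x => ?_
    rw [star_dotProduct_siteForm_mulVec]
    have h1 : HasSum (fun k => ∑ p, ((r⁻¹ ^ k : ℝ) : ℂ) * (stepOne V)^[k] N p *
        (star (x p.1.swap) * x p.2)) (∑ p, M p * (star (x p.1.swap) * x p.2)) :=
      hasSum_sum fun p _ => (hHas p).mul_right _
    refine h1.nonneg fun k => ?_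
    have h2 := (hpsd k).dotProduct_mulVec_nonneg x
    rw [star_dotProduct_siteForm_mulVec] at h2
    simp only [mul_assoc, ← Finset.mul_sum]
    refine mul_nonneg ?_ h2
    rw [Complex.zero_le_real]
    positivity
  have hstep : stepOne V M = (r : ℂ) • (M - N) := by
    funext j
    have h1 : HasSum (fun k => ((r⁻¹ ^ k : ℝ) : ℂ) * (stepOne V)^[k + 1] N j) (stepOne V M j) := by
      have h2 : HasSum (fun k => ∑ m, ket0 m * ∑ p : Rep q × Rep q,
          ((r⁻¹ ^ k : ℝ) : ℂ) * (stepOne V)^[k] N p.1 * ket1 p.2 * V p (m, j)) (stepOne V M j) :=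
        hasSum_sum fun m _ => (hasSum_sum fun p _ =>
          ((hHas p.1).mul_right _).mul_right _).mul_left _
      have h3 : (fun k => ((r⁻¹ ^ k : ℝ) : ℂ) * (stepOne V)^[k + 1] N j) =
          fun k => ∑ m, ket0 m * ∑ p : Rep q × Rep q,
            ((r⁻¹ ^ k : ℝ) : ℂ) * (stepOne V)^[k] N p.1 * ket1 p.2 * V p (m, j) := by
        funext k
        rw [Function.iterate_succ_apply', stepOne, Finset.mul_sum]
        refine Finset.sum_congr rfl fun m _ => ?_
        rw [mul_left_comm, Finset.mul_sum]
        congr 1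
        exact Finset.sum_congr rfl fun p _ => by ring
      rw [h3]
      exact h2
    have h3 := (hasSum_nat_add_iff' 1).2 (hHas j)
    have h4 : HasSum (fun k => ((r⁻¹ ^ k : ℝ) : ℂ) * (stepOne V)^[k + 1] N j)
        ((r : ℂ) * (M j - N j)) := by
      have h5 := h3.mul_left (r : ℂ)
      simp only [Finset.range_one, Finset.sum_singleton, pow_zero, Complex.ofReal_one, one_mul,
        Function.iterate_zero, id] at h5
      have h6 : (fun k => ((r⁻¹ ^ k : ℝ) : ℂ) * (stepOne V)^[k + 1] N j) =
          fun k => (r : ℂ) * (((r⁻¹ ^ (k + 1) : ℝ) : ℂ) * (stepOne V)^[k + 1] N j) := by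
        funext k
        push_cast
        rw [pow_succ]
        field_simp
      rw [h6]
      exact h5
    exact h1.unique h4
  refine ⟨M, hMpsd, ?_, hstep⟩
  have h6 : M - N = ((r⁻¹ : ℝ) : ℂ) • stepOne V M := by
    rw [hstep, smul_smul]
    simp [hrC]
  rw [h6, siteForm_smul]
  refine (posSemidef_stepOne hV hMpsd).smul ?_
  rw [Complex.zero_le_real]
  positivity

end Lyapunov

/-! ### Rows of gates -/

section Row

variable {ι : Type} [Fintype ι] [DecidableEq ι] {q : ℕ}
  {V : Matrix (Rep q × Rep q) (Rep q × Rep q) ℂ} {s : ℕ → ι}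

/-- A row of `v` gates along the sites `s 0, …, s v`; the gate on `(s 0, s 1)` acts first. -/
def row (V : Matrix (Rep q × Rep q) (Rep q × Rep q) ℂ) (s : ℕ → ι) :
    ℕ → Matrix (ι → Rep q) (ι → Rep q) ℂ
  | 0 => 1
  | v + 1 => bondMat (s v) (s (v + 1)) V * row V s v

/-- The action of a row on functionals of its left output legs `s 0, …, s (v - 1)`, of its right
output leg `s v`, and of the other sites: on the left inputs it is the sum defining the light-like
generator. -/
lemma vecMul_row {v : ℕ} (hs : Set.InjOn s (Set.Iic v)) (f : (Fin v → Rep q) → ℂ) (h : Rep q → ℂ)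
    (ρ : (ι → Rep q) → ℂ) (hρ : ∀ k ≤ v, ∀ c p, ρ (Function.update c (s k) p) = ρ c)
    {Ψ : (ι → Rep q) → ℂ} (hΨ : ∀ c, Ψ c = f (fun k => c (s k)) * h (c (s v)) * ρ c)
    (c : ι → Rep q) :
    (Ψ ᵥ* row V s v) c =
      (∑ i, f i * lineSum V v (Pi.single (c (s 0)) 1) h i fun k => c (s (k + 1))) * ρ c := by
  induction v generalizing h ρ Ψ c with
  | zero =>
    rw [row, vecMul_one, hΨ, Fintype.sum_unique, lineSum_zero, single_dotProduct, one_mul]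
    congr 3
    exact Subsingleton.elim _ _
  | succ v ih =>
    have hne : s v ≠ s (v + 1) := fun e => by
      have := hs (Set.mem_Iic.2 (Nat.le_succ v)) (Set.mem_Iic.2 le_rfl) e
      omega
    have hne' : ∀ k ≤ v, s k ≠ s (v + 1) := fun k hk e => by
      have := hs (Set.mem_Iic.2 (hk.trans (Nat.le_succ v))) (Set.mem_Iic.2 le_rfl) e
      omega
    have hne'' : ∀ k < v, s k ≠ s v := fun k hk e => by
      have := hs (Set.mem_Iic.2 (by omega)) (Set.mem_Iic.2 (Nat.le_succ v)) e
      omega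
    set g : Rep q → Rep q → (ι → Rep q) → ℂ := fun p j c =>
      f (Fin.snoc (fun k : Fin v => c (s k)) p) * (∑ m', V (p, m') (c (s v), j) * h m') *
        (if c (s (v + 1)) = j then ρ c else 0) with hg
    have h1 : Ψ ᵥ* bondMat (s v) (s (v + 1)) V = ∑ p, ∑ j, g p j := by
      funext c
      have h2 : ∀ p : Rep q × Rep q, Ψ (pairUpdate c (s v) (s (v + 1)) p) =
          f (Fin.snoc (fun k : Fin v => c (s k)) p.1) * h p.2 * ρ c := by
        intro p
        rw [hΨ, pairUpdate_right c hne, pairUpdate, hρ v (Nat.le_succ v), hρ (v + 1) le_rfl]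
        congr 3
        funext k
        refine Fin.lastCases ?_ (fun k => ?_) k
        · rw [Fin.snoc_last, Fin.val_last, Function.update_self]
        · rw [Fin.snoc_castSucc, Fin.val_castSucc, Function.update_of_ne (hne'' k k.2),
            Function.update_of_ne (hne' k k.2.le)]
      rw [vecMul_bondMat hne, Fintype.sum_prod_type]
      simp only [Finset.sum_apply]
      refine Finset.sum_congr rfl fun p _ => ?_
      simp only [hg, mul_ite, mul_zero, Finset.sum_ite_eq, Finset.mem_univ, if_true, h2,
        Finset.mul_sum, Finset.sum_mul]
      exact Finset.sum_congr rfl fun m' _ => by ring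
    rw [row, ← vecMul_vecMul, h1]
    simp only [sum_vecMul, Finset.sum_apply]
    have h3 : ∀ p j, (g p j ᵥ* row V s v) c = (∑ i, f (Fin.snoc i p) *
        lineSum V v (Pi.single (c (s 0)) 1) (fun m => ∑ m', V (p, m') (m, j) * h m') i
          fun k => c (s (k + 1))) * (if c (s (v + 1)) = j then ρ c else 0) := by
      intro p j
      refine ih (hs.mono (Set.Iic_subset_Iic.2 (Nat.le_succ v))) (fun i => f (Fin.snoc i p))
        (fun m => ∑ m', V (p, m') (m, j) * h m') (fun c => if c (s (v + 1)) = j then ρ c else 0)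
        ?_ (fun c => rfl) c
      intro k hk c p
      rw [Function.update_of_ne (hne' k hk).symm, hρ k (hk.trans (Nat.le_succ v))]
    simp only [h3, mul_ite, mul_zero, Finset.sum_ite_eq, Finset.mem_univ, if_true]
    rw [← Finset.sum_mul, sum_snoc, Finset.sum_comm]
    congr 1
    refine Finset.sum_congr rfl fun i _ => Finset.sum_congr rfl fun p _ => ?_
    rw [lineSum_succ, Fin.snoc_last, Fin.init_snoc]
    rfl

/-- The functional `f` of the sites `s 0, …, s (v - 1)`, with the row vector `1` at all other
sites. -/
def lift (s : ℕ → ι) (v : ℕ) (f : (Fin v → Rep q) → ℂ) : (ι → Rep q) → ℂ := fun c =>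
  f (fun k => c (s k)) * ∏ k ∈ Finset.univ \ (Finset.range v).image s, ket1 (c k)

/-- The projection `|0)(1|`: it resets a site to the state `0`. -/
def reset (q : ℕ) : Matrix (Rep q) (Rep q) ℂ := vecMulVec ket0 ket1

lemma vecMul_reset (φ : Rep q → ℂ) : φ ᵥ* reset q = (φ ⬝ᵥ ket0) • ket1 := by
  rw [reset, vecMul_vecMulVec]

/-- If the auxiliary line of a row enters in the state `0`, which is what the reset of `s 0`
enforces, then a functional of the outputs of the row is pulled back along the light-like generator.
The outputs are at `s 0, …, s (v - 1)`, the inputs at `s 1, …, s v`. -/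
lemma lift_vecMul_row {v : ℕ} (hs : Set.InjOn s (Set.Iic v)) (f : (Fin v → Rep q) → ℂ) :
    lift s v f ᵥ* row V s v ᵥ* siteMat (s 0) (reset q) =
      lift (fun k => s (k + 1)) v (f ᵥ* T V v) := by
  set S : Finset ι := Finset.univ \ (Finset.range (v + 1)).image s with hS
  have hmem : ∀ k ≤ v, s k ∉ S := fun k hk => by
    rw [hS, Finset.mem_sdiff, not_and_not_right]
    exact fun _ => Finset.mem_image_of_mem _ (Finset.mem_range.2 (by omega))
  have h1 : ∀ c : ι → Rep q, lift s v f c =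
      f (fun k => c (s k)) * ket1 (c (s v)) * ∏ k ∈ S, ket1 (c k) := by
    intro c
    have e : Finset.univ \ (Finset.range v).image s = insert (s v) S := by
      ext k
      simp only [hS, Finset.mem_sdiff, Finset.mem_univ, true_and, Finset.mem_image,
        Finset.mem_range, Finset.mem_insert, not_exists, not_and]
      constructor
      · intro h
        by_cases hk : k = s v
        · exact Or.inl hk
        · refine Or.inr fun a ha e => ?_
          rcases Nat.lt_succ_iff_lt_or_eq.1 ha with h' | rfl
          · exact h a h' e
          · exact hk e.symm
      · rintro (rfl | h) a ha e
        · have := hs (Set.mem_Iic.2 ha.le) (Set.mem_Iic.2 le_rfl) e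
          omega
        · exact h a (by omega) e
    rw [lift, e, Finset.prod_insert (hmem v le_rfl)]
    ring
  have h2 : ∀ c : ι → Rep q, lift (fun k => s (k + 1)) v (f ᵥ* T V v) c =
      (f ᵥ* T V v) (fun k => c (s (k + 1))) * ket1 (c (s 0)) * ∏ k ∈ S, ket1 (c k) := by
    intro c
    have e : Finset.univ \ (Finset.range v).image (fun k => s (k + 1)) = insert (s 0) S := by
      ext k
      simp only [hS, Finset.mem_sdiff, Finset.mem_univ, true_and, Finset.mem_image,
        Finset.mem_range, Finset.mem_insert, not_exists, not_and]
      constructor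
      · intro h
        by_cases hk : k = s 0
        · exact Or.inl hk
        · refine Or.inr fun a ha e => ?_
          rcases Nat.eq_zero_or_pos a with rfl | h'
          · exact hk e.symm
          · exact h (a - 1) (by omega) (by rwa [Nat.sub_add_cancel h'])
      · rintro (rfl | h) a ha e
        · have := hs (Set.mem_Iic.2 (by omega)) (Set.mem_Iic.2 (Nat.zero_le v)) e
          omega
        · exact h (a + 1) (by omega) e
    rw [lift, e, Finset.prod_insert (hmem 0 (Nat.zero_le v))]
    ring
  funext c
  have hne : ∀ k : Fin v, s (k + 1) ≠ s 0 := fun k e => by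
    have := hs (Set.mem_Iic.2 (by omega)) (Set.mem_Iic.2 (Nat.zero_le v)) e
    omega
  rw [h2, vecMul_siteMat]
  have h3 : ∀ p, (lift s v f ᵥ* row V s v) (Function.update c (s 0) p) =
      (∑ i, f i * lineSum V v (Pi.single p 1) ket1 i fun k => c (s (k + 1))) *
        ∏ k ∈ S, ket1 (c k) := by
    intro p
    rw [vecMul_row hs f ket1 (fun c => ∏ k ∈ S, ket1 (c k))
      (fun k hk c p => prod_update_of_notMem (hmem k hk) c p fun _ => ket1) h1,
      prod_update_of_notMem (hmem 0 (Nat.zero_le v)) c p fun _ => ket1]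
    simp only [Function.update_self, Function.update_of_ne (hne _)]
  have h4 : (f ᵥ* T V v) (fun k => c (s (k + 1))) = ∑ p,
      (∑ i, f i * lineSum V v (Pi.single p 1) ket1 i fun k => c (s (k + 1))) * ket0 p := by
    rw [vecMul, dotProduct]
    simp only [T_apply, Finset.sum_mul]
    rw [Finset.sum_comm]
    refine Finset.sum_congr rfl fun i _ => ?_
    rw [lineSum_eq_sum_left, Finset.mul_sum]
    exact Finset.sum_congr rfl fun p _ => by ring
  simp only [h3, h4, reset, vecMulVec_apply]
  rw [Finset.sum_mul, Finset.sum_mul]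
  exact Finset.sum_congr rfl fun p _ => by ring

/-- A product of `1`'s and identity weights is not changed by a row of gates within whose range all
factors agree. -/
lemma prodVec_vecMul_row (hV : IsChannel V) {v : ℕ} (hs : Set.InjOn s (Set.Iic v))
    {φ : ι → Rep q → ℂ} (hφ : (∀ k ≤ v, φ (s k) = ket1) ∨ ∀ k ≤ v, φ (s k) = idWeight) :
    prodVec φ ᵥ* row V s v = prodVec φ := by
  induction v with
  | zero => rw [row, vecMul_one]
  | succ v ih =>
    have hne : s v ≠ s (v + 1) := fun e => by
      have := hs (Set.mem_Iic.2 (Nat.le_succ v)) (Set.mem_Iic.2 le_rfl) e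
      omega
    rw [row, ← vecMul_vecMul, prodVec_vecMul_bondMat hne _ fun _ _ _ => rfl]
    · refine ih (hs.mono (Set.Iic_subset_Iic.2 (Nat.le_succ v))) ?_
      exact hφ.imp (fun h k hk => h k (hk.trans (Nat.le_succ v)))
        fun h k hk => h k (hk.trans (Nat.le_succ v))
    · intro r
      rcases hφ with h | h
      · rw [h v (Nat.le_succ v), h (v + 1) le_rfl]
        exact hV.ket1_mul r
      · rw [h v (Nat.le_succ v), h (v + 1) le_rfl]
        have h1 := hV.ket0_mul r
        simp only [idWeight]
        calc ∑ p : Rep q × Rep q, (q : ℂ)⁻¹ * ket0 p.1 * ((q : ℂ)⁻¹ * ket0 p.2) * V p r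
            = (q : ℂ)⁻¹ * (q : ℂ)⁻¹ * ∑ p : Rep q × Rep q, ket0 p.1 * ket0 p.2 * V p r := by
              rw [Finset.mul_sum]
              exact Finset.sum_congr rfl fun p _ => by ring
          _ = (q : ℂ)⁻¹ * ket0 r.1 * ((q : ℂ)⁻¹ * ket0 r.2) := by rw [h1]; ring

lemma lift_vecMul_bondMat (hV : IsChannel V) {v : ℕ} (f : (Fin v → Rep q) → ℂ) {i j : ι}
    (hij : i ≠ j) (hi : ∀ k < v, s k ≠ i) (hj : ∀ k < v, s k ≠ j) :
    lift s v f ᵥ* bondMat i j V = lift s v f := by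
  set S : Finset ι := Finset.univ \ (Finset.range v).image s with hS
  have hiS : i ∈ S := by
    simp only [hS, Finset.mem_sdiff, Finset.mem_univ, true_and, Finset.mem_image, Finset.mem_range,
      not_exists, not_and]
    exact hi
  have hjS : j ∈ S.erase i := by
    simp only [hS, Finset.mem_erase, Finset.mem_sdiff, Finset.mem_univ, true_and, Finset.mem_image,
      Finset.mem_range, not_exists, not_and]
    exact ⟨hij.symm, hj⟩
  have h1 : ∀ c : ι → Rep q, lift s v f c = ket1 (c i) * ket1 (c j) *
      (f (fun k => c (s k)) * ∏ k ∈ (S.erase i).erase j, ket1 (c k)) := by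
    intro c
    rw [lift, ← hS, ← Finset.mul_prod_erase S _ hiS, ← Finset.mul_prod_erase _ _ hjS]
    ring
  funext c
  rw [vecMul_bondMat_of_factor hij hV.ket1_mul _ _ h1, ← h1]
  intro c p
  congr 1
  · congr 1
    funext k
    rw [pairUpdate_of_ne c (hi k k.2) (hj k k.2)]
  · refine Finset.prod_congr rfl fun k hk => ?_
    simp only [Finset.mem_erase] at hk
    rw [pairUpdate_of_ne c hk.2.1 hk.1]

end Row

/-! ### One row of the circuit: the recursive estimate -/

section Step

variable {ι : Type} [Fintype ι] [DecidableEq ι] {q : ℕ}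
  {V : Matrix (Rep q × Rep q) (Rep q × Rep q) ℂ} {s : ℕ → ι}

/-- The product functional with the factor `φ` at the site `i` and `1` elsewhere. -/
def siteFun (i : ι) (φ : Rep q → ℂ) : (ι → Rep q) → ℂ :=
  prodVec (Function.update (fun _ => ket1) i φ)

lemma siteFun_sub (i : ι) (φ ψ : Rep q → ℂ) : siteFun i (φ - ψ) = siteFun i φ - siteFun i ψ := by
  have h := prodVec_update_add (fun _ => ket1) i (φ - ψ) ψ
  rw [sub_add_cancel] at h
  exact eq_sub_of_add_eq h.symm

lemma siteFun_smul (i : ι) (z : ℂ) (φ : Rep q → ℂ) : siteFun i (z • φ) = z • siteFun i φ :=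
  prodVec_update_smul _ _ _ _

lemma siteFun_ket1 (i : ι) : siteFun i ket1 = prodVec fun _ => (ket1 (q := q)) := by
  rw [siteFun, Function.update_eq_self_iff.2 rfl]

lemma Nonneg.vecMul_row (hV : IsChannel V) {v : ℕ} (hs : Set.InjOn s (Set.Iic v))
    {f : (ι → Rep q) → ℂ} (hf : Nonneg f) : Nonneg (f ᵥ* row V s v) := by
  induction v generalizing f with
  | zero => rwa [row, vecMul_one]
  | succ v ih =>
    have hne : s v ≠ s (v + 1) := fun e => by
      have := hs (Set.mem_Iic.2 (Nat.le_succ v)) (Set.mem_Iic.2 le_rfl) e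
      omega
    rw [row, ← vecMul_vecMul]
    exact ih (hs.mono (Set.Iic_subset_Iic.2 (Nat.le_succ v))) (hV.nonneg hne hf)

/-- The product functional of identity weights on `S`, a positive semidefinite factor at `i`, and
`1` elsewhere is nonnegative. -/
lemma nonneg_prodVec_ite (hq : 0 < q) (S : Finset ι) {i : ι} (hi : i ∉ S) {φ : Rep q → ℂ}
    (hφ : (siteForm φ).PosSemidef) :
    Nonneg (prodVec (Function.update (fun k => if k ∈ S then idWeight else ket1) i φ)) := by
  refine nonneg_prodVec fun k => ?_
  by_cases hk : k = i
  · subst hk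
    rwa [Function.update_self]
  · rw [Function.update_of_ne hk]
    split_ifs
    exacts [posSemidef_siteForm_idWeight hq, posSemidef_siteForm_ket1]

/-- The weight of the identity at `i` is at least the weight of the identity on `insert i S`. -/
lemma nonneg_idWeight_sub (hq : 0 < q) (S : Finset ι) {i : ι} (hi : i ∉ S) :
    Nonneg (siteFun i (idWeight (q := q)) -
      prodVec fun k => if k ∈ insert i S then idWeight else ket1) := by
  induction S using Finset.induction_on with
  | empty =>
    have h : siteFun i (idWeight (q := q)) =
        prodVec fun k => if k ∈ insert i (∅ : Finset ι) then idWeight else ket1 := by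
      rw [siteFun]
      congr 1
      funext k
      by_cases hk : k = i <;> simp [hk, Function.update_of_ne]
    rw [h, sub_self]
    intro X
    simp
  | insert a S ha ih =>
    rw [Finset.mem_insert, not_or] at hi
    have h1 := ih hi.2
    have ha' : a ∉ insert i S := by
      rw [Finset.mem_insert, not_or]
      exact ⟨fun e => hi.1 e.symm, ha⟩
    have h2 := nonneg_prodVec_ite hq (insert i S) ha' (posSemidef_siteForm_ket1_sub_idWeight hq)
    have h3 := prodVec_update_add (fun k => if k ∈ insert i S then idWeight else ket1 (q := q)) a
      (ket1 - idWeight) idWeight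
    have h4 : Function.update (fun k => if k ∈ insert i S then idWeight else ket1 (q := q)) a ket1 =
        fun k => if k ∈ insert i S then idWeight else ket1 := by
      rw [Function.update_eq_self_iff, if_neg ha']
    have h5 : Function.update (fun k => if k ∈ insert i S then idWeight else ket1 (q := q)) a
        idWeight = fun k => if k ∈ insert i (insert a S) then idWeight else ket1 := by
      funext k
      by_cases hk : k = a
      · subst hk
        simp
      · rw [Function.update_of_ne hk]
        simp [hk]
    rw [sub_add_cancel, h4, h5] at h3
    have h6 := h1.add h2
    rw [h3] at h6
    convert h6 using 1
    abel

/-- A vector on which all nonnegative functionals have nonnegative real part. -/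
def IsState (x : (ι → Rep q) → ℂ) : Prop := ∀ f, Nonneg f → 0 ≤ (f ⬝ᵥ x).re

lemma IsState.row_mulVec (hV : IsChannel V) {v : ℕ} (hs : Set.InjOn s (Set.Iic v))
    {x : (ι → Rep q) → ℂ} (hx : IsState x) : IsState (row V s v *ᵥ x) := fun f hf => by
  rw [dotProduct_mulVec]
  exact hx _ (hf.vecMul_row hV hs)

lemma lift_prodVec {v : ℕ} (hs : Set.InjOn s (Set.Iio v)) (φ : Rep q → ℂ) :
    lift s v (prodVec fun _ => φ) =
      prodVec fun k => if k ∈ (Finset.range v).image s then φ else ket1 := by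
  funext c
  have h : ∏ k : Fin v, φ (c (s k)) = ∏ k ∈ (Finset.range v).image s, φ (c k) := by
    rw [Finset.prod_image fun a ha b hb => hs (by simpa using ha) (by simpa using hb),
      Finset.prod_range]
  simp only [lift, prodVec]
  rw [h, ← Finset.prod_sdiff (Finset.subset_univ ((Finset.range v).image s)), mul_comm]
  congr 1
  · refine Finset.prod_congr rfl fun k hk => ?_
    rw [if_neg (Finset.mem_sdiff.1 hk).2]
  · refine Finset.prod_congr rfl fun k hk => ?_
    rw [if_pos hk]

lemma lift_sub {v : ℕ} (f g : (Fin v → Rep q) → ℂ) :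
    lift s v (f - g) = lift s v f - lift s v g := by
  funext c
  simp only [lift, Pi.sub_apply, sub_mul]

/-- The inequality for the last gate of a row, which feeds the auxiliary line at `i` and the site
`j`. Where the line carries the identity, the gate acts on `M` as the generator of width one, which
contracts `M` at the rate `r`; elsewhere `M` is at most `c`. -/
lemma nonneg_last_gate (hq : 0 < q) (hV : IsChannel V) {i j : ι} (hij : i ≠ j) {M N : Rep q → ℂ}
    {r : ℝ} (hr : 0 ≤ r) (hM : (siteForm M).PosSemidef) (hN : (siteForm N).PosSemidef)
    (hstep : stepOne V M = (r : ℂ) • (M - N)) {c : ℝ}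
    (hc : (siteForm ((c : ℂ) • ket1 - M)).PosSemidef) {δ : ℝ} (hδ : 0 < δ) :
    Nonneg ((((1 + δ) * r : ℝ) : ℂ) • siteFun j M +
      (((1 + δ⁻¹) * c : ℝ) : ℂ) • siteFun i (ket1 - idWeight) -
      siteFun i M ᵥ* bondMat i j V) := by
  set Ψ := siteFun i M ᵥ* bondMat i j V with hΨ
  have hMn : Nonneg (siteFun i M) := by
    simpa [siteFun] using nonneg_prodVec_ite hq ∅ (Finset.notMem_empty i) hM
  have h1 := (hV.nonneg hij hMn).split i (projId q) hδ
  -- the part in which the auxiliary line carries the identity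
  have h2 : Ψ ᵥ* siteMat i (repKraus (projId q)) =
      prodVec (Function.update (fun k => if k ∈ ({i} : Finset ι) then idWeight else ket1) j
        (stepOne V M)) := by
    have hf : ∀ c : ι → Rep q, siteFun i M c = M (c i) * ket1 (c j) *
        ∏ k ∈ (Finset.univ.erase i).erase j, ket1 (c k) := by
      intro c
      rw [siteFun, prodVec_eq_pair_mul _ hij, Function.update_self, Function.update_of_ne hij.symm]
      congr 1
      refine Finset.prod_congr rfl fun k hk => ?_
      rw [Function.update_of_ne (Finset.mem_erase.1 (Finset.mem_erase.1 hk).2).1]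
    have hΨc : ∀ c : ι → Rep q, Ψ c = (∑ p : Rep q × Rep q, M p.1 * ket1 p.2 * V p (c i, c j)) *
        ∏ k ∈ (Finset.univ.erase i).erase j, ket1 (c k) := by
      intro c
      rw [hΨ, vecMul_bondMat hij, Finset.sum_mul]
      refine Finset.sum_congr rfl fun p _ => ?_
      rw [hf, pairUpdate_left, pairUpdate_right c hij, Finset.prod_congr rfl fun k hk => by
        rw [pairUpdate_of_ne c (Finset.mem_erase.1 (Finset.mem_erase.1 hk).2).1
          (Finset.mem_erase.1 hk).1]]
      ring
    funext c
    rw [vecMul_siteMat, prodVec_eq_pair_mul _ hij, Function.update_self, Function.update_of_ne hij,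
      if_pos (Finset.mem_singleton_self i)]
    have h3 : ∏ k ∈ (Finset.univ.erase i).erase j, Function.update
        (fun k => if k ∈ ({i} : Finset ι) then idWeight else ket1) j (stepOne V M) k (c k) =
        ∏ k ∈ (Finset.univ.erase i).erase j, ket1 (c k) := by
      refine Finset.prod_congr rfl fun k hk => ?_
      rw [Function.update_of_ne (Finset.mem_erase.1 hk).1, if_neg]
      rw [Finset.mem_singleton]
      exact (Finset.mem_erase.1 (Finset.mem_erase.1 hk).2).1
    rw [h3, stepOne, Finset.mul_sum, Finset.sum_mul]
    refine Finset.sum_congr rfl fun p _ => ?_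
    rw [hΨc, Function.update_self, Function.update_of_ne hij.symm, repKraus_projId,
      Finset.prod_congr rfl fun k hk => by
        rw [Function.update_of_ne (Finset.mem_erase.1 (Finset.mem_erase.1 hk).2).1]]
    ring
  have hji : j ∉ ({i} : Finset ι) := by
    rw [Finset.mem_singleton]
    exact hij.symm
  have h3 : Nonneg ((r : ℂ) • siteFun j M - Ψ ᵥ* siteMat i (repKraus (projId q))) := by
    have e1 := prodVec_update_smul (fun k => if k ∈ ({i} : Finset ι) then idWeight else ket1) j
      (r : ℂ) (M - N)
    have e2 := prodVec_update_add (fun k => if k ∈ ({i} : Finset ι) then idWeight else ket1) j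
      (M - N) N
    have e3 := prodVec_update_add (Function.update (fun _ => ket1) j M) i (ket1 - idWeight) idWeight
    have n1 := nonneg_prodVec_ite hq {i} hji hN
    have n2 : Nonneg (prodVec (Function.update (Function.update (fun _ => ket1) j M) i
        (ket1 - idWeight))) := by
      refine nonneg_prodVec fun k => ?_
      by_cases hk : k = i
      · subst hk
        rw [Function.update_self]
        exact posSemidef_siteForm_ket1_sub_idWeight hq
      · rw [Function.update_of_ne hk]
        by_cases hk' : k = j
        · subst hk'
          rwa [Function.update_self]
        · rw [Function.update_of_ne hk']
          exact posSemidef_siteForm_ket1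
    have e4 : Function.update (Function.update (fun _ => ket1) j M) i idWeight =
        Function.update (fun k => if k ∈ ({i} : Finset ι) then idWeight else ket1) j M := by
      rw [Function.update_comm hij.symm]
      congr 1
      funext k
      by_cases hk : k = i <;> simp [hk, Function.update_of_ne]
    have e5 : Function.update (Function.update (fun _ => ket1) j M) i (ket1 (q := q)) =
        Function.update (fun _ => ket1) j M := by
      rw [Function.update_eq_self_iff, Function.update_of_ne hij]
    rw [sub_add_cancel, e5, e4] at e3
    rw [sub_add_cancel] at e2
    rw [h2, hstep, e1, ← smul_sub, siteFun, e3, e2]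
    refine Nonneg.smul ?_ hr
    have := n2.add n1
    convert this using 1
    abel
  -- the part in which the auxiliary line is orthogonal to the identity
  have h4 : Nonneg ((c : ℂ) • siteFun i (ket1 - idWeight) -
      Ψ ᵥ* siteMat i (repKraus (1 - projId q))) := by
    have n1 : Nonneg (siteFun i ((c : ℂ) • ket1 - M)) := by
      simpa [siteFun] using nonneg_prodVec_ite hq ∅ (Finset.notMem_empty i) hc
    have n2 := (hV.nonneg hij n1).vecMul_siteMat i (1 - projId q)
    have e : (prodVec fun _ : ι => ket1) ᵥ* bondMat i j V = prodVec fun _ => ket1 :=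
      prodVec_vecMul_bondMat hij (φ := fun _ => ket1) (ψ := fun _ => ket1) hV.ket1_mul
        fun _ _ _ => rfl
    rw [siteFun_sub, siteFun_smul, sub_vecMul, sub_vecMul, siteFun_ket1, smul_vecMul, e,
      smul_vecMul, prodVec_vecMul_siteMat, ket1_vecMul_repKraus_one_sub_projId hq] at n2
    exact n2
  have h5 := (h1.add (h3.smul (r := 1 + δ) (by positivity))).add
    (h4.smul (r := 1 + δ⁻¹) (by positivity))
  convert h5 using 1
  simp only [smul_sub, smul_smul, Complex.ofReal_mul]
  abel

/-- The estimate of one row: the weight `M` on the last site is contracted at the rate `(1 + δ) r`,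
up to the weight of the operators that differ from the identity on the other `v` sites. -/
lemma row_estimate (hq : 0 < q) (hV : IsChannel V) {v : ℕ} (hs : Set.InjOn s (Set.Iic (v + 1)))
    {M N : Rep q → ℂ} {r : ℝ} (hr : 0 ≤ r) (hM : (siteForm M).PosSemidef)
    (hN : (siteForm N).PosSemidef) (hstep : stepOne V M = (r : ℂ) • (M - N)) {c : ℝ} (hc0 : 0 ≤ c)
    (hc : (siteForm ((c : ℂ) • ket1 - M)).PosSemidef) {δ : ℝ} (hδ : 0 < δ)
    {x : (ι → Rep q) → ℂ} (hx : IsState x) (hx0 : siteMat (s 0) (reset q) *ᵥ x = x) :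
    (siteFun (s v) M ⬝ᵥ (row V s (v + 1) *ᵥ x)).re ≤
      (1 + δ) * r * (siteFun (s (v + 1)) M ⬝ᵥ x).re + (1 + δ⁻¹) * c *
        (lift (fun k => s (k + 1)) v ((prodVec fun _ => ket1) - prodVec fun _ => idWeight) ⬝ᵥ x).re
    := by
  have hs' : Set.InjOn s (Set.Iic v) := hs.mono (Set.Iic_subset_Iic.2 (Nat.le_succ v))
  have hne : s v ≠ s (v + 1) := fun e => by
    have := hs (Set.mem_Iic.2 (Nat.le_succ v)) (Set.mem_Iic.2 le_rfl) e
    omega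
  have hnotMem : s v ∉ (Finset.range v).image s := by
    simp only [Finset.mem_image, Finset.mem_range, not_exists, not_and]
    intro a ha e
    have := hs' (Set.mem_Iic.2 ha.le) (Set.mem_Iic.2 le_rfl) e
    omega
  set S : Finset ι := insert (s v) ((Finset.range v).image s) with hS
  have hmemS : ∀ k ≤ v, s k ∈ S := by
    intro k hk
    rw [hS, ← Finset.image_insert, ← Finset.range_add_one]
    exact Finset.mem_image_of_mem _ (Finset.mem_range.2 (by omega))
  -- the weight where the line is not the identity is at most the weight where the outputs and the
  -- line are not all the identity, and the rest of the row preserves the latter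
  have n1 := nonneg_last_gate hq hV hne hr hM hN hstep hc hδ
  have n2 := nonneg_idWeight_sub hq ((Finset.range v).image s) hnotMem
  have n3 := n1.add (n2.smul (r := (1 + δ⁻¹) * c) (by positivity))
  have n4 := hx _ (n3.vecMul_row hV hs')
  -- all functionals except the last gate are invariant under the rest of the row
  have e1 : siteFun (s (v + 1)) M ᵥ* row V s v = siteFun (s (v + 1)) M := by
    refine prodVec_vecMul_row hV hs' (Or.inl fun k hk => ?_)
    rw [Function.update_of_ne]
    intro e
    have := hs (Set.mem_Iic.2 (by omega)) (Set.mem_Iic.2 le_rfl) e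
    omega
  have e2 : (prodVec fun _ => ket1) ᵥ* row V s v = prodVec fun _ => ket1 :=
    prodVec_vecMul_row hV hs' (Or.inl fun _ _ => rfl)
  have e3 : (prodVec fun k => if k ∈ S then idWeight else ket1) ᵥ* row V s v =
      prodVec fun k => if k ∈ S then idWeight else ket1 :=
    prodVec_vecMul_row hV hs' (Or.inr fun k hk => if_pos (hmemS k hk))
  have e4 : siteFun (s v) M ᵥ* bondMat (s v) (s (v + 1)) V ᵥ* row V s v =
      siteFun (s v) M ᵥ* row V s (v + 1) := by rw [row, vecMul_vecMul]
  have hs1 : Set.InjOn (fun k => s (k + 1)) (Set.Iio v) := by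
    intro a ha b hb e
    rw [Set.mem_Iio] at ha hb
    have := hs (Set.mem_Iic.2 (by omega)) (Set.mem_Iic.2 (by omega)) e
    omega
  -- the auxiliary line enters in the state `0`
  have e5 : (prodVec fun k => if k ∈ S then idWeight else ket1) ⬝ᵥ x =
      lift (fun k => s (k + 1)) v (prodVec fun _ => idWeight) ⬝ᵥ x := by
    rw [← hx0, dotProduct_mulVec, dotProduct_mulVec, prodVec_vecMul_siteMat, lift_prodVec hs1,
      prodVec_vecMul_siteMat, if_pos (hmemS 0 (Nat.zero_le v)), vecMul_reset,
      idWeight_dot_ket0 hq, one_smul]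
    have h0 : s 0 ∉ (Finset.range v).image fun k => s (k + 1) := by
      simp only [Finset.mem_image, Finset.mem_range, not_exists, not_and]
      intro a ha e
      have := hs (Set.mem_Iic.2 (by omega)) (Set.mem_Iic.2 (Nat.zero_le _)) e
      omega
    rw [if_neg h0, vecMul_reset, ket1_dot_ket0 hq, one_smul]
    congr 2
    have h1 : S = insert (s 0) ((Finset.range v).image fun k => s (k + 1)) := by
      rw [hS, ← Finset.image_insert, ← Finset.range_add_one]
      ext k
      simp only [Finset.mem_image, Finset.mem_range, Finset.mem_insert]
      constructor
      · rintro ⟨a, ha, rfl⟩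
        rcases Nat.eq_zero_or_pos a with rfl | h'
        · exact Or.inl rfl
        · exact Or.inr ⟨a - 1, by omega, by rw [Nat.sub_add_cancel h']⟩
      · rintro (rfl | ⟨a, ha, rfl⟩)
        exacts [⟨0, by omega, rfl⟩, ⟨a + 1, by omega, rfl⟩]
    rw [h1]
    funext k
    by_cases hk : k = s 0
    · subst hk
      simp
    · rw [Function.update_of_ne hk, Function.update_of_ne hk]
      simp [hk]
  have e6 : lift (fun k => s (k + 1)) v (prodVec fun _ => ket1) =
      prodVec fun _ : ι => ket1 (q := q) := by
    rw [lift_prodVec hs1]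
    simp
  have e7 : siteFun (s v) (ket1 - idWeight (q := q)) =
      (prodVec fun _ => ket1) - siteFun (s v) idWeight := by
    rw [siteFun_sub, siteFun_ket1]
  rw [lift_sub, e6, sub_dotProduct, ← e5]
  have n5 : (((((1 + δ) * r : ℝ) : ℂ) • siteFun (s (v + 1)) M +
      (((1 + δ⁻¹) * c : ℝ) : ℂ) • ((prodVec fun _ => ket1) -
        prodVec fun k => if k ∈ S then idWeight else ket1) -
      siteFun (s v) M ᵥ* bondMat (s v) (s (v + 1)) V)) =
      ((((1 + δ) * r : ℝ) : ℂ) • siteFun (s (v + 1)) M +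
      (((1 + δ⁻¹) * c : ℝ) : ℂ) • siteFun (s v) (ket1 - idWeight) -
      siteFun (s v) M ᵥ* bondMat (s v) (s (v + 1)) V) +
      (((1 + δ⁻¹) * c : ℝ) : ℂ) • (siteFun (s v) idWeight -
        prodVec fun k => if k ∈ S then idWeight else ket1) := by
    rw [e7]
    simp only [smul_sub]
    abel
  rw [← n5, sub_vecMul, add_vecMul, smul_vecMul, smul_vecMul, sub_vecMul, e1, e2, e3, e4,
    sub_dotProduct, add_dotProduct, smul_dotProduct, smul_dotProduct, sub_dotProduct,
    Complex.sub_re, Complex.add_re, smul_eq_mul, smul_eq_mul, Complex.re_ofReal_mul,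
    Complex.re_ofReal_mul] at n4
  rw [dotProduct_mulVec]
  linarith

end Step

/-! ### Iterating the rows -/

section Iterate

variable {q : ℕ} {V : Matrix (Rep q × Rep q) (Rep q × Rep q) ℂ}

lemma siteMat_commute_row {ι : Type} [Fintype ι] [DecidableEq ι] {s : ℕ → ι} {v : ℕ}
    (hs : Set.InjOn s (Set.Iic v)) {i : ι} (hi : ∀ k ≤ v, i ≠ s k) (W : Matrix (Rep q) (Rep q) ℂ) :
    Commute (siteMat i W) (row V s v) := by
  induction v with
  | zero => exact Commute.one_right _
  | succ v ih =>
    have hne : s v ≠ s (v + 1) := fun e => by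
      have := hs (Set.mem_Iic.2 (Nat.le_succ v)) (Set.mem_Iic.2 le_rfl) e
      omega
    exact (siteMat_commute_bondMat hne (hi v (Nat.le_succ v)) (hi (v + 1) le_rfl) V W).mul_right
      (ih (hs.mono (Set.Iic_subset_Iic.2 (Nat.le_succ v)))
        fun k hk => hi k (hk.trans (Nat.le_succ v)))

lemma lift_dotProduct_prodVec {ι : Type} [Fintype ι] [DecidableEq ι] {s : ℕ → ι} {v : ℕ}
    (hs : Set.InjOn s (Set.Iio v)) (g : (Fin v → Rep q) → ℂ) {κ : ι → Rep q → ℂ}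
    (hκ : ∀ k, ket1 ⬝ᵥ κ k = 1) :
    lift s v g ⬝ᵥ prodVec κ = g ⬝ᵥ prodVec fun k : Fin v => κ (s k) := by
  have hinj : ∀ a b : Fin v, s a = s b → a = b := fun a b e =>
    Fin.ext (hs (Set.mem_Iio.2 a.2) (Set.mem_Iio.2 b.2) e)
  have key : ∀ ψ : Fin v → Rep q → ℂ,
      lift s v (prodVec ψ) ⬝ᵥ prodVec κ = prodVec ψ ⬝ᵥ prodVec fun k : Fin v => κ (s k) := by
    intro ψ
    set φ : ι → Rep q → ℂ := fun i => if h : ∃ k : Fin v, s k = i then ψ h.choose else ket1 with hφ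
    have h1 : ∀ k : Fin v, φ (s k) = ψ k := by
      intro k
      have h : ∃ k' : Fin v, s k' = s k := ⟨k, rfl⟩
      simp only [hφ, dif_pos h]
      rw [hinj _ _ h.choose_spec]
    have h2 : ∀ i ∈ Finset.univ \ (Finset.range v).image s, φ i = ket1 := by
      intro i hi
      have h : ¬ ∃ k : Fin v, s k = i := by
        rintro ⟨k, rfl⟩
        exact (Finset.mem_sdiff.1 hi).2 (Finset.mem_image_of_mem _ (Finset.mem_range.2 k.2))
      simp only [hφ, dif_neg h]
    have h3 : ∀ G : ι → ℂ, ∏ i, G i = (∏ k : Fin v, G (s k)) *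
        ∏ i ∈ Finset.univ \ (Finset.range v).image s, G i := by
      intro G
      rw [← Finset.prod_sdiff (Finset.subset_univ ((Finset.range v).image s)), mul_comm,
        Finset.prod_image fun a ha b hb => hs (by simpa using ha) (by simpa using hb),
        Finset.prod_range]
    have h4 : lift s v (prodVec ψ) = prodVec φ := by
      funext c
      rw [prodVec, h3, lift, prodVec]
      simp only [h1]
      congr 1
      exact Finset.prod_congr rfl fun i hi => by rw [h2 i hi]
    rw [h4, prodVec_dotProduct, prodVec_dotProduct, h3]
    simp only [h1]
    rw [Finset.prod_eq_one (s := Finset.univ \ (Finset.range v).image s)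
      fun i hi => by rw [h2 i hi, hκ], mul_one]
  have hg : g = ∑ j, g j • prodVec fun k => Pi.single (j k) (1 : ℂ) := by
    funext c
    rw [Finset.sum_apply, Finset.sum_eq_single c]
    · simp [prodVec]
    · intro j _ hj
      obtain ⟨k, hk⟩ := Function.ne_iff.1 hj
      simp only [Pi.smul_apply, smul_eq_mul, prodVec]
      rw [Finset.prod_eq_zero (Finset.mem_univ k), mul_zero]
      rw [Pi.single_apply, if_neg hk.symm]
    · simp
  have hlin : lift s v g = ∑ j, g j • lift s v (prodVec fun k => Pi.single (j k) (1 : ℂ)) := by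
    funext c
    rw [Finset.sum_apply]
    simp only [Pi.smul_apply, smul_eq_mul, lift, ← mul_assoc, ← Finset.sum_mul]
    congr 1
    conv_lhs => rw [hg]
    simp
  rw [hlin, sum_dotProduct]
  conv_rhs => rw [hg, sum_dotProduct]
  simp only [smul_dotProduct, key]

/-- The site with coordinate `z` of the chain `{-L, …, L}` (clamped to the chain). -/
def site (L : ℕ) (z : ℤ) : Site L := Set.projIcc (-(L : ℤ)) L (by omega) z

lemma coe_site {L : ℕ} {z : ℤ} (h1 : -(L : ℤ) ≤ z) (h2 : z ≤ L) :
    ((site L z : Site L) : ℤ) = z := by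
  rw [site, Set.projIcc_of_mem _ ⟨h1, h2⟩]

/-- The product state with `φ` at the site `0` and the state `0` elsewhere. -/
def initVec (L : ℕ) (φ : Rep q → ℂ) : (Site L → Rep q) → ℂ :=
  prodVec fun k => if (k : ℤ) = 0 then φ else ket0

/-- The product of the first `b` rows of `v + 1` gates; the row `b` runs along the sites
`-b, …, v + 1 - b`. -/
def rowProd (V : Matrix (Rep q × Rep q) (Rep q × Rep q) ℂ) (v L : ℕ) :
    ℕ → Matrix (Site L → Rep q) (Site L → Rep q) ℂ
  | 0 => 1
  | b + 1 => row V (fun k => site L ((k : ℤ) - (b + 1))) (v + 1) * rowProd V v L b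

lemma injOn_site {L v b : ℕ} (hb : b ≤ L) (hv : v ≤ L + b) :
    Set.InjOn (fun k : ℕ => site L ((k : ℤ) - b)) (Set.Iic v) := by
  intro a ha a' ha' e
  rw [Set.mem_Iic] at ha ha'
  have h := congrArg (fun x : Site L => (x : ℤ)) e
  simp only at h
  rw [coe_site (by omega) (by omega), coe_site (by omega) (by omega)] at h
  omega

lemma reset_mulVec_ket0 (hq : 0 < q) : reset q *ᵥ ket0 = ket0 := by
  rw [reset, vecMulVec_mulVec, ket1_dot_ket0 hq]
  simp

/-- The sites to the left of the rows applied so far are still in the state `0`. -/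
lemma reset_rowProd_mulVec (hq : 0 < q) {v L : ℕ} (φ : Rep q → ℂ) (hv : v ≤ L) {b : ℕ} (hb : b ≤ L)
    {z : ℤ} (hz : -(L : ℤ) ≤ z) (hzb : z < -b) :
    siteMat (site L z) (reset q) *ᵥ (rowProd V v L b *ᵥ initVec L φ) =
      rowProd V v L b *ᵥ initVec L φ := by
  induction b with
  | zero =>
    rw [rowProd, one_mulVec, initVec, siteMat_mulVec_prodVec]
    congr 1
    rw [Function.update_eq_self_iff, coe_site hz (by omega), if_neg (by omega),
      reset_mulVec_ket0 hq]
  | succ b ih =>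
    have hc := siteMat_commute_row (V := V) (i := site L z) (v := v + 1)
      (injOn_site hb (by omega)) (fun k hk e => by
        have h := congrArg (fun x : Site L => (x : ℤ)) e
        rw [coe_site hz (by omega), coe_site (by omega) (by omega)] at h
        omega) (reset q)
    rw [rowProd, ← mulVec_mulVec, mulVec_mulVec]
    have hc' := hc.eq
    push_cast at hc'
    rw [hc', ← mulVec_mulVec, ih (by omega) (by omega)]

lemma isState_rowProd_mulVec (hV : IsChannel V) {v L : ℕ} {φ : Rep q → ℂ} (hv : v ≤ L)
    (hφ : IsState (initVec L φ)) {b : ℕ} (hb : b ≤ L) :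
    IsState (rowProd V v L b *ᵥ initVec L φ) := by
  induction b with
  | zero => rwa [rowProd, one_mulVec]
  | succ b ih =>
    rw [rowProd, ← mulVec_mulVec]
    have h := injOn_site (v := v + 1) hb (by omega)
    push_cast at h
    exact (ih (by omega)).row_mulVec hV h

/-- On the first `v` of the `v + 1` sites of its output, `b` rows of width `v + 1` act as the power
`T_v ^ b`: the last gate of each row is traced out. -/
lemma lift_dotProduct_rowProd (hq : 0 < q) (hV : IsChannel V) {v L : ℕ} (φ : Rep q → ℂ)
    (hv : v ≤ L) {b : ℕ} (hb : b ≤ L) (f : (Fin v → Rep q) → ℂ) :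
    lift (fun k => site L ((k : ℤ) - b)) v f ⬝ᵥ (rowProd V v L b *ᵥ initVec L φ) =
      lift (fun k => site L (k : ℤ)) v (f ᵥ* T V v ^ b) ⬝ᵥ initVec L φ := by
  induction b generalizing f with
  | zero => simp [rowProd]
  | succ b ih =>
    set s : ℕ → Site L := fun k => site L ((k : ℤ) - (b + 1)) with hs
    have hinj : Set.InjOn s (Set.Iic (v + 1)) := by
      have h := injOn_site (v := v + 1) hb (by omega)
      push_cast at h
      exact h
    have hne : ∀ a b, a ≤ v + 1 → b ≤ v + 1 → a ≠ b → s a ≠ s b := fun a b ha hb hab e =>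
      hab (hinj (Set.mem_Iic.2 ha) (Set.mem_Iic.2 hb) e)
    push_cast
    rw [rowProd, ← mulVec_mulVec, ← reset_rowProd_mulVec (V := V) hq φ hv (b := b) (by omega)
      (z := -((b : ℤ) + 1)) (by omega) (by omega), dotProduct_mulVec, dotProduct_mulVec]
    have h0 : site L (-((b : ℤ) + 1)) = s 0 := by simp [hs]
    have h1 : lift s v f ᵥ* row V s (v + 1) = lift s v f ᵥ* row V s v := by
      rw [row, ← vecMul_vecMul, lift_vecMul_bondMat hV f
        (hne v (v + 1) (by omega) le_rfl (by omega))
        (fun k hk => hne k v (by omega) (by omega) (by omega))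
        fun k hk => hne k (v + 1) (by omega) le_rfl (by omega)]
    have h2 : (fun k => s (k + 1)) = fun k : ℕ => site L ((k : ℤ) - b) := by
      funext k
      simp only [hs]
      congr 1
      push_cast
      ring
    rw [h0, h1, lift_vecMul_row (hinj.mono (Set.Iic_subset_Iic.2 (Nat.le_succ v))), h2,
      ih (by omega), vecMul_vecMul, ← pow_succ']

/-- The weight of a positive functional that vanishes on the identity, at the last of the `v + 1`
output sites of the rows, decays at every rate above `|z₂(v)|`, uniformly in the length of the
chain. -/
lemma exists_weight_bound (hq : 0 < q) (hV : IsChannel V) {v : ℕ} (hv : 1 ≤ v) {N : Rep q → ℂ}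
    (hN : (siteForm N).PosSemidef) (hN0 : N ⬝ᵥ ket0 = 0) {φ : Rep q → ℂ}
    (hφ1 : ket1 ⬝ᵥ φ = 1) (hφ : ∀ L, IsState (initVec L φ)) {R : ℝ} (hR : absZ2 V v < R) :
    ∃ C : ℝ, ∀ L τ : ℕ, v ≤ L → τ ≤ L →
      (siteFun (site L ((v : ℤ) - τ)) N ⬝ᵥ (rowProd V v L τ *ᵥ initVec L φ)).re ≤ C * R ^ τ := by
  obtain ⟨r, hvr, hrR⟩ := exists_between hR
  have hr0 : 0 < r := (absZ2_nonneg v).trans_lt hvr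
  have hR0 : 0 < R := hr0.trans hrR
  have hmono : Monotone fun v => absZ2 V v := monotone_nat_of_le_succ (absZ2_le_succ hq hV)
  obtain ⟨M, hM, hMN, hstep⟩ := exists_lyapunov hq hV hN hN0 ((hmono hv).trans_lt hvr)
  -- the constant in `M ≤ c · 1`
  obtain ⟨c, hc0, hc⟩ : ∃ c : ℝ, 0 ≤ c ∧ (siteForm ((c : ℂ) • ket1 - M)).PosSemidef := by
    obtain ⟨c, hc0, hc⟩ := exists_smul_one_sub_posSemidef hM.1
    refine ⟨c * Real.sqrt q, by positivity, ?_⟩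
    have hs : Real.sqrt q ≠ 0 := (Real.sqrt_pos.2 (Nat.cast_pos.2 hq)).ne'
    rw [siteForm_sub, siteForm_smul, siteForm_ket1, smul_smul, ← Complex.ofReal_mul, mul_assoc,
      mul_inv_cancel₀ hs, mul_one]
    exact hc
  set g : (Fin v → Rep q) → ℂ := (prodVec fun _ => ket1) - prodVec fun _ => idWeight with hg
  have hg0 : (g ⬝ᵥ prodVec fun _ => ket0) = 0 := by
    rw [hg, sub_dotProduct, prodVec_dotProduct, prodVec_dotProduct]
    simp [ket1_dot_ket0 hq, idWeight_dot_ket0 hq]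
  obtain ⟨C, hC⟩ := exists_vecMul_pow_bound (F V v) (absZ2_nonneg v)
    (fun z hz => norm_le_absZ2 hz) hvr g
  set ρ : (Fin v → Rep q) → ℂ := prodVec fun k : Fin v => if (k : ℕ) = 0 then φ else ket0 with hρ
  have hκ : ∀ L, ∀ k : Site L, ket1 ⬝ᵥ (if (k : ℤ) = 0 then φ else ket0) = 1 := by
    intro L k
    split_ifs
    exacts [hφ1, ket1_dot_ket0 hq]
  have hp : ∀ L b : ℕ, v ≤ L → b ≤ L →
      (lift (fun k => site L ((k : ℤ) - b)) v g ⬝ᵥ (rowProd V v L b *ᵥ initVec L φ)).re ≤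
        C * (∑ j, ‖ρ j‖) * r ^ b := by
    intro L b hvL hbL
    have hinj : Set.InjOn (fun k : ℕ => site L (k : ℤ)) (Set.Iio v) := by
      have := injOn_site (L := L) (v := v) (b := 0) (by omega) (by omega)
      simp only [Nat.cast_zero, sub_zero] at this
      exact this.mono fun k hk => Set.mem_Iic.2 (Set.mem_Iio.1 hk).le
    have hρ' : ρ = prodVec fun k : Fin v =>
        if ((site L (((k : ℕ) : ℤ)) : Site L) : ℤ) = 0 then φ else ket0 := by
      rw [hρ]
      congr 1
      funext k
      rw [coe_site (by omega) (by omega)]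
      simp
    rw [lift_dotProduct_rowProd hq hV φ hvL hbL, initVec, lift_dotProduct_prodVec hinj _ (hκ L),
      ← hρ', vecMul_T_pow hq hV hg0]
    refine (Complex.re_le_norm _).trans ((norm_sum_le _ _).trans ?_)
    rw [Finset.mul_sum, Finset.sum_mul]
    refine Finset.sum_le_sum fun j _ => ?_
    rw [norm_mul, mul_right_comm]
    exact mul_le_mul_of_nonneg_right (hC b j) (norm_nonneg _)
  -- `δ` is chosen such that the contraction rate `(1 + δ) r` of one row is `R`
  set δ : ℝ := R / r - 1 with hδ
  have hδ0 : 0 < δ := by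
    rw [hδ, sub_pos, one_lt_div hr0]
    exact hrR
  have hδr : (1 + δ) * r = R := by
    rw [hδ]
    field_simp
    ring
  set D : ℝ := (1 + δ⁻¹) * c * (C * ∑ j, ‖ρ j‖) with hD
  -- the solution of the recursion `m (τ + 1) ≤ R m τ + D r ^ τ`
  have hmain : ∀ L τ : ℕ, v ≤ L → τ ≤ L →
      (siteFun (site L ((v : ℤ) - τ)) M ⬝ᵥ (rowProd V v L τ *ᵥ initVec L φ)).re ≤
        ((M ⬝ᵥ ket0).re + D / (R - r)) * R ^ τ - D / (R - r) * r ^ τ := by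
    intro L τ hvL hτL
    induction τ with
    | zero =>
      have h1 : siteFun (site L (v : ℤ)) M ⬝ᵥ initVec L φ = M ⬝ᵥ ket0 := by
        rw [siteFun, initVec, prodVec_dotProduct,
          ← Finset.mul_prod_erase _ _ (Finset.mem_univ (site L (v : ℤ))), Function.update_self,
          Finset.prod_eq_one, mul_one, coe_site (by omega) (by omega), if_neg (by omega)]
        intro k hk
        rw [Function.update_of_ne (Finset.ne_of_mem_erase hk), hκ]
      simp [rowProd, h1]
    | succ τ ih =>
      have hinj := injOn_site (v := v + 1) hτL (by omega)
      have h1 := row_estimate hq hV hinj hr0.le hM hN hstep hc0 hc hδ0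
        (isState_rowProd_mulVec hV hvL (hφ L) (b := τ) (by omega))
        (by
          refine reset_rowProd_mulVec hq φ hvL (by omega) ?_ ?_ <;> push_cast <;> omega)
      have e1 : ∀ k : ℕ, (((k + 1 : ℕ) : ℤ) - ((τ + 1 : ℕ) : ℤ)) = (k : ℤ) - τ := by
        intro k
        push_cast
        ring
      simp only [e1, hδr] at h1
      have h2 := hp L τ hvL (by omega)
      have h3 := ih (by omega)
      have h4 : rowProd V v L (τ + 1) *ᵥ initVec L φ =
          row V (fun k => site L ((k : ℤ) - ((τ + 1 : ℕ) : ℤ))) (v + 1) *ᵥ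
            (rowProd V v L τ *ᵥ initVec L φ) := by
        rw [mulVec_mulVec, rowProd]
        push_cast
        rfl
      rw [h4]
      refine h1.trans ?_
      have h5 := mul_le_mul_of_nonneg_left h3 hR0.le
      have h6 : (1 + δ⁻¹) * c * (lift (fun k => site L ((k : ℤ) - τ)) v g ⬝ᵥ
          (rowProd V v L τ *ᵥ initVec L φ)).re ≤ D * r ^ τ := by
        rw [hD, mul_assoc ((1 + δ⁻¹) * c)]
        exact mul_le_mul_of_nonneg_left h2 (by positivity)
      refine (add_le_add h5 h6).trans (le_of_eq ?_)
      have hRr : R - r ≠ 0 := (sub_pos.2 hrR).ne'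
      rw [pow_succ, pow_succ]
      field_simp
      ring
  have hD0 : 0 ≤ D := by
    have hC0 : 0 ≤ C := by
      have h2 := hC 0 fun _ => ((⟨0, hq⟩, ⟨0, hq⟩), (⟨0, hq⟩, ⟨0, hq⟩))
      rw [pow_zero, pow_zero, mul_one] at h2
      exact (norm_nonneg _).trans h2
    rw [hD]
    have : 0 ≤ ∑ j, ‖ρ j‖ := Finset.sum_nonneg fun _ _ => norm_nonneg _
    positivity
  refine ⟨(M ⬝ᵥ ket0).re + D / (R - r), fun L τ hvL hτL => ?_⟩
  have hn : Nonneg (siteFun (site L ((v : ℤ) - τ)) (M - N)) := by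
    simpa [siteFun] using nonneg_prodVec_ite hq ∅ (Finset.notMem_empty _) hMN
  have h1 := isState_rowProd_mulVec hV hvL (hφ L) hτL _ hn
  rw [siteFun_sub, sub_dotProduct, Complex.sub_re] at h1
  have h2 := hmain L τ hvL hτL
  have h3 : 0 ≤ D / (R - r) * r ^ τ := by
    have := sub_pos.2 hrR
    positivity
  linarith

end Iterate

/-! ### The correlator as a matrix element of the replicated circuit -/

section Correlator

variable {q : ℕ}

/-- The state `A† ⊗ₖ A / √q` of one site. -/
def obsKet (A : Matrix (Fin q) (Fin q) ℂ) (p : Rep q) : ℂ :=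
  ((Real.sqrt q : ℝ) : ℂ)⁻¹ * (star (A p.1.2 p.1.1) * A p.2.1 p.2.2)

/-- The functional `X ⊗ₖ Y ↦ tr (X B† Y B) / √q` of one site. -/
def obsBra (B : Matrix (Fin q) (Fin q) ℂ) (p : Rep q) : ℂ :=
  ((Real.sqrt q : ℝ) : ℂ)⁻¹ * (star (B p.2.1 p.1.2) * B p.2.2 p.1.1)

lemma obsKet_one : obsKet (1 : Matrix (Fin q) (Fin q) ℂ) = ket0 := by
  funext p
  simp only [obsKet, ket0, one_apply, @eq_comm _ p.1.2]
  by_cases h1 : p.1.1 = p.1.2 <;> by_cases h2 : p.2.1 = p.2.2 <;> simp [h1, h2]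

lemma obsBra_one : obsBra (1 : Matrix (Fin q) (Fin q) ℂ) = ket1 := by
  funext p
  simp only [obsBra, ket1, one_apply, @eq_comm _ p.2.2]
  by_cases h1 : p.1.1 = p.2.2 <;> by_cases h2 : p.2.1 = p.1.2 <;> simp [h1, h2]

lemma siteOp_apply {L : ℕ} (A : Matrix (Fin q) (Fin q) ℂ) {x : ℤ} (h1 : -(L : ℤ) ≤ x) (h2 : x ≤ L)
    (a b : Site L → Fin q) :
    siteOp L A x a b = ∏ k : Site L, (if (k : ℤ) = x then A else 1) (a k) (b k) := by
  have hx : x ∈ Set.Icc (-(L : ℤ)) (L : ℤ) := ⟨h1, h2⟩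
  rw [siteOp, dif_pos hx, of_apply, ← Finset.mul_prod_erase _ _ (Finset.mem_univ ⟨x, hx⟩),
    if_pos rfl]
  have hne : ∀ k ∈ Finset.univ.erase (⟨x, hx⟩ : Site L), (k : ℤ) ≠ x := fun k hk e =>
    Finset.ne_of_mem_erase hk (Subtype.ext e)
  split_ifs with h
  · rw [Finset.prod_eq_one, mul_one]
    intro k hk
    rw [if_neg (hne k hk), h k (hne k hk), one_apply_eq]
  · push Not at h
    obtain ⟨k, hk, hab⟩ := h
    rw [Finset.prod_eq_zero (i := k), mul_zero]
    · exact Finset.mem_erase.2 ⟨fun e => hk (congrArg (fun x : Site L => (x : ℤ)) e),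
        Finset.mem_univ k⟩
    · rw [if_neg hk, one_apply_ne hab]

lemma bondOp_eq {L : ℕ} (v : Matrix (Fin q × Fin q) (Fin q × Fin q) ℂ) {i : ℤ}
    (h1 : -(L : ℤ) ≤ i) (h2 : i < L) :
    bondOp L v i = bondMat (site L i) (site L (i + 1)) v := by
  have h : i ∈ Set.Icc (-(L : ℤ)) (L : ℤ) ∧ i + 1 ∈ Set.Icc (-(L : ℤ)) (L : ℤ) :=
    ⟨⟨h1, h2.le⟩, ⟨by omega, by omega⟩⟩
  have e1 : site L i = ⟨i, h.1⟩ := Subtype.ext (coe_site h1 h2.le)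
  have e2 : site L (i + 1) = ⟨i + 1, h.2⟩ := Subtype.ext (coe_site (by omega) (by omega))
  ext a b
  rw [bondOp, dif_pos h, e1, e2]
  simp only [bondMat, of_apply, ne_eq, Subtype.ext_iff]

/-- The replicated operator of a one-site operator is a product vector: the powers of `√q` undo the
normalization of the states. -/
lemma dens_siteOp {L : ℕ} (A : Matrix (Fin q) (Fin q) ℂ) (hq : 0 < q) :
    dens (siteOp L A 0) =
      ((Real.sqrt q : ℝ) : ℂ) ^ Fintype.card (Site L) • initVec L (obsKet A) := by
  have hs : ((Real.sqrt q : ℝ) : ℂ) ≠ 0 :=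
    Complex.ofReal_ne_zero.2 (Real.sqrt_pos.2 (Nat.cast_pos.2 hq)).ne'
  funext c
  rw [dens, siteOp_apply A (by omega) (by omega), siteOp_apply A (by omega) (by omega), star_prod,
    ← Finset.prod_mul_distrib, Pi.smul_apply, smul_eq_mul, initVec, prodVec,
    ← Finset.card_univ, ← Finset.prod_const, ← Finset.prod_mul_distrib]
  refine Finset.prod_congr rfl fun k _ => ?_
  rw [← obsKet_one]
  split_ifs <;> simp only [obsKet] <;> field_simp

lemma isState_initVec (hq : 0 < q) (L : ℕ) (A : Matrix (Fin q) (Fin q) ℂ) :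
    IsState (initVec L (obsKet A)) := by
  intro f hf
  have h := hf (siteOp L A 0)
  have hs : 0 < Real.sqrt q := Real.sqrt_pos.2 (Nat.cast_pos.2 hq)
  rw [dens_siteOp A hq, dotProduct_smul, smul_eq_mul, ← Complex.ofReal_pow,
    Complex.re_ofReal_mul] at h
  exact nonneg_of_mul_nonneg_right h (by positivity)

/-- The trace in the correlator pairs the replicated operator of `A` with a product functional. -/
lemma trace_conj_siteOp {L : ℕ} (hq : 0 < q) (A : ChainOp q L) (B : Matrix (Fin q) (Fin q) ℂ)
    {x : ℤ} (h1 : -(L : ℤ) ≤ x) (h2 : x ≤ L) :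
    (Aᴴ * (siteOp L B x)ᴴ * A * siteOp L B x).trace =
      ((Real.sqrt q : ℝ) : ℂ) ^ Fintype.card (Site L) *
        (siteFun (site L x) (obsBra B) ⬝ᵥ dens A) := by
  have hs : ((Real.sqrt q : ℝ) : ℂ) ≠ 0 :=
    Complex.ofReal_ne_zero.2 (Real.sqrt_pos.2 (Nat.cast_pos.2 hq)).ne'
  have hbra : ∀ c : Site L → Rep q, ((Real.sqrt q : ℝ) : ℂ) ^ Fintype.card (Site L) *
      siteFun (site L x) (obsBra B) c =
      star (siteOp L B x (fun k => (c k).2.1) fun k => (c k).1.2) *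
        siteOp L B x (fun k => (c k).2.2) fun k => (c k).1.1 := by
    intro c
    rw [siteOp_apply B h1 h2, siteOp_apply B h1 h2, star_prod, ← Finset.prod_mul_distrib, siteFun,
      prodVec, ← Finset.card_univ, ← Finset.prod_const, ← Finset.prod_mul_distrib]
    refine Finset.prod_congr rfl fun k _ => ?_
    by_cases hk : (k : ℤ) = x
    · have e : k = site L x := Subtype.ext (by rw [hk, coe_site h1 h2])
      subst e
      rw [Function.update_self, if_pos hk, obsBra]
      field_simp
    · rw [if_neg hk, Function.update_of_ne, ← obsBra_one, obsBra]
      · field_simp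
      · rintro rfl
        exact hk (coe_site h1 h2)
  rw [dotProduct, Finset.mul_sum]
  simp only [← mul_assoc, hbra]
  rw [sum_rep_config]
  have hrev : ∀ f : (Site L → Fin q) → (Site L → Fin q) → (Site L → Fin q) → ℂ,
      ∑ d, ∑ c, ∑ b, f b c d = ∑ b, ∑ c, ∑ d, f b c d := by
    intro f
    rw [Finset.sum_comm, Finset.sum_congr rfl fun c _ => Finset.sum_comm, Finset.sum_comm]
  have hentry : ∀ a, (Aᴴ * (siteOp L B x)ᴴ * A * siteOp L B x) a a = ∑ d, ∑ c, ∑ b,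
      star (A b a) * star (siteOp L B x c b) * A c d * siteOp L B x d a := by
    intro a
    simp only [mul_apply, conjTranspose_apply, Finset.sum_mul]
  rw [trace]
  refine Finset.sum_congr rfl fun a _ => ?_
  rw [diag_apply, hentry, hrev]
  refine Finset.sum_congr rfl fun b _ => Finset.sum_congr rfl fun c _ =>
    Finset.sum_congr rfl fun d _ => ?_
  rw [dens]
  ring

lemma expval_conj_siteOp {L : ℕ} (hq : 0 < q) (A : ChainOp q L) (B : Matrix (Fin q) (Fin q) ℂ)
    {x : ℤ} (h1 : -(L : ℤ) ≤ x) (h2 : x ≤ L) {G : Matrix (Site L → Rep q) (Site L → Rep q) ℂ}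
    {A₀ : Matrix (Fin q) (Fin q) ℂ} (hA : dens A = G *ᵥ dens (siteOp L A₀ 0)) :
    expval (Aᴴ * (siteOp L B x)ᴴ * A * siteOp L B x) =
      siteFun (site L x) (obsBra B) ⬝ᵥ (G *ᵥ initVec L (obsKet A₀)) := by
  have hs : ((Real.sqrt q : ℝ) : ℂ) ≠ 0 :=
    Complex.ofReal_ne_zero.2 (Real.sqrt_pos.2 (Nat.cast_pos.2 hq)).ne'
  have hss : ((Real.sqrt q : ℝ) : ℂ) * ((Real.sqrt q : ℝ) : ℂ) = (q : ℂ) := by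
    rw [← Complex.ofReal_mul, Real.mul_self_sqrt (Nat.cast_nonneg q), Complex.ofReal_natCast]
  rw [expval, trace_conj_siteOp hq A B h1 h2, hA, dens_siteOp A₀ hq, mulVec_smul, dotProduct_smul,
    smul_eq_mul, trace_one, Fintype.card_fun, Fintype.card_fin, Nat.cast_pow, ← mul_assoc,
    ← mul_pow, hss]
  have hq' : (q : ℂ) ≠ 0 := Nat.cast_ne_zero.2 hq.ne'
  field_simp

/-- The gates of the circuit on the chain `{-L, …, L}` up to time `t`, as pairs of a bond and a
time, in the order in which they occur in the evolution operator. -/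
def gateList (L t : ℕ) : List (ℤ × ℕ) :=
  (List.range t).flatMap fun s =>
    ((List.range (2 * L)).filter fun k : ℕ => ((k : ℤ) - L) % 2 = ((s + 1 : ℕ) : ℤ) % 2).map
      fun k : ℕ => ((k : ℤ) - L, s + 1)

lemma prod_map_flatMap {α β M : Type*} [Monoid M] (l : List α) (f : α → List β) (h : β → M) :
    ((l.flatMap f).map h).prod = (l.map fun a => ((f a).map h).prod).prod := by
  induction l with
  | nil => simp
  | cons a l ih => simp [List.flatMap_cons, ih]

lemma prod_map_filter {α M : Type*} [Monoid M] (l : List α) (p : α → Prop) [DecidablePred p]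
    (h : α → M) : ((l.filter fun a => p a).map h).prod =
      (l.map fun a => if p a then h a else 1).prod := by
  induction l with
  | nil => simp
  | cons a l ih =>
    by_cases ha : p a <;> simp [ha, ih]

lemma evolution_eq (L : ℕ) (g : ℤ × ℕ → Gate q) (t : ℕ) :
    evolution L g t = ((gateList L t).map fun p => bondMat (site L p.1) (site L (p.1 + 1))
      (g p : Matrix (Fin q × Fin q) (Fin q × Fin q) ℂ)).prod := by
  rw [gateList, prod_map_flatMap, evolution]
  congr 1
  refine List.map_congr_left fun s _ => ?_
  rw [List.map_map, prod_map_filter, layer]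
  congr 1
  refine List.map_congr_left fun k hk => ?_
  rw [List.mem_range] at hk
  split_ifs
  · rw [bondOp_eq _ (by omega) (by omega)]
    rfl
  · rfl

/-- In the Heisenberg picture the last factor of a product of gates acts last. -/
lemma dens_conj_prod (L : ℕ) (g : ℤ × ℕ → Gate q) (l : List (ℤ × ℕ)) (A : ChainOp q L) :
    dens ((l.map fun p => bondMat (site L p.1) (site L (p.1 + 1))
        (g p : Matrix (Fin q × Fin q) (Fin q × Fin q) ℂ)).prodᴴ * A *
      (l.map fun p => bondMat (site L p.1) (site L (p.1 + 1))
        (g p : Matrix (Fin q × Fin q) (Fin q × Fin q) ℂ)).prod) =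
      (l.reverse.map fun p => bondMat (site L p.1) (site L (p.1 + 1)) (replica (g p))).prod *ᵥ
        dens A := by
  induction l generalizing A with
  | nil => simp
  | cons p l ih =>
    rw [List.map_cons, List.prod_cons, conjTranspose_mul, List.reverse_cons, List.map_append,
      List.prod_append, ← mulVec_mulVec]
    simp only [List.map_cons, List.map_nil, List.prod_cons, List.prod_nil, mul_one]
    set Y := bondMat (site L p.1) (site L (p.1 + 1))
      (g p : Matrix (Fin q × Fin q) (Fin q × Fin q) ℂ) with hY
    have h1 : dens (Yᴴ * A * Y) =
        bondMat (site L p.1) (site L (p.1 + 1)) (replica (g p)) *ᵥ dens A :=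
      dens_conj_bondMat _ _ _ _
    rw [← h1, ← ih (Yᴴ * A * Y)]
    simp only [Matrix.mul_assoc]

/-- The correlator of one realization of the circuit is a matrix element of the product of the
replicated gates. -/
lemma otocXT_eq (hq : 0 < q) (g : ℤ × ℕ → Gate q) (μ ν : Fin q × Fin q) (x : ℤ) (t : ℕ) :
    otocXT g μ ν x t = 1 - siteFun (site (t + x.natAbs) x) (obsBra (pauli ν)) ⬝ᵥ
      (((gateList (t + x.natAbs) t).reverse.map fun p => bondMat (site (t + x.natAbs) p.1)
        (site (t + x.natAbs) (p.1 + 1)) (replica (g p))).prod *ᵥ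
          initVec (t + x.natAbs) (obsKet (pauli μ))) := by
  have h : dens (heisenberg (t + x.natAbs) g t (siteOp (t + x.natAbs) (pauli μ) 0)) =
      ((gateList (t + x.natAbs) t).reverse.map fun p => bondMat (site (t + x.natAbs) p.1)
        (site (t + x.natAbs) (p.1 + 1)) (replica (g p))).prod *ᵥ
          dens (siteOp (t + x.natAbs) (pauli μ) 0) := by
    rw [heisenberg, evolution_eq, dens_conj_prod]
  rw [otocXT]
  exact congrArg (1 - ·) (expval_conj_siteOp hq _ _ (by omega) (by omega) h)

end Correlator

/-! ### The one-site observables -/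

section Observables

variable {q : ℕ}

lemma conjTranspose_pauli_mul_self (μ : Fin q × Fin q) : (pauli μ)ᴴ * pauli μ = 1 := by
  have hnorm : ∀ n : ℕ, star (Complex.exp (2 * Real.pi * Complex.I / q) ^ n) *
      Complex.exp (2 * Real.pi * Complex.I / q) ^ n = 1 := by
    intro n
    have h : ‖Complex.exp (2 * Real.pi * Complex.I / q)‖ = 1 := by
      have := Complex.norm_exp_ofReal_mul_I (2 * Real.pi / q)
      rw [← this]
      congr 2
      push_cast
      ring
    rw [star_pow, ← mul_pow, Complex.star_def, ← Complex.normSq_eq_conj_mul_self,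
      Complex.normSq_eq_norm_sq, h]
    simp
  have hinj : ∀ b b' : Fin q, ((b : ℕ) + (μ.2 : ℕ)) % q = ((b' : ℕ) + (μ.2 : ℕ)) % q → b = b' := by
    intro b b' h
    have h' : (b : ℕ) ≡ b' [MOD q] := Nat.ModEq.add_right_cancel' _ h
    exact Fin.ext (by rwa [Nat.ModEq, Nat.mod_eq_of_lt b.2, Nat.mod_eq_of_lt b'.2] at h')
  ext b b'
  have hq : 0 < q := lt_of_le_of_lt (Nat.zero_le _) b.2
  rw [mul_apply, Finset.sum_eq_single ⟨((b : ℕ) + (μ.2 : ℕ)) % q, Nat.mod_lt _ hq⟩]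
  · simp only [conjTranspose_apply, pauli, of_apply, if_true]
    by_cases hb : b = b'
    · subst hb
      rw [if_pos rfl, hnorm, one_apply_eq]
    · rw [if_neg fun h => hb (hinj _ _ h), mul_zero, one_apply_ne hb]
  · intro a _ ha
    simp only [conjTranspose_apply, pauli, of_apply]
    rw [if_neg fun h => ha (Fin.ext h), star_zero, zero_mul]
  · simp

lemma sqrt_inv_mul_sqrt_inv_mul (hq : 0 < q) :
    ((Real.sqrt q : ℝ) : ℂ)⁻¹ * ((Real.sqrt q : ℝ) : ℂ)⁻¹ * (q : ℂ) = 1 := by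
  have h : ((Real.sqrt q : ℝ) : ℂ) * ((Real.sqrt q : ℝ) : ℂ) = (q : ℂ) := by
    rw [← Complex.ofReal_mul, Real.mul_self_sqrt (Nat.cast_nonneg q), Complex.ofReal_natCast]
  rw [← mul_inv, h, inv_mul_cancel₀ (Nat.cast_ne_zero.2 hq.ne')]

lemma sum_sum_star_mul_self {A : Matrix (Fin q) (Fin q) ℂ} (hA : Aᴴ * A = 1) :
    ∑ a, ∑ b, star (A b a) * A b a = (q : ℂ) := by
  have h : (Aᴴ * A).trace = q := by rw [hA, trace_one, Fintype.card_fin]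
  rw [← h]
  simp only [trace, diag_apply, mul_apply, conjTranspose_apply]

lemma ket1_dotProduct_obsKet (hq : 0 < q) {A : Matrix (Fin q) (Fin q) ℂ} (hA : Aᴴ * A = 1) :
    ket1 ⬝ᵥ obsKet A = 1 := by
  have h : ket1 ⬝ᵥ obsKet A = ∑ a, ∑ b, ((Real.sqrt q : ℝ) : ℂ)⁻¹ * ((Real.sqrt q : ℝ) : ℂ)⁻¹ *
      (star (A b a) * A b a) := by
    simp only [dotProduct, Fintype.sum_prod_type, ket1, obsKet, ite_and, ite_mul, zero_mul]
    refine Finset.sum_congr rfl fun a _ => Finset.sum_congr rfl fun b _ => ?_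
    simp [mul_assoc]
  rw [h]
  simp only [← Finset.mul_sum]
  rw [sum_sum_star_mul_self hA, sqrt_inv_mul_sqrt_inv_mul hq]

lemma obsBra_dotProduct_ket0 (hq : 0 < q) {B : Matrix (Fin q) (Fin q) ℂ} (hB : Bᴴ * B = 1) :
    obsBra B ⬝ᵥ ket0 = 1 := by
  have h : obsBra B ⬝ᵥ ket0 = ∑ a, ∑ b, ((Real.sqrt q : ℝ) : ℂ)⁻¹ * ((Real.sqrt q : ℝ) : ℂ)⁻¹ *
      (star (B b a) * B b a) := by
    simp only [dotProduct, Fintype.sum_prod_type, ket0, obsBra, ite_and, mul_ite, mul_zero]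
    refine Finset.sum_congr rfl fun a _ => ?_
    simp only [Finset.sum_ite_irrel, Finset.sum_const_zero, Finset.sum_ite_eq, Finset.mem_univ,
      if_true]
    refine Finset.sum_congr rfl fun b _ => ?_
    ring
  rw [h]
  simp only [← Finset.mul_sum]
  rw [sum_sum_star_mul_self hB, sqrt_inv_mul_sqrt_inv_mul hq]

open scoped Kronecker in
lemma siteForm_obsBra (B : Matrix (Fin q) (Fin q) ℂ) :
    siteForm (obsBra B) = (((Real.sqrt q)⁻¹ : ℝ) : ℂ) • (Bᴴ ⊗ₖ Bᵀ) := by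
  ext x y
  simp [siteForm, obsBra, kroneckerMap_apply]

lemma siteForm_obsBra_conjTranspose (B : Matrix (Fin q) (Fin q) ℂ) :
    siteForm (obsBra Bᴴ) = (siteForm (obsBra B))ᴴ := by
  rw [siteForm_obsBra, siteForm_obsBra, conjTranspose_smul, conjTranspose_kronecker,
    conjTranspose_conjTranspose, Complex.star_def, Complex.conj_ofReal]
  rfl

/-- The functional `ket1 - Re (obsBra B)` of one site, whose expectation is the real part of the
correlator. For unitary `B` it is, up to normalization, half the square norm of `X - B† X B`, hence
positive, and it vanishes on the identity. -/
def commForm (B : Matrix (Fin q) (Fin q) ℂ) : Rep q → ℂ :=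
  ket1 - (2⁻¹ : ℂ) • (obsBra B + obsBra Bᴴ)

open scoped Kronecker in
lemma posSemidef_siteForm_commForm {B : Matrix (Fin q) (Fin q) ℂ} (hB : B * Bᴴ = 1) :
    (siteForm (commForm B)).PosSemidef := by
  set S := Bᴴ ⊗ₖ Bᵀ with hS
  have hSS : Sᴴ * S = 1 := by
    rw [hS, conjTranspose_kronecker, ← mul_kronecker_mul, conjTranspose_conjTranspose, hB]
    have e : Bᵀᴴ = Bᴴᵀ := rfl
    have h : Bᵀᴴ * Bᵀ = 1 := by
      rw [e, ← transpose_mul, hB, transpose_one]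
    rw [h, one_kronecker_one]
  have h : siteForm (commForm B) =
      (((Real.sqrt q)⁻¹ * 2⁻¹ : ℝ) : ℂ) • ((1 - S)ᴴ * (1 - S)) := by
    have hadd : siteForm (obsBra B + obsBra Bᴴ) =
      siteForm (obsBra B) + siteForm (obsBra Bᴴ) := rfl
    rw [commForm, siteForm_sub, siteForm_smul, hadd, siteForm_obsBra_conjTranspose, siteForm_ket1,
      siteForm_obsBra, ← hS, conjTranspose_smul, Complex.star_def, Complex.conj_ofReal,
      conjTranspose_sub, conjTranspose_one, Matrix.mul_sub, Matrix.sub_mul, Matrix.sub_mul, hSS]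
    simp only [Matrix.one_mul, Matrix.mul_one]
    push_cast
    module
  rw [h]
  refine (posSemidef_conjTranspose_mul_self _).smul ?_
  rw [Complex.zero_le_real]
  positivity

lemma commForm_dotProduct_ket0 (hq : 0 < q) {B : Matrix (Fin q) (Fin q) ℂ} (hB : Bᴴ * B = 1) :
    commForm B ⬝ᵥ ket0 = 0 := by
  have hB' : Bᴴᴴ * Bᴴ = 1 := by rw [conjTranspose_conjTranspose, mul_eq_one_comm.1 hB]
  rw [commForm, sub_dotProduct, smul_dotProduct, add_dotProduct, ket1_dot_ket0 hq,
    obsBra_dotProduct_ket0 hq hB, obsBra_dotProduct_ket0 hq hB']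
  norm_num

variable {ι : Type} [Fintype ι] [DecidableEq ι]

lemma IsState.im_siteFun_of_posSemidef {x : (ι → Rep q) → ℂ} (hx : IsState x) (i : ι)
    {φ : Rep q → ℂ} (hφ : (siteForm φ).PosSemidef) : (siteFun i φ ⬝ᵥ x).im = 0 := by
  have h : ∀ X : Matrix (ι → Fin q) (ι → Fin q) ℂ, 0 ≤ siteFun i φ ⬝ᵥ dens X := by
    refine prodVec_dotProduct_dens_nonneg fun k => ?_
    by_cases hk : k = i
    · subst hk
      rwa [Function.update_self]
    · rw [Function.update_of_ne hk]
      exact posSemidef_siteForm_ket1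
  obtain ⟨-, h1, h2⟩ := dotProduct_dens_nonneg_iff.1 h
  have e1 := hx _ h1
  have e2 := hx _ h2
  simp only [smul_dotProduct, smul_eq_mul, neg_mul, Complex.neg_re, Complex.I_mul_re] at e1 e2
  linarith

/-- Hermitian one-site functionals have real expectations. -/
lemma IsState.im_siteFun (hq : 0 < q) {x : (ι → Rep q) → ℂ} (hx : IsState x) (i : ι)
    {φ : Rep q → ℂ} (hφ : (siteForm φ).IsHermitian) : (siteFun i φ ⬝ᵥ x).im = 0 := by
  obtain ⟨c, -, hc⟩ := exists_smul_one_sub_posSemidef hφ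
  have hs : 0 < Real.sqrt q := Real.sqrt_pos.2 (Nat.cast_pos.2 hq)
  set z : ℂ := ((c * Real.sqrt q : ℝ) : ℂ) with hz
  have h1 : (siteForm (z • ket1 - φ)).PosSemidef := by
    rw [siteForm_sub, siteForm_smul, siteForm_ket1, smul_smul, hz, ← Complex.ofReal_mul, mul_assoc,
      mul_inv_cancel₀ hs.ne', mul_one]
    exact hc
  have e1 := hx.im_siteFun_of_posSemidef i h1
  have e2 := hx.im_siteFun_of_posSemidef i (posSemidef_siteForm_ket1 (q := q))
  rw [siteFun_sub, siteFun_smul, sub_dotProduct, smul_dotProduct, smul_eq_mul, Complex.sub_im,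
    hz, Complex.im_ofReal_mul, e2] at e1
  linarith

lemma IsState.re_siteFun_commForm (hq : 0 < q) {x : (ι → Rep q) → ℂ} (hx : IsState x) (i : ι)
    (B : Matrix (Fin q) (Fin q) ℂ) :
    (siteFun i (commForm B) ⬝ᵥ x).re = (siteFun i (ket1 - obsBra B) ⬝ᵥ x).re := by
  have h1 : (siteForm (Complex.I • (obsBra B - obsBra Bᴴ))).IsHermitian := by
    rw [siteForm_smul, siteForm_sub, siteForm_obsBra_conjTranspose]
    rw [IsHermitian, conjTranspose_smul, conjTranspose_sub, conjTranspose_conjTranspose,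
      Complex.star_def, Complex.conj_I, neg_smul, ← smul_neg, neg_sub]
  have e := hx.im_siteFun hq i h1
  rw [siteFun_smul, smul_dotProduct, smul_eq_mul, Complex.I_mul_im] at e
  have h2 : commForm B = (ket1 - obsBra B) - (-(2⁻¹ : ℂ)) • (obsBra B - obsBra Bᴴ) := by
    rw [commForm]
    module
  rw [h2, siteFun_sub _ (ket1 - obsBra B), siteFun_smul, sub_dotProduct, smul_dotProduct,
    smul_eq_mul, Complex.sub_re]
  have h3 : (-(2⁻¹ : ℂ)) = ((-2⁻¹ : ℝ) : ℂ) := by push_cast; rfl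
  rw [h3, Complex.re_ofReal_mul, e]
  ring

end Observables

/-! ### Averages of products of independent random matrices -/

section Average

variable {Ω : Type*} [MeasurableSpace Ω] {P : Measure Ω} [IsProbabilityMeasure P]

lemma measurable_list_prod {Ω' α n : Type*} [MeasurableSpace Ω'] [Fintype n] [DecidableEq n]
    (l : List α) (h : α → Ω' → Matrix n n ℂ)
    (hm : ∀ p ∈ l, ∀ i j, Measurable fun ω => h p ω i j) (i j : n) :
    Measurable fun ω => (l.map fun p => h p ω).prod i j := by
  induction l generalizing i j with
  | nil =>
    simp only [List.map_nil, List.prod_nil]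
    exact measurable_const
  | cons p l ih =>
    simp only [List.map_cons, List.prod_cons, mul_apply]
    exact Finset.measurable_sum _ fun k _ => (hm p (by simp) i k).mul
      (ih (fun p' hp' => hm p' (by simp [hp'])) k j)

lemma exists_bound_list_prod {Ω' α n : Type*} [Fintype n] [DecidableEq n]
    (l : List α) (h : α → Ω' → Matrix n n ℂ)
    (hb : ∀ p ∈ l, ∀ i j ω, ‖h p ω i j‖ ≤ 1) :
    ∃ C : ℝ, ∀ i j ω, ‖(l.map fun p => h p ω).prod i j‖ ≤ C := by
  induction l with
  | nil =>
    refine ⟨1, fun i j ω => ?_⟩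
    simp only [List.map_nil, List.prod_nil, one_apply]
    split_ifs <;> simp
  | cons p l ih =>
    obtain ⟨C, hC⟩ := ih fun p' hp' => hb p' (by simp [hp'])
    refine ⟨Fintype.card n * C, fun i j ω => ?_⟩
    simp only [List.map_cons, List.prod_cons, mul_apply]
    refine (norm_sum_le _ _).trans ?_
    rw [← nsmul_eq_mul]
    refine Finset.sum_le_card_nsmul _ _ _ fun k _ => ?_
    rw [norm_mul, ← one_mul C]
    exact mul_le_mul (hb p (by simp) i k ω) (hC k j ω) (norm_nonneg _) zero_le_one

/-- The entries of a product of independent random matrices with bounded entries average to the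
entries of the product of the averaged matrices. -/
lemma integral_list_prod {α n : Type*} [Fintype n] [DecidableEq n] {l : List α} (hl : l.Nodup)
    {h : α → Ω → Matrix n n ℂ} (hm : ∀ p ∈ l, ∀ i j, Measurable fun ω => h p ω i j)
    (hb : ∀ p ∈ l, ∀ i j ω, ‖h p ω i j‖ ≤ 1) (i j : n) :
    ∫ g, (l.map fun p => h p (g p)).prod i j ∂(Measure.infinitePi fun _ : α => P) =
      (l.map fun p => of fun i j => ∫ ω, h p ω i j ∂P).prod i j := by
  classical
  induction l generalizing i j with
  | nil => simp
  | cons p l ih =>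
    obtain ⟨hp, hl⟩ := List.nodup_cons.1 hl
    have hm' : ∀ p ∈ l, ∀ i j, Measurable fun ω => h p ω i j := fun p' hp' => hm p' (by simp [hp'])
    have hb' : ∀ p ∈ l, ∀ i j ω, ‖h p ω i j‖ ≤ 1 := fun p' hp' => hb p' (by simp [hp'])
    obtain ⟨ω₀⟩ := nonempty_of_isProbabilityMeasure P
    -- the tail of the product is a function of the coordinates in `l`
    set ext : (l.toFinset → Ω) → α → Ω := fun y a => if ha : a ∈ l.toFinset then y ⟨a, ha⟩ else ω₀
      with hext
    have hextm : ∀ a, Measurable fun y => ext y a := by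
      intro a
      by_cases ha : a ∈ l.toFinset
      · simp only [hext, dif_pos ha]
        exact measurable_pi_apply _
      · simp only [hext, dif_neg ha]
        exact measurable_const
    have htail : ∀ g : α → Ω, (l.map fun p => h p (g p)) =
        l.map fun p => h p (ext (fun a => g a) p) := by
      intro g
      refine List.map_congr_left fun a ha => ?_
      simp only [hext, dif_pos (List.mem_toFinset.2 ha)]
    have hY : ∀ k, Measurable fun y : l.toFinset → Ω =>
        (l.map fun p => h p (ext y p)).prod k j := fun k =>
      measurable_list_prod l (fun p y => h p (ext y p))
        (fun p hp i j => (hm' p hp i j).comp (hextm p)) k j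
    have hind := (ProbabilityTheory.iIndepFun_infinitePi (P := fun _ : α => P)
      (X := fun _ ω => ω) (fun _ => measurable_id)).indepFun_finset {p} l.toFinset
        (by simpa using hp) (fun a => measurable_pi_apply a)
    have hind' : ∀ k, ProbabilityTheory.IndepFun (fun g : α → Ω => h p (g p) i k)
        (fun g : α → Ω => (l.map fun p => h p (g p)).prod k j)
        (Measure.infinitePi fun _ : α => P) := by
      intro k
      have := hind.comp (φ := fun y : ({p} : Finset α) → Ω =>
          h p (y ⟨p, Finset.mem_singleton_self p⟩) i k)
        ((hm p (by simp) i k).comp (measurable_pi_apply _)) (hY k)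
      have e : (fun g : α → Ω => (l.map fun p => h p (g p)).prod k j) = fun g =>
          (l.map fun p => h p (ext (fun a => g a) p)).prod k j := funext fun g => by rw [htail g]
      rw [e]
      exact this
    have hX : ∀ k, Measurable fun g : α → Ω => h p (g p) i k := fun k =>
      (hm p (by simp) i k).comp (measurable_pi_apply p)
    have hZ : ∀ k, Measurable fun g : α → Ω => (l.map fun p => h p (g p)).prod k j := fun k =>
      measurable_list_prod l (fun p (g : α → Ω) => h p (g p))
        (fun p hp i j => (hm' p hp i j).comp (measurable_pi_apply p)) k j
    obtain ⟨C, hC⟩ := exists_bound_list_prod l (fun p (g : α → Ω) => h p (g p))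
      fun p hp i j g => hb' p hp i j (g p)
    have hXi : ∀ k, Integrable (fun g : α → Ω => h p (g p) i k)
        (Measure.infinitePi fun _ : α => P) := fun k =>
      Integrable.of_bound (hX k).aestronglyMeasurable 1 (ae_of_all _ fun g => hb p (by simp) i k _)
    have hZi : ∀ k, Integrable (fun g : α → Ω => (l.map fun p => h p (g p)).prod k j)
        (Measure.infinitePi fun _ : α => P) := fun k =>
      Integrable.of_bound (hZ k).aestronglyMeasurable C (ae_of_all _ fun g => hC k j g)
    simp only [List.map_cons, List.prod_cons, mul_apply]
    have hXZ : ∀ k, Integrable (fun g : α → Ω =>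
        h p (g p) i k * (l.map fun p => h p (g p)).prod k j) (Measure.infinitePi fun _ : α => P) :=
      fun k => (hind' k).integrable_mul (hXi k) (hZi k)
    rw [integral_finsetSum _ fun k _ => hXZ k]
    refine Finset.sum_congr rfl fun k _ => ?_
    rw [(hind' k).integral_fun_mul_eq_mul_integral (hX k).aestronglyMeasurable
      (hZ k).aestronglyMeasurable, ih hl hm' hb' k j]
    congr 1
    have he := measurePreserving_eval_infinitePi (fun _ : α => P) p
    have h1 := integral_map (μ := Measure.infinitePi fun _ : α => P) he.measurable.aemeasurable
      (f := fun ω => h p ω i k) (hm p (by simp) i k).aestronglyMeasurable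
    rw [he.map_eq] at h1
    exact h1.symm

variable {q : ℕ} {ι : Type} [Fintype ι] [DecidableEq ι] {u : Ω → Gate q}

/-- In the average of a matrix element of a product of replicated gates at distinct bonds or times,
each gate is replaced with its average. -/
lemma integral_dotProduct_prod_mulVec
    (hu : ∀ a b, Measurable fun ω => (u ω : Matrix (Fin q × Fin q) (Fin q × Fin q) ℂ) a b)
    {α : Type*} {l : List α} (hl : l.Nodup) (s s' : α → ι) (f x : (ι → Rep q) → ℂ) :
    Integrable (fun g : α → Ω => f ⬝ᵥ ((l.map fun p =>
        bondMat (s p) (s' p) (replica (u (g p)))).prod *ᵥ x)) (Measure.infinitePi fun _ => P) ∧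
      ∫ g, f ⬝ᵥ ((l.map fun p => bondMat (s p) (s' p) (replica (u (g p)))).prod *ᵥ x)
          ∂(Measure.infinitePi fun _ : α => P) =
        f ⬝ᵥ ((l.map fun p => bondMat (s p) (s' p) (avgReplica P u)).prod *ᵥ x) := by
  have hm : ∀ p ∈ l, ∀ i j, Measurable fun ω => bondMat (s p) (s' p) (replica (u ω)) i j := by
    intro p _ i j
    simp only [bondMat, of_apply]
    split_ifs
    · exact measurable_replica hu _ _
    · exact measurable_const
  have hb : ∀ p ∈ l, ∀ i j ω, ‖bondMat (s p) (s' p) (replica (u ω)) i j‖ ≤ 1 := by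
    intro p _ i j ω
    simp only [bondMat, of_apply]
    split_ifs
    · exact norm_replica_le _ _ _
    · simp
  have havg : ∀ p, bondMat (s p) (s' p) (avgReplica P u) =
      of fun i j => ∫ ω, bondMat (s p) (s' p) (replica (u ω)) i j ∂P := by
    intro p
    ext i j
    simp only [bondMat, of_apply, avgReplica]
    split_ifs
    · rfl
    · simp
  obtain ⟨C, hC⟩ := exists_bound_list_prod l
    (fun p (g : α → Ω) => bondMat (s p) (s' p) (replica (u (g p)))) fun p hp i j g =>
      hb p hp i j (g p)
  have hint : ∀ i j, Integrable (fun g : α → Ω =>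
      (l.map fun p => bondMat (s p) (s' p) (replica (u (g p)))).prod i j)
        (Measure.infinitePi fun _ => P) := fun i j =>
    Integrable.of_bound (measurable_list_prod l
      (fun p (g : α → Ω) => bondMat (s p) (s' p) (replica (u (g p))))
      (fun p hp i j => (hm p hp i j).comp (measurable_pi_apply p)) i j).aestronglyMeasurable C
      (ae_of_all _ fun g => hC i j g)
  simp only [dotProduct, mulVec]
  refine ⟨integrable_finsetSum _ fun i _ => (integrable_finsetSum _ fun j _ =>
    (hint i j).mul_const _).const_mul _, ?_⟩
  rw [integral_finsetSum _ fun i _ => (integrable_finsetSum _ fun j _ =>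
    (hint i j).mul_const _).const_mul _]
  refine Finset.sum_congr rfl fun i _ => ?_
  rw [integral_const_mul, integral_finsetSum _ fun j _ => (hint i j).mul_const _]
  congr 1
  refine Finset.sum_congr rfl fun j _ => ?_
  rw [integral_mul_const, integral_list_prod hl hm hb i j]
  simp only [havg]

end Average

/-! ### Rearranging the gates along the light cone -/

section LightCone

variable {q : ℕ} {V : Matrix (Rep q × Rep q) (Rep q × Rep q) ℂ}

/-- Two orders of the same factors have the same product if in both of them any two factors that do
not commute appear by decreasing height. -/
lemma prod_eq_of_perm {α M : Type*} [Monoid M] {f : α → M} {h : α → ℕ} {l₁ l₂ : List α}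
    (hl : l₁.Perm l₂) (h₁ : l₁.Pairwise fun p q => Commute (f p) (f q) ∨ h q < h p)
    (h₂ : l₂.Pairwise fun p q => Commute (f p) (f q) ∨ h q < h p) :
    (l₁.map f).prod = (l₂.map f).prod := by
  induction l₁ generalizing l₂ with
  | nil => rw [List.nil_perm.1 hl]
  | cons p l ih =>
    obtain ⟨A, B, rfl⟩ := List.append_of_mem (hl.subset (List.mem_cons_self (a := p) (l := l)))
    have hl' : l.Perm (A ++ B) := (hl.trans List.perm_middle).cons_inv
    rw [List.pairwise_cons] at h₁
    have h2' := List.pairwise_append.1 h₂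
    have hA : Commute (A.map f).prod (f p) := by
      refine Commute.list_prod_left _ _ fun y hy => ?_
      obtain ⟨a, ha, rfl⟩ := List.mem_map.1 hy
      rcases h₁.1 a (hl'.symm.subset (List.mem_append_left _ ha)) with h | h
      · exact h.symm
      · rcases h2'.2.2 a ha p List.mem_cons_self with h' | h'
        · exact h'
        · exact absurd h (Nat.lt_asymm h')
    rw [List.map_cons, List.prod_cons, ih hl' h₁.2
      (h₂.sublist (List.Sublist.append_left (List.sublist_cons_self _ _) _))]
    simp only [List.map_append, List.prod_append, List.map_cons, List.prod_cons, ← mul_assoc]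
    rw [hA.eq]

lemma mem_gateList {L t : ℕ} {p : ℤ × ℕ} : p ∈ gateList L t ↔
    1 ≤ p.2 ∧ p.2 ≤ t ∧ -(L : ℤ) ≤ p.1 ∧ p.1 < L ∧ p.1 % 2 = (p.2 : ℤ) % 2 := by
  simp only [gateList, List.mem_flatMap, List.mem_range, List.mem_map, List.mem_filter,
    decide_eq_true_eq]
  constructor
  · rintro ⟨s, hs, k, ⟨hk, hp⟩, rfl⟩
    exact ⟨by simp, by simpa using hs, by simp, by simp only; omega, hp⟩
  · rintro ⟨h1, h2, h3, h4, h5⟩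
    refine ⟨p.2 - 1, by omega, (p.1 + L).toNat, ⟨by omega, ?_⟩, ?_⟩
    · rw [Nat.sub_add_cancel h1, ← h5]
      congr 1
      omega
    · refine Prod.ext ?_ ?_
      · simp only
        omega
      · exact Nat.sub_add_cancel h1

/-- The gates are listed by increasing time, and for equal times from left to right. -/
lemma pairwise_gateList (L t : ℕ) :
    (gateList L t).Pairwise fun p p' => p.2 < p'.2 ∨ p.2 = p'.2 ∧ p.1 < p'.1 := by
  rw [gateList, List.pairwise_flatMap]
  constructor
  · intro s _
    rw [List.pairwise_map]
    refine List.Pairwise.filter _ (List.pairwise_lt_range.imp fun {a b} hab => Or.inr ⟨rfl, ?_⟩)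
    simp only
    omega
  · refine List.pairwise_lt_range.imp fun {a b} hab x hx y hy => Or.inl ?_
    obtain ⟨_, _, rfl⟩ := List.mem_map.1 hx
    obtain ⟨_, _, rfl⟩ := List.mem_map.1 hy
    simpa using hab

lemma nodup_gateList (L t : ℕ) : (gateList L t).Nodup :=
  (pairwise_gateList L t).imp fun {p p'} h e => by
    subst e
    omega

/-- The operator of the gate at the bond and time `p`. -/
def gateMat (V : Matrix (Rep q × Rep q) (Rep q × Rep q) ℂ) (L : ℕ) (p : ℤ × ℕ) :
    Matrix (Site L → Rep q) (Site L → Rep q) ℂ :=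
  bondMat (site L p.1) (site L (p.1 + 1)) V

lemma site_ne_site {L : ℕ} {i j : ℤ} (h1 : -(L : ℤ) ≤ i) (h2 : i ≤ L) (h3 : -(L : ℤ) ≤ j)
    (h4 : j ≤ L) (h : i ≠ j) : site L i ≠ site L j := fun e => by
  have := congrArg (fun x : Site L => (x : ℤ)) e
  rw [coe_site h1 h2, coe_site h3 h4] at this
  exact h this

lemma gateMat_commute {L t : ℕ} {p p' : ℤ × ℕ} (hp : p ∈ gateList L t) (hp' : p' ∈ gateList L t)
    (h : p.1 + 1 < p'.1 ∨ p'.1 + 1 < p.1) : Commute (gateMat V L p) (gateMat V L p') := by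
  rw [mem_gateList] at hp hp'
  refine bondMat_commute ?_ ?_ ?_ ?_ ?_ ?_ V V <;> apply site_ne_site <;> omega

/-- The gates of the rectangle of the light-cone coordinates `0 ≤ (i + s) / 2 ≤ v`,
`1 ≤ (s - i) / 2 ≤ τ`, row by row. -/
def rectList (v : ℕ) : ℕ → List (ℤ × ℕ)
  | 0 => []
  | b + 1 => ((List.range (v + 1)).reverse.map fun a : ℕ => ((a : ℤ) - (b + 1), a + (b + 1))) ++
      rectList v b

lemma mem_rectList {v τ : ℕ} {p : ℤ × ℕ} : p ∈ rectList v τ ↔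
    0 ≤ p.1 + p.2 ∧ p.1 + p.2 ≤ 2 * v ∧ 2 ≤ (p.2 : ℤ) - p.1 ∧ (p.2 : ℤ) - p.1 ≤ 2 * τ ∧
      p.1 % 2 = (p.2 : ℤ) % 2 := by
  induction τ with
  | zero =>
    simp only [rectList, List.not_mem_nil, false_iff]
    omega
  | succ b ih =>
    simp only [rectList, List.mem_append, ih, List.mem_map, List.mem_reverse, List.mem_range]
    constructor
    · rintro (⟨a, ha, rfl⟩ | h)
      · push_cast
        omega
      · omega
    · intro h
      by_cases hb : (p.2 : ℤ) - p.1 ≤ 2 * b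
      · exact Or.inr (by omega)
      · refine Or.inl ⟨((p.1 + p.2) / 2).toNat, by omega, Prod.ext ?_ ?_⟩
        · simp only
          omega
        · simp only
          omega

/-- In the listing by rows, gates that touch each other appear by decreasing time. -/
lemma pairwise_rectList (v τ : ℕ) : (rectList v τ).Pairwise fun p p' =>
    (p.1 + 1 < p'.1 ∨ p'.1 + 1 < p.1) ∨ p'.2 < p.2 := by
  induction τ with
  | zero => exact List.Pairwise.nil
  | succ b ih =>
    rw [rectList, List.pairwise_append]
    refine ⟨?_, ih, ?_⟩
    · rw [List.pairwise_map, List.pairwise_reverse]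
      refine List.pairwise_lt_range.imp fun {a a'} h => Or.inr ?_
      simp only
      omega
    · intro p hp p' hp'
      obtain ⟨a, ha, rfl⟩ := List.mem_map.1 hp
      rw [List.mem_reverse, List.mem_range] at ha
      rw [mem_rectList] at hp'
      simp only
      omega

lemma nodup_rectList (v τ : ℕ) : (rectList v τ).Nodup := by
  induction τ with
  | zero => exact List.nodup_nil
  | succ b ih =>
    rw [rectList, List.nodup_append]
    refine ⟨?_, ih, ?_⟩
    · refine List.Nodup.map (fun a a' h => ?_) (List.nodup_reverse.2 List.nodup_range)
      have := congrArg Prod.snd h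
      simp only at this
      omega
    · intro p hp p' hp' e
      subst e
      obtain ⟨a, ha, rfl⟩ := List.mem_map.1 hp
      rw [mem_rectList] at hp'
      push_cast at hp'
      omega

lemma row_eq_prod {L : ℕ} (b v : ℕ) :
    row V (fun k => site L ((k : ℤ) - (b + 1))) v =
      (((List.range v).reverse.map fun a : ℕ => ((a : ℤ) - (b + 1), a + (b + 1))).map
        (gateMat V L)).prod := by
  induction v with
  | zero => rfl
  | succ v ih =>
    rw [row, ih, List.range_succ, List.reverse_append]
    simp only [List.reverse_cons, List.reverse_nil, List.nil_append, List.cons_append,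
      List.map_cons, List.prod_cons, gateMat]
    congr 3
    push_cast
    ring

lemma rowProd_eq_prod (v L τ : ℕ) : rowProd V v L τ = ((rectList v τ).map (gateMat V L)).prod := by
  induction τ with
  | zero => rfl
  | succ b ih => rw [rowProd, rectList, List.map_append, List.prod_append, ih, row_eq_prod]

lemma prod_mulVec_of_forall {n α : Type*} [Fintype n] [DecidableEq n] {l : List α}
    {f : α → Matrix n n ℂ} {x : n → ℂ} (h : ∀ p ∈ l, f p *ᵥ x = x) :
    (l.map f).prod *ᵥ x = x := by
  induction l with
  | nil => simp
  | cons p l ih =>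
    rw [List.map_cons, List.prod_cons, ← mulVec_mulVec, ih fun p' hp' => h p' (by simp [hp']),
      h p (by simp)]

lemma vecMul_prod_of_forall {n α : Type*} [Fintype n] [DecidableEq n] {l : List α}
    {f : α → Matrix n n ℂ} {x : n → ℂ} (h : ∀ p ∈ l, x ᵥ* f p = x) :
    x ᵥ* (l.map f).prod = x := by
  induction l with
  | nil => simp
  | cons p l ih =>
    rw [List.map_cons, List.prod_cons, ← vecMul_vecMul, h p (by simp),
      ih fun p' hp' => h p' (by simp [hp'])]

/-- Only the gates in the intersection of the two light cones matter, and they may be applied row by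
row: gates outside the forward light cone of the site `0` fix the initial state, and gates outside
the backward light cone of the final site fix the final functional. -/
lemma siteFun_dotProduct_circuit (hV : IsChannel V) {v τ L : ℕ} (hv : v ≤ L) (hτ : τ ≤ L)
    (φ ψ : Rep q → ℂ) :
    siteFun (site L ((v : ℤ) - τ)) ψ ⬝ᵥ
        (((gateList L (v + τ)).reverse.map (gateMat V L)).prod *ᵥ initVec L φ) =
      siteFun (site L ((v : ℤ) - τ)) ψ ⬝ᵥ (rowProd V v L τ *ᵥ initVec L φ) := by
  set l := (gateList L (v + τ)).reverse with hl
  have hmem : ∀ p, p ∈ l ↔ p ∈ gateList L (v + τ) := fun p => List.mem_reverse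
  set Fw : ℤ × ℕ → Prop := fun p => 0 ≤ p.1 + p.2 ∧ 2 ≤ (p.2 : ℤ) - p.1 with hFw
  set Bw : ℤ × ℕ → Prop := fun p => p.1 + p.2 ≤ 2 * v ∧ (p.2 : ℤ) - p.1 ≤ 2 * τ with hBw
  set G2 := (l.filter fun p => Fw p).filter fun p => ¬ Bw p with hG2
  set G0 := l.filter fun p => ¬ Fw p with hG0
  have hG2m : ∀ p, p ∈ G2 ↔ (p ∈ l ∧ Fw p) ∧ ¬ Bw p := fun p => by
    simp only [hG2, List.mem_filter, decide_eq_true_eq]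
  have hG0m : ∀ p, p ∈ G0 ↔ p ∈ l ∧ ¬ Fw p := fun p => by
    simp only [hG0, List.mem_filter, decide_eq_true_eq]
  have hrectm : ∀ p, p ∈ rectList v τ → (p ∈ l ∧ Fw p) ∧ Bw p := by
    intro p hp
    rw [mem_rectList] at hp
    rw [hmem, mem_gateList]
    exact ⟨⟨by omega, by simp only [hFw]; omega⟩, by simp only [hBw]; omega⟩
  have hnd : l.Nodup := List.nodup_reverse.2 (nodup_gateList L _)
  have hlp : l.Pairwise fun p p' => p'.2 < p.2 ∨ p.2 = p'.2 ∧ p'.1 < p.1 := by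
    rw [hl, List.pairwise_reverse]
    exact (pairwise_gateList L _).imp fun {p p'} h => by omega
  have hrect : (rectList v τ).Perm ((l.filter fun p => Fw p).filter fun p => Bw p) := by
    rw [List.perm_ext_iff_of_nodup (nodup_rectList v τ) ((hnd.filter _).filter _)]
    intro p
    rw [List.mem_filter, List.mem_filter, decide_eq_true_eq, decide_eq_true_eq]
    refine ⟨hrectm p, fun h => ?_⟩
    rw [hmem, mem_gateList] at h
    rw [mem_rectList]
    simp only [hFw, hBw] at h
    omega
  have hsplit : ∀ (l : List (ℤ × ℕ)) (Q : ℤ × ℕ → Prop) [DecidablePred Q],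
      ((l.filter fun p => Q p) ++ l.filter fun p => ¬ Q p).Perm l := by
    intro l Q _
    simpa only [decide_not] using List.filter_append_perm (fun p => decide (Q p)) l
  have hperm : l.Perm (G2 ++ (rectList v τ ++ G0)) := by
    have h1 : ((l.filter fun p => Fw p) ++ G0).Perm l := hsplit l Fw
    have h2 : (((l.filter fun p => Fw p).filter fun p => Bw p) ++ G2).Perm
        (l.filter fun p => Fw p) := hsplit _ Bw
    refine h1.symm.trans ?_
    rw [← List.append_assoc]
    refine List.Perm.append_right _ (h2.symm.trans (List.perm_append_comm.trans ?_))
    exact List.Perm.append_left _ hrect.symm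
  -- gates that touch each other and are not in the order of decreasing time
  have key : ∀ p p', p ∈ l → p' ∈ l → (p ≠ p' → p.2 ≤ p'.2 →
      -1 ≤ p.1 - p'.1 → p.1 - p'.1 ≤ 1 → p.2 < p'.2 → False) →  p ≠ p' →
      Commute (gateMat V L p) (gateMat V L p') ∨ p'.2 < p.2 := by
    intro p p' hp hp' h hne
    by_cases h1 : p'.2 < p.2
    · exact Or.inr h1
    · refine Or.inl (gateMat_commute ((hmem p).1 hp) ((hmem p').1 hp') ?_)
      by_contra h2
      have h3 := mem_gateList.1 ((hmem p).1 hp)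
      have h4 := mem_gateList.1 ((hmem p').1 hp')
      have h5 : p.2 ≠ p'.2 := fun e => hne (Prod.ext (by rw [e] at h3; omega) e)
      exact h hne (by omega) (by omega) (by omega) (by omega)
  have hpl : ∀ {l' : List (ℤ × ℕ)}, l'.Sublist l → l'.Pairwise fun p p' =>
      Commute (gateMat V L p) (gateMat V L p') ∨ p'.2 < p.2 := by
    intro l' hl'
    refine List.Pairwise.imp_of_mem (fun {p p'} hp hp' h => ?_) (hlp.sublist hl')
    refine key p p' (hl'.subset hp) (hl'.subset hp') (fun _ _ _ _ _ => by omega) ?_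
    rintro rfl
    omega
  have hp2 : (G2 ++ (rectList v τ ++ G0)).Pairwise fun p p' =>
      Commute (gateMat V L p) (gateMat V L p') ∨ p'.2 < p.2 := by
    rw [List.pairwise_append, List.pairwise_append]
    refine ⟨hpl (List.filter_sublist.trans List.filter_sublist), ⟨?_, hpl List.filter_sublist,
      ?_⟩, ?_⟩
    · refine List.Pairwise.imp_of_mem (fun {p p'} hp hp' h => ?_) (pairwise_rectList v τ)
      exact h.imp_left fun h => gateMat_commute ((hmem p).1 (hrectm p hp).1.1)
        ((hmem p').1 (hrectm p' hp').1.1) h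
    · intro p hp p' hp'
      have h1 := hrectm p hp
      have h2 := (hG0m p').1 hp'
      refine key p p' h1.1.1 h2.1 (fun _ _ _ _ _ => ?_) ?_
      · simp only [hFw, hBw] at h1 h2
        omega
      · rintro rfl
        exact h2.2 h1.1.2
    · intro p hp p' hp'
      have h1 := (hG2m p).1 hp
      rcases List.mem_append.1 hp' with hp' | hp'
      · have h2 := hrectm p' hp'
        refine key p p' h1.1.1 h2.1.1 (fun _ _ _ _ _ => ?_) ?_
        · simp only [hFw, hBw] at h1 h2
          omega
        · rintro rfl
          exact h1.2 h2.2
      · have h2 := (hG0m p').1 hp'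
        refine key p p' h1.1.1 h2.1 (fun _ _ _ _ _ => ?_) ?_
        · simp only [hFw, hBw] at h1 h2
          omega
        · rintro rfl
          exact h2.2 h1.1.2
  rw [prod_eq_of_perm (h := Prod.snd) hperm (hpl (List.Sublist.refl l)) hp2, List.map_append,
    List.map_append, List.prod_append, List.prod_append, ← mulVec_mulVec, ← mulVec_mulVec,
    dotProduct_mulVec, ← rowProd_eq_prod]
  have e0 : (G0.map (gateMat V L)).prod *ᵥ initVec L φ = initVec L φ := by
    refine prod_mulVec_of_forall fun p hp => ?_
    have h := (hG0m p).1 hp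
    rw [hmem, mem_gateList] at h
    simp only [hFw] at h
    refine bondMat_mulVec_prodVec (site_ne_site (by omega) (by omega) (by omega) (by omega)
      (by omega)) fun r => ?_
    rw [coe_site (by omega) (by omega), coe_site (by omega) (by omega), if_neg (by omega),
      if_neg (by omega)]
    exact hV.mul_ket0 r
  have e2 : siteFun (site L ((v : ℤ) - τ)) ψ ᵥ* (G2.map (gateMat V L)).prod =
      siteFun (site L ((v : ℤ) - τ)) ψ := by
    refine vecMul_prod_of_forall fun p hp => ?_
    have h := (hG2m p).1 hp
    rw [hmem, mem_gateList] at h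
    simp only [hFw, hBw] at h
    refine prodVec_vecMul_bondMat (site_ne_site (by omega) (by omega) (by omega) (by omega)
      (by omega)) (fun r => ?_) fun _ _ _ => rfl
    rw [Function.update_of_ne (site_ne_site (by omega) (by omega) (by omega) (by omega)
      (by omega)), Function.update_of_ne (site_ne_site (by omega) (by omega) (by omega) (by omega)
      (by omega))]
    exact hV.ket1_mul r
  rw [e0, e2]

end LightCone

/-! ### The averaged correlator -/

section Correlators

variable {q : ℕ}

lemma siteFun_ket1_dotProduct_rowProd (hq : 0 < q) {V : Matrix (Rep q × Rep q) (Rep q × Rep q) ℂ}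
    (hV : IsChannel V) {v L τ : ℕ} (hv : v ≤ L) (hτ : τ ≤ L) (i : Site L) {φ : Rep q → ℂ}
    (hφ : ket1 ⬝ᵥ φ = 1) : siteFun i ket1 ⬝ᵥ (rowProd V v L τ *ᵥ initVec L φ) = 1 := by
  rw [siteFun_ket1]
  induction τ with
  | zero =>
    rw [rowProd, one_mulVec, initVec, prodVec_dotProduct]
    refine Finset.prod_eq_one fun k _ => ?_
    split_ifs
    · exact hφ
    · exact ket1_dot_ket0 hq
  | succ b ih =>
    have h := injOn_site (v := v + 1) hτ (by omega)
    push_cast at h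
    rw [rowProd, ← mulVec_mulVec, dotProduct_mulVec,
      prodVec_vecMul_row hV h (Or.inl fun _ _ => rfl), ih (by omega)]

variable {Ω : Type*} [MeasurableSpace Ω] {P : Measure Ω} [IsProbabilityMeasure P]
  {u : Ω → Gate q}

/-- The averaged correlator is a matrix element of a product of rows of averaged replicated
gates. -/
lemma integral_otoc (hq : 0 < q)
    (hu : ∀ a b, Measurable fun ω => (u ω : Matrix (Fin q × Fin q) (Fin q × Fin q) ℂ) a b)
    (μ ν : Fin q × Fin q) (v τ : ℕ) :
    ∃ L : ℕ, v ≤ L ∧ τ ≤ L ∧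
      ∫ g, otoc (fun p => u (g p)) μ ν (v + 1) τ ∂(Measure.infinitePi fun _ : ℤ × ℕ => P) =
        siteFun (site L ((v : ℤ) - τ)) (ket1 - obsBra (pauli ν)) ⬝ᵥ
          (rowProd (avgReplica P u) v L τ *ᵥ initVec L (obsKet (pauli μ))) := by
  have hV : IsChannel (avgReplica P u) := isChannel_avgReplica hu
  have hx : (((v + 1 : ℕ) : ℤ) - 1 - τ) = (v : ℤ) - τ := by push_cast; ring
  set L := v + τ + ((v : ℤ) - τ).natAbs with hL
  have hvL : v ≤ L := by omega
  have hτL : τ ≤ L := by omega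
  refine ⟨L, hvL, hτL, ?_⟩
  have h1 : ∀ g : ℤ × ℕ → Ω, otoc (fun p => u (g p)) μ ν (v + 1) τ =
      1 - siteFun (site L ((v : ℤ) - τ)) (obsBra (pauli ν)) ⬝ᵥ
        (((gateList L (v + τ)).reverse.map fun p =>
          bondMat (site L p.1) (site L (p.1 + 1)) (replica (u (g p)))).prod *ᵥ
            initVec L (obsKet (pauli μ))) := by
    intro g
    rw [otoc, hx, Nat.add_sub_cancel, otocXT_eq hq]
  obtain ⟨hint, havg⟩ := integral_dotProduct_prod_mulVec (P := P) hu
    (List.nodup_reverse.2 (nodup_gateList L (v + τ))) (fun p => site L p.1)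
    (fun p => site L (p.1 + 1)) (siteFun (site L ((v : ℤ) - τ)) (obsBra (pauli ν)))
    (initVec L (obsKet (pauli μ)))
  simp only [h1]
  rw [integral_sub (integrable_const _) hint, havg, siteFun_sub, sub_dotProduct,
    siteFun_ket1_dotProduct_rowProd hq hV hvL hτL _
      (ket1_dotProduct_obsKet hq (conjTranspose_pauli_mul_self μ)),
    ← siteFun_dotProduct_circuit hV hvL hτL]
  simp only [integral_const, probReal_univ, one_smul]
  rfl

/-- The averaged correlator of width `v + 1` decays at every rate above `|z₂(v)|`, since its real
part is the weight of a positive functional that vanishes on the identity. -/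
lemma exists_re_integral_otoc_le (hq : 0 < q)
    (hu : ∀ a b, Measurable fun ω => (u ω : Matrix (Fin q × Fin q) (Fin q × Fin q) ℂ) a b)
    (μ ν : Fin q × Fin q) {v : ℕ} (hv : 1 ≤ v) {R : ℝ} (hR : absZ2 (avgReplica P u) v < R) :
    ∃ C : ℝ, ∀ τ : ℕ, (∫ g, otoc (fun p => u (g p)) μ ν (v + 1) τ
      ∂(Measure.infinitePi fun _ : ℤ × ℕ => P)).re ≤ C * R ^ τ := by
  have hV : IsChannel (avgReplica P u) := isChannel_avgReplica hu
  have hB := conjTranspose_pauli_mul_self ν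
  obtain ⟨C, hC⟩ := exists_weight_bound hq hV hv
    (posSemidef_siteForm_commForm (mul_eq_one_comm.1 hB)) (commForm_dotProduct_ket0 hq hB)
    (ket1_dotProduct_obsKet hq (conjTranspose_pauli_mul_self μ))
    (fun L => isState_initVec hq L (pauli μ)) hR
  refine ⟨C, fun τ => ?_⟩
  obtain ⟨L, hvL, hτL, h⟩ := integral_otoc (P := P) hq hu μ ν v τ
  rw [h, ← (isState_rowProd_mulVec hV hvL (isState_initVec hq L (pauli μ)) hτL).re_siteFun_commForm
    hq]
  exact hC L τ hvL hτL

lemma liminf_le_zero_of_le_geometric {f : ℕ → ℝ} {C ρ : ℝ} (hρ : 0 ≤ ρ) (hρ1 : ρ < 1)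
    (hf : ∀ᶠ τ in atTop, f τ ≤ C * ρ ^ τ) :
    liminf (fun τ => (f τ : EReal)) atTop ≤ 0 := by
  have h1 : Tendsto (fun τ : ℕ => C * ρ ^ τ) atTop (nhds 0) := by
    simpa using (tendsto_pow_atTop_nhds_zero_of_lt_one hρ hρ1).const_mul C
  have h2 : Tendsto (fun τ : ℕ => ((C * ρ ^ τ : ℝ) : EReal)) atTop (nhds 0) :=
    (continuous_coe_real_ereal.tendsto 0).comp h1
  rw [← h2.liminf_eq]
  exact liminf_le_liminf (hf.mono fun τ h => EReal.coe_le_coe_iff.2 h)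

/-- The random case. If `|z₂(w)|` exceeded `|z₂(w - 1)|`, the correlator would decay at a rate
strictly between the two, and its ratio to `|z₂(w)|^τ` would tend to `0`. -/
lemma absZ2_eq_of_liminf_pos
    (hu : ∀ a b, Measurable fun ω => (u ω : Matrix (Fin q × Fin q) (Fin q × Fin q) ℂ) a b)
    {w : ℕ} (hw : 2 ≤ w) (μ ν : Fin q × Fin q)
    (h : 0 < liminf (fun τ : ℕ =>
          (((∫ g, otoc (fun p => u (g p)) μ ν w τ
                ∂(Measure.infinitePi fun _ : ℤ × ℕ => P)).re /
            ((τ : ℝ) ^ phi (avgReplica P u) w * absZ2 (avgReplica P u) w ^ τ) : ℝ) : EReal))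
        atTop) :
    absZ2 (avgReplica P u) w = absZ2 (avgReplica P u) (w - 1) := by
  have hq : 0 < q := μ.1.pos
  obtain ⟨v, rfl⟩ : ∃ v, w = v + 1 := ⟨w - 1, by omega⟩
  rw [Nat.add_sub_cancel]
  have hV : IsChannel (avgReplica P u) := isChannel_avgReplica hu
  by_contra hne
  obtain ⟨R, hvR, hRz⟩ := exists_between
    (lt_of_le_of_ne (absZ2_le_succ hq hV v) fun e => hne e.symm)
  have hR : 0 < R := (absZ2_nonneg v).trans_lt hvR
  obtain ⟨C, hC⟩ := exists_re_integral_otoc_le (P := P) hq hu μ ν (by omega : 1 ≤ v) hvR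
  set z := absZ2 (avgReplica P u) (v + 1) with hz
  have hz0 : 0 < z := hR.trans hRz
  refine absurd h (not_lt.2 (liminf_le_zero_of_le_geometric (C := max C 0) (ρ := R / z)
    (by positivity) ((div_lt_one hz0).2 hRz) ?_))
  filter_upwards [eventually_ge_atTop 1] with τ hτ
  have h1 : (1 : ℝ) ≤ (τ : ℝ) ^ phi (avgReplica P u) (v + 1) :=
    one_le_pow₀ (by exact_mod_cast hτ)
  have h2 : 0 ≤ max C 0 * R ^ τ := mul_nonneg (le_max_right _ _) (by positivity)
  rw [div_pow, ← mul_div_assoc]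
  refine (div_le_div_of_nonneg_right ((hC τ).trans
    (mul_le_mul_of_nonneg_right (le_max_left C 0) (by positivity))) (by positivity)).trans ?_
  refine div_le_div_of_nonneg_left h2 (by positivity) ?_
  exact le_mul_of_one_le_left (by positivity) h1

end Correlators

end LLG

end

/-- The first part is about spatial-temporal invariant circuits (all gates equal to `u`), the second
about spatial-temporal random circuits (independent gates, each distributed as `u` under `P`), with
the averaged correlator and the averaged light-like generator. -/
theorem mainTheorem1 (q w : ℕ) (hw : 2 ≤ w) (μ ν : Fin q × Fin q) :
    (∀ u : LLG.Gate q,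
      0 < liminf (fun τ : ℕ =>
          (((LLG.otoc (fun _ => u) μ ν w τ).re /
            ((τ : ℝ) ^ LLG.phi (LLG.replica u) w * LLG.absZ2 (LLG.replica u) w ^ τ) : ℝ) : EReal))
        atTop →
      LLG.absZ2 (LLG.replica u) w = LLG.absZ2 (LLG.replica u) (w - 1)) ∧
    (∀ (Ω : Type*) [MeasurableSpace Ω] (P : Measure Ω) [IsProbabilityMeasure P]
        (u : Ω → LLG.Gate q),
      (∀ a b, Measurable fun ω => (u ω : Matrix (Fin q × Fin q) (Fin q × Fin q) ℂ) a b) →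
      0 < liminf (fun τ : ℕ =>
          (((∫ g, LLG.otoc (fun p => u (g p)) μ ν w τ
                ∂(Measure.infinitePi fun _ : ℤ × ℕ => P)).re /
            ((τ : ℝ) ^ LLG.phi (LLG.avgReplica P u) w *
              LLG.absZ2 (LLG.avgReplica P u) w ^ τ) : ℝ) : EReal))
        atTop →
      LLG.absZ2 (LLG.avgReplica P u) w = LLG.absZ2 (LLG.avgReplica P u) (w - 1)) := by
  refine ⟨fun u h => ?_, fun Ω _ P _ u hu h => LLG.absZ2_eq_of_liminf_pos hu hw μ ν h⟩
  -- a deterministic gate is a random gate on the one-point probability space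
  have hrep : LLG.avgReplica (Measure.dirac ()) (fun _ => u) = LLG.replica u := by
    ext o i
    simp [LLG.avgReplica]
  have key := LLG.absZ2_eq_of_liminf_pos (P := Measure.dirac ()) (u := fun _ => u)
    (fun _ _ => measurable_const) hw μ ν
  simp only [hrep, integral_const, probReal_univ, one_smul] at key
  exact key h
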